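/- Let $\mathbb T^2=\mathbb R^2/\mathbb Z^2$ with normalised Lebesgue measure $\mathrm{Leb}$, let $e_n(x)=e^{2\pi i n\cdot x}$ and, for a real distribution $\omega\in C^\infty(\mathbb T^2)'$, $\widehat\omega(n)=\langle\omega,e_n\rangle$ and $\|\omega\|_{H^s}^2=\sum_{n\in\mathbb Z^2}(1+|n|^2)^s|\widehat\omega(n)|^2$. Let $H^{-1-}(\mathbb T^2)=\bigcap_{\delta>0}H^{-1-\delta}(\mathbb T^2)$ with the metric $d(\omega,\omega')=\sum_{n\ge1}2^{-n}\big(\|\omega-\omega'\|_{H^{-1-1/n}}\wedge1\big)$. For $T>0$ let $\mathcal X=C([0,T];H^{-1-}(\mathbb T^2))$ carry the uniform distance and its Borel $\sigma$-algebra. Let $\epsilon\in(0,1)$ and let $K$ be the kernel of the modified SQG equation on $\mathbb T^2$, $$K(x)=c\sum_{m\in\mathbb Z^2}\frac12\left(\frac{(x+m)^\perp}{|x+m|^{3-\epsilon}}+\frac{(x-m)^\perp}{|x-m|^{3-\epsilon}}\right),\qquad (x_1,x_2)^\perp=(-x_2,x_1),$$ where terms with vanishing denominator are $0$ (so $K(0)=0$)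 and $c\ne0$ is a fixed real constant. (For $c=-\frac{(1-\epsilon)\Gamma((1-\epsilon)/2)}{\pi2^{1+\epsilon}\Gamma((1+\epsilon)/2)}$ this is the convolution kernel of $\nabla^\perp\Lambda^{-1-\epsilon}$, with $\Lambda=(-\Delta)^{1/2}$ and $\nabla^\perp=(-\partial_2,\partial_1)$.) For $N\ge1$ let $\Delta_N\subset(\mathbb T^2)^N$ be the set of $(x_1,\dots,x_N)$ with $x_i=x_j$ for some $i\neq j$, and let $((\xi_1,X_0^1),\dots,(\xi_N,X_0^N))$ be random with law $\lambda_N^0=N(0,1)^{\otimes N}\otimes\mathrm{Leb}^{\otimes N}$, i.e. all these variables are independent, the intensities $\xi_n$ are standard Gaussian and the positions $X_0^n$ are uniform on $\mathbb T^2$. Then: 1. For every $N\ge1$, almost surely there is a unique solution $X_\cdot=(X^1_\cdot,\dots,X^N_\cdot):[0,\infty)\to\Delta_N^c$ of $$\frac{dX^i_t}{dt}=\frac1{\sqrt N}\sum_{j=1}^N\xi_jK(X^i_t-X^j_t),\qquad i=1,\dots,N,$$ started at $(X^1_0,\dots,X^N_0)$, and the point vortex field $\theta^N_t=\frac1{\sqrt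 N}\sum_{n=1}^N\xi_n\delta_{X^n_t}$, $t\in[0,T]$, is a random variable with values in $\mathcal X$ (measurable up to null sets). Let $Q_N$ denote its law. 2. The family $(Q_N)_{N\ge1}$ is tight in $\mathcal X=C([0,T];H^{-1-}(\mathbb T^2))$. 3. There are a subsequence $(Q_{N_k})_k$ and a probability measure $Q$ on $\mathcal X$ such that $Q_{N_k}\to Q$ weakly. -/

import Mathlib

open MeasureTheory ProbabilityTheory Filter Topology

noncomputable section

namespace PointVortex

/-- The plane `ℝ²` with the Euclidean norm. -/
abbrev Plane : Type := EuclideanSpace ℝ (Fin 2)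

/-- The unit torus `𝕋² = ℝ² / ℤ²`; its `volume` is the normalised Lebesgue measure. -/
abbrev Torus : Type := UnitAddTorus (Fin 2)

/-- The quotient map `ℝ² → 𝕋²`. -/
def toTorus (x : Plane) : Torus := fun i => (x i : UnitAddCircle)

/-! ### Distributions on the torus -/

/-- The space `C^∞(𝕋²)` of smooth real functions on the torus. -/
def SmoothFun : Submodule ℝ (Torus → ℝ) where
  carrier := {f | ContDiff ℝ (⊤ : ℕ∞) (fun x : Plane => f (toTorus x))}
  add_mem' {f g} hf hg := by
    simp only [Set.mem_ofPred_eq] at hf hg ⊢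
    exact hf.add hg
  zero_mem' := by
    simp only [Set.mem_ofPred_eq]
    exact contDiff_const
  smul_mem' a f hf := by
    simp only [Set.mem_ofPred_eq] at hf ⊢
    exact (contDiff_const (c := a)).mul hf

/-- `φ` and its derivatives up to order `k` are bounded by `M`, i.e. `‖φ‖_{C^k} ≤ M`. -/
def BoundedBy (φ : SmoothFun) (k : ℕ) (M : ℝ) : Prop :=
  ∀ j ≤ k, ∀ x : Plane, ‖iteratedFDeriv ℝ j (fun y : Plane => φ.1 (toTorus y)) x‖ ≤ M

/-- The space `C^∞(𝕋²)'` of (real) distributions on the torus: the linear functionals on `C^∞(𝕋²)`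
which are continuous, that is, bounded by a multiple of some `C^k` norm. -/
def distributions : Submodule ℝ (SmoothFun →ₗ[ℝ] ℝ) where
  carrier := {ω | ∃ (C : ℝ) (k : ℕ), ∀ (φ : SmoothFun) (M : ℝ), BoundedBy φ k M → |ω φ| ≤ C * M}
  add_mem' := by
    rintro ω₁ ω₂ ⟨C₁, k₁, h₁⟩ ⟨C₂, k₂, h₂⟩
    refine ⟨C₁ + C₂, max k₁ k₂, fun φ M hM => ?_⟩
    have e₁ := h₁ φ M fun j hj => hM j (hj.trans (le_max_left _ _))
    have e₂ := h₂ φ M fun j hj => hM j (hj.trans (le_max_right _ _))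
    calc |(ω₁ + ω₂) φ| ≤ |ω₁ φ| + |ω₂ φ| := abs_add_le _ _
      _ ≤ (C₁ + C₂) * M := by linarith
  zero_mem' := ⟨0, 0, fun φ M _ => by simp⟩
  smul_mem' := by
    rintro a ω ⟨C, k, h⟩
    refine ⟨|a| * C, k, fun φ M hM => ?_⟩
    calc |(a • ω) φ| = |a| * |ω φ| := by simp [abs_mul]
      _ ≤ |a| * (C * M) := mul_le_mul_of_nonneg_left (h φ M hM) (abs_nonneg a)
      _ = |a| * C * M := by ring

/-- The space `C^∞(𝕋²)'` as a type. -/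
def Distribution : Type := distributions

instance : AddCommGroup Distribution := inferInstanceAs (AddCommGroup distributions)

instance : Module ℝ Distribution := inferInstanceAs (Module ℝ distributions)

/-- The duality `⟨ω, φ⟩`. -/
def Distribution.pair (ω : Distribution) (φ : SmoothFun) : ℝ := ω.1 φ

theorem toTorus_surjective : Function.Surjective toTorus := by
  intro x
  choose y hy using fun i => QuotientAddGroup.mk_surjective (x i)
  exact ⟨WithLp.toLp 2 y, funext hy⟩

/-- The Dirac mass `δ_x` at `x ∈ 𝕋²`, as a distribution. -/
def dirac (x : Torus) : Distribution :=
  ⟨{ toFun := fun φ => φ.1 x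
     map_add' := fun _ _ => rfl
     map_smul' := fun _ _ => rfl },
   1, 0, fun φ M hM => by
    obtain ⟨y, rfl⟩ := toTorus_surjective x
    simpa using hM 0 le_rfl y⟩

theorem contDiff_mFourier (n : Fin 2 → ℤ) :
    ContDiff ℝ (⊤ : ℕ∞) (fun x : Plane => UnitAddTorus.mFourier n (toTorus x)) := by
  have : (fun x : Plane => UnitAddTorus.mFourier n (toTorus x)) =
      fun x : Plane => ∏ i, Complex.exp (2 * Real.pi * Complex.I * n i * (x i : ℝ)) := by
    funext x
    simp only [UnitAddTorus.mFourier, toTorus, ContinuousMap.coe_mk, fourier_coe_apply]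
    simp
  rw [this]
  refine contDiff_prod fun i _ => ?_
  refine ContDiff.cexp (contDiff_const.mul ?_)
  exact Complex.ofRealCLM.contDiff.comp (by fun_prop)

/-- The real part `x ↦ cos (2π n · x)` of `e_n(x) = exp (2π i n · x)`. -/
def cosFun (n : Fin 2 → ℤ) : SmoothFun :=
  ⟨fun x => (UnitAddTorus.mFourier n x).re,
    Complex.reCLM.contDiff.comp (contDiff_mFourier n)⟩

/-- The imaginary part `x ↦ sin (2π n · x)` of `e_n(x) = exp (2π i n · x)`. -/
def sinFun (n : Fin 2 → ℤ) : SmoothFun :=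
  ⟨fun x => (UnitAddTorus.mFourier n x).im,
    Complex.imCLM.contDiff.comp (contDiff_mFourier n)⟩

/-- The Fourier coefficient `ω̂(n) = ⟨ω, e_n⟩`. -/
def fourierCoeff (ω : Distribution) (n : Fin 2 → ℤ) : ℂ :=
  ⟨ω.pair (cosFun n), ω.pair (sinFun n)⟩

theorem fourierCoeff_add (ω ω' : Distribution) (n : Fin 2 → ℤ) :
    fourierCoeff (ω + ω') n = fourierCoeff ω n + fourierCoeff ω' n := rfl

theorem fourierCoeff_smul (a : ℝ) (ω : Distribution) (n : Fin 2 → ℤ) :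
    fourierCoeff (a • ω) n = (a : ℂ) * fourierCoeff ω n := by
  have h : ∀ φ, (a • ω).pair φ = a * ω.pair φ := fun _ => rfl
  apply Complex.ext <;> simp [fourierCoeff, h]

theorem fourierCoeff_zero (n : Fin 2 → ℤ) : fourierCoeff 0 n = 0 := rfl

/-! ### Sobolev spaces on the torus -/

/-- The weight `(1 + |n|²)^s`. -/
def sobolevWeight (s : ℝ) (n : Fin 2 → ℤ) : ℝ := (1 + ∑ i, (n i : ℝ) ^ 2) ^ s

theorem sobolevWeight_nonneg (s : ℝ) (n : Fin 2 → ℤ) : 0 ≤ sobolevWeight s n :=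
  Real.rpow_nonneg (by positivity) _

/-- `ω ∈ H^s(𝕋²)`, i.e. `∑_n (1 + |n|²)^s |ω̂(n)|² < ∞`. -/
def MemSobolev (s : ℝ) (ω : Distribution) : Prop :=
  Summable fun n : Fin 2 → ℤ => sobolevWeight s n * ‖fourierCoeff ω n‖ ^ 2

/-- The norm of `H^s(𝕋²)` (meaningful on `H^s(𝕋²)`). -/
def sobolevNorm (s : ℝ) (ω : Distribution) : ℝ :=
  √(∑' n : Fin 2 → ℤ, sobolevWeight s n * ‖fourierCoeff ω n‖ ^ 2)

theorem MemSobolev.zero (s : ℝ) : MemSobolev s 0 := by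
  simp [MemSobolev, fourierCoeff_zero]

theorem MemSobolev.smul {s : ℝ} {ω : Distribution} (a : ℝ) (h : MemSobolev s ω) :
    MemSobolev s (a • ω) := by
  refine (Summable.mul_left (a ^ 2) h).congr fun n => ?_
  rw [fourierCoeff_smul, norm_mul, mul_pow, Complex.norm_real, Real.norm_eq_abs, sq_abs]
  ring

theorem memSobolev_add_and_norm_le {s : ℝ} {ω ω' : Distribution} (h : MemSobolev s ω)
    (h' : MemSobolev s ω') :
    MemSobolev s (ω + ω') ∧
      sobolevNorm s (ω + ω') ≤ sobolevNorm s ω + sobolevNorm s ω' := by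
  have key : ∀ (η : Distribution) (n : Fin 2 → ℤ),
      (√(sobolevWeight s n) * ‖fourierCoeff η n‖) ^ (2 : ℝ) =
        sobolevWeight s n * ‖fourierCoeff η n‖ ^ 2 := fun η n => by
    rw [Real.rpow_two, mul_pow, Real.sq_sqrt (sobolevWeight_nonneg s n)]
  have hnn : ∀ (η : Distribution) (n : Fin 2 → ℤ),
      0 ≤ √(sobolevWeight s n) * ‖fourierCoeff η n‖ := fun η n => by positivity
  obtain ⟨hs, hle⟩ := Real.Lp_add_le_tsum_of_nonneg (p := 2) (by norm_num) (hnn ω) (hnn ω')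
    (by simpa only [key, MemSobolev] using h) (by simpa only [key, MemSobolev] using h')
  have hcmp : ∀ n : Fin 2 → ℤ, sobolevWeight s n * ‖fourierCoeff (ω + ω') n‖ ^ 2 ≤
      (√(sobolevWeight s n) * ‖fourierCoeff ω n‖ +
        √(sobolevWeight s n) * ‖fourierCoeff ω' n‖) ^ (2 : ℝ) := fun n => by
    rw [← key, ← mul_add]
    exact Real.rpow_le_rpow (hnn _ n) (mul_le_mul_of_nonneg_left
      (by rw [fourierCoeff_add]; exact norm_add_le _ _) (Real.sqrt_nonneg _)) (by norm_num)
  have hmem : MemSobolev s (ω + ω') := Summable.of_nonneg_of_le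
    (fun n => mul_nonneg (sobolevWeight_nonneg s n) (by positivity)) hcmp hs
  refine ⟨hmem, ?_⟩
  simp only [key, ← Real.sqrt_eq_rpow] at hle
  exact (Real.sqrt_le_sqrt (hmem.tsum_le_tsum hcmp hs)).trans hle

theorem sobolevNorm_neg (s : ℝ) (ω : Distribution) : sobolevNorm s (-ω) = sobolevNorm s ω := by
  have : ∀ n, ‖fourierCoeff (-ω) n‖ = ‖fourierCoeff ω n‖ := fun n => by
    rw [← neg_one_smul ℝ ω, fourierCoeff_smul]; simp
  simp only [sobolevNorm, this]

theorem sobolevNorm_zero (s : ℝ) : sobolevNorm s 0 = 0 := by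
  simp [sobolevNorm, fourierCoeff_zero]

theorem sobolevNorm_nonneg (s : ℝ) (ω : Distribution) : 0 ≤ sobolevNorm s ω := Real.sqrt_nonneg _

/-- The space `H^{-1-}(𝕋²) = ⋂_{δ > 0} H^{-1-δ}(𝕋²)` as a subspace of the distributions. -/
def hMinusOneMinus : Submodule ℝ Distribution where
  carrier := {ω | ∀ δ : ℝ, 0 < δ → MemSobolev (-1 - δ) ω}
  add_mem' h h' δ hδ := (memSobolev_add_and_norm_le (h δ hδ) (h' δ hδ)).1
  zero_mem' _ _ := MemSobolev.zero _
  smul_mem' a _ h δ hδ := (h δ hδ).smul a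

/-- The space `H^{-1-}(𝕋²)` as a type. -/
def HMinus : Type := hMinusOneMinus

instance : AddCommGroup HMinus := inferInstanceAs (AddCommGroup hMinusOneMinus)

instance : Module ℝ HMinus := inferInstanceAs (Module ℝ hMinusOneMinus)

/-- An element of `H^{-1-}(𝕋²)` as a distribution. -/
def HMinus.toDistribution (ω : HMinus) : Distribution := ω.1

/-- The `k`-th term (`k = 0, 1, 2, …`) of the metric of `H^{-1-}(𝕋²)`. -/
def HMinus.distTerm (ω ω' : HMinus) (k : ℕ) : ℝ :=
  (1 / 2 : ℝ) ^ (k + 1) *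
    min (sobolevNorm (-1 - 1 / ((k : ℝ) + 1)) (ω.toDistribution - ω'.toDistribution)) 1

theorem HMinus.distTerm_nonneg (ω ω' : HMinus) (k : ℕ) : 0 ≤ HMinus.distTerm ω ω' k :=
  mul_nonneg (by positivity) (le_min (sobolevNorm_nonneg _ _) zero_le_one)

theorem HMinus.summable_distTerm (ω ω' : HMinus) : Summable (HMinus.distTerm ω ω') := by
  refine Summable.of_nonneg_of_le (HMinus.distTerm_nonneg ω ω')
    (fun k => ?_) ((summable_nat_add_iff 1).2 summable_geometric_two)
  exact mul_le_of_le_one_right (by positivity) (min_le_right _ _)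

theorem HMinus.distTerm_triangle (ω₁ ω₂ ω₃ : HMinus) (k : ℕ) :
    HMinus.distTerm ω₁ ω₃ k ≤ HMinus.distTerm ω₁ ω₂ k + HMinus.distTerm ω₂ ω₃ k := by
  have hmem : ∀ η η' : HMinus, MemSobolev (-1 - 1 / ((k : ℝ) + 1))
      (η.toDistribution - η'.toDistribution) := fun η η' =>
    hMinusOneMinus.sub_mem η.2 η'.2 _ (by positivity)
  have h := (memSobolev_add_and_norm_le (hmem ω₁ ω₂) (hmem ω₂ ω₃)).2
  rw [sub_add_sub_cancel] at h
  unfold HMinus.distTerm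
  rw [← mul_add]
  refine mul_le_mul_of_nonneg_left ?_ (by positivity)
  have a := sobolevNorm_nonneg (-1 - 1 / ((k : ℝ) + 1)) (ω₁.toDistribution - ω₂.toDistribution)
  have b := sobolevNorm_nonneg (-1 - 1 / ((k : ℝ) + 1)) (ω₂.toDistribution - ω₃.toDistribution)
  rcases min_cases (sobolevNorm (-1 - 1 / ((k : ℝ) + 1))
      (ω₁.toDistribution - ω₂.toDistribution)) 1 with ⟨e, _⟩ | ⟨e, _⟩ <;>
  rcases min_cases (sobolevNorm (-1 - 1 / ((k : ℝ) + 1))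
      (ω₂.toDistribution - ω₃.toDistribution)) 1 with ⟨e', _⟩ | ⟨e', _⟩ <;>
  rw [e, e']
  · exact (min_le_left _ _).trans h
  all_goals exact (min_le_right _ _).trans (by linarith)

/-- The metric `d(ω, ω') = ∑_{n ≥ 1} 2^{-n} (‖ω - ω'‖_{H^{-1-1/n}} ∧ 1)` of `H^{-1-}(𝕋²)`. -/
instance : PseudoMetricSpace HMinus where
  dist ω ω' := ∑' k : ℕ, HMinus.distTerm ω ω' k
  dist_self ω := by simp only [HMinus.distTerm, sub_self, sobolevNorm_zero]; simp
  dist_comm ω ω' := by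
    refine tsum_congr fun k => ?_
    unfold HMinus.distTerm
    rw [← neg_sub ω'.toDistribution, sobolevNorm_neg]
  dist_triangle ω₁ ω₂ ω₃ := by
    rw [← (HMinus.summable_distTerm ω₁ ω₂).tsum_add (HMinus.summable_distTerm ω₂ ω₃)]
    exact (HMinus.summable_distTerm ω₁ ω₃).tsum_le_tsum (HMinus.distTerm_triangle ω₁ ω₂ ω₃)
      ((HMinus.summable_distTerm ω₁ ω₂).add (HMinus.summable_distTerm ω₂ ω₃))

/-- The path space `𝒳 = C([0,T]; H^{-1-}(𝕋²))` with the topology of uniform convergence. -/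
abbrev PathSpace (T : ℝ) : Type := C(Set.Icc (0 : ℝ) T, HMinus)

/-- The path space carries its Borel `σ`-algebra. -/
instance (T : ℝ) : MeasurableSpace (PathSpace T) := borel _

instance (T : ℝ) : BorelSpace (PathSpace T) := ⟨rfl⟩

/-! ### The point vortex system -/

/-- The whole space kernel `x^⊥ / |x|^{3-ε}`, with value `0` at the origin. -/
def planeKernel (ε : ℝ) (x : Plane) : Plane := (‖x‖ ^ (3 - ε))⁻¹ • !₂[-(x 1), x 0]

/-- The lattice vector `m ∈ ℤ²` as an element of the plane. -/
def latticePoint (m : Fin 2 → ℤ) : Plane := WithLp.toLp 2 fun i => (m i : ℝ)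

/-- The kernel `K` of the modified SQG equation on the torus, as a `ℤ²`-periodic function on the
plane: the periodisation `∑_{m ∈ ℤ²} c (x + m)^⊥ / |x + m|^{3-ε}`, in which the terms of `m` and
`-m` are averaged, which makes the series absolutely convergent for `0 < ε < 1`. For
`c = - (1 - ε) Γ((1 - ε) / 2) / (π 2^(1 + ε) Γ((1 + ε) / 2))` this is the convolution kernel of
`∇^⊥ Λ^{-1-ε}` with `∇^⊥ = (-∂₂, ∂₁)`. -/
def kernel (c ε : ℝ) (x : Plane) : Plane :=
  c • ∑' m : Fin 2 → ℤ,
    (1 / 2 : ℝ) • (planeKernel ε (x + latticePoint m) + planeKernel ε (x - latticePoint m))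

/-- The set `Δ_N` of configurations in which two vortices coincide. -/
def collisionSet (N : ℕ) : Set (Fin N → Torus) := {x | ∃ i j, i ≠ j ∧ x i = x j}

/-- `X : [0,∞) → Δ_N^c` solves the point vortex system
`dx_i/dt = N^{-1/2} ∑_j ξ_j K(x_i - x_j)`, where `v i = (ξ_i, x_i(0))` are the intensities and the
initial positions. The differential equation is written for a lift `Y` of `X` to `ℝ²`.
(Values of `X` and `Y` at negative times are irrelevant.) -/
structure IsVortexSolution (c ε : ℝ) {N : ℕ} (v : Fin N → ℝ × Torus)
    (X : ℝ → Fin N → Torus) : Prop where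
  initial : ∀ i, X 0 i = (v i).2
  no_collision : ∀ t, 0 ≤ t → X t ∉ collisionSet N
  ode : ∃ Y : ℝ → Fin N → Plane, (∀ t, 0 ≤ t → ∀ i, toTorus (Y t i) = X t i) ∧
    ∀ t, 0 ≤ t → ∀ i, HasDerivWithinAt (fun s => Y s i)
      ((√(N : ℝ))⁻¹ • ∑ j, (v j).1 • kernel c ε (Y t i - Y t j)) (Set.Ici 0) t

/-- The point vortex field `N^{-1/2} ∑_n ξ_n δ_{x_n}`. -/
def vortexField {N : ℕ} (v : Fin N → ℝ × Torus) (x : Fin N → Torus) : Distribution :=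
  (√(N : ℝ))⁻¹ • ∑ n, (v n).1 • dirac (x n)

/-- `u` is the path `t ↦ N^{-1/2} ∑_n ξ_n δ_{X_t^n}` of the point vortex field on `[0,T]`, where `X`
is a solution of the point vortex system with the intensities and initial positions `v`. -/
def IsVortexFieldPath (c ε T : ℝ) {N : ℕ} (v : Fin N → ℝ × Torus) (u : PathSpace T) : Prop :=
  ∃ X : ℝ → Fin N → Torus, IsVortexSolution c ε v X ∧
    ∀ t : Set.Icc (0 : ℝ) T, (u t).toDistribution = vortexField v (X t)

open Classical in
/-- The random path `θ^N`, as a function of the intensities and initial positions `v` (set to `0`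
on the set of those `v` for which the point vortex system has no solution). -/
def theta (c ε T : ℝ) (N : ℕ) (v : Fin N → ℝ × Torus) : PathSpace T :=
  if h : ∃ u : PathSpace T, IsVortexFieldPath c ε T v u then h.choose else 0

/-- The law `λ_N^0 = (⊗_N N(0,1)) ⊗ Leb` of the intensities and initial positions. -/
def initialLaw (N : ℕ) : Measure (Fin N → ℝ × Torus) :=
  Measure.pi fun _ => (gaussianReal 0 1).prod volume

/-- The law `Q_N` of `θ^N` on the path space. -/
def thetaLaw (c ε T : ℝ) (N : ℕ) : Measure (PathSpace T) :=
  (initialLaw N).map (theta c ε T N)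

end PointVortex

end

open MeasureTheory ProbabilityTheory Filter Topology

set_option linter.unusedSectionVars false

noncomputable section

namespace PointVortex

/-! ### Summability of Sobolev weights and logarithmic bounds -/

/-! The kernel is replaced by a smooth truncation at distance `δ` from the lattice, which is still
odd, periodic and divergence free. The truncated vortex system has a global flow, and for fixed
intensities its drift is divergence free on `(𝕋²)^N`. Hence independent Gaussian intensities and
uniform positions form an invariant law (`IsRegularKernel.measurePreserving_vortexFlow`). The
expected time integral of a functional along the flow is therefore `T` times its expectation under
this law (`IsRegularKernel.lintegral_timeIntegral`). All estimates along trajectories reduce to such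
static integrals, with constants that do not depend on `δ`.

Collisions. For `z = x_i - x_j` consider `-log (gap z + δ²)`, where `gap` is comparable to the
squared distance. Its time derivative is of order `|z|⁻¹` times the relative velocity. The velocity
that the two vortices induce on each other has size `|z|^{-(2-ε)}`, and the product `|z|^{-(3-ε)}`
would not be integrable. That velocity is however orthogonal to `z` up to a Lipschitz error, which
brings the contribution of the pair down to the integrable `|z|^{-(2-ε)}`
(`exists_ofReal_gapDeriv_torusKernel_le`). A third vortex contributes terms such as `|x_i - x_j|⁻¹
|x_i - x_m|^{-(2-ε)}`, integrable because `x_i - x_j` and `x_i - x_m` are independent. By Markov's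
inequality two vortices come within `δ` before time `T` with probability at most `M / log (1 / (13
δ²))`, with `M` independent of `δ` (`exists_measure_nearCollision_le`). Off this event the truncated
flow solves the original system, and `δ → 0` gives almost sure global existence. Uniqueness is
deterministic: a collision free solution keeps a positive distance on compact time intervals, so it
is a truncated flow for all small `δ`. Thus `theta` is almost surely a limit of continuous functions
of the data, which gives measurability.

Tightness. Let `z(t)` be the real or imaginary part of the Fourier mode `n`. Under the invariant law
and for given positions it is centred Gaussian of variance at most `1`, so it has exponential
moments. Since the kernel is odd, its time derivative is a quadratic form in the intensities with
coefficients `N⁻¹` times a symmetrised kernel of size `(1 + |n|²) |x_i - x_j|^{-(1-ε)}`. This is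
square integrable because `ε > 0`, and it vanishes on the diagonal; the second moment of the
derivative is therefore `O((1 + |n|²)²)` uniformly in `N` and `δ`. The inequality `|(e^{2z} +
e^{-2z})'| ≤ z'² + (e^{2z} + e^{-2z})²` turns these static moments into a bound for the supremum of
`e^{2|z|}` over `[0, T]`, and the bound on `∫ z'²` gives Hölder continuity of exponent `1/2`.
Markov's inequality at height `e^A (1 + |n|²)⁴` leaves probabilities `O(e^{-A} (1 + |n|²)^{-2})`,
summable over `ℤ²`. Outside an event of probability `O(e^{-A})` all modes are bounded by `A + 4 log
(1 + |n|²)` with explicit moduli of continuity. Logarithmic growth is negligible in every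
`H^{-1-δ}`, so such paths form a relatively compact set (`exists_isCompact_pathSpace`). Prokhorov's
theorem gives the convergent subsequence. -/

/-- The quantity `1 + |n|²`. -/
def bracketSq (n : Fin 2 → ℤ) : ℝ := 1 + ∑ i, (n i : ℝ) ^ 2

theorem one_le_bracketSq (n : Fin 2 → ℤ) : 1 ≤ bracketSq n :=
  le_add_of_nonneg_right (by positivity)

theorem bracketSq_pos (n : Fin 2 → ℤ) : 0 < bracketSq n :=
  zero_lt_one.trans_le (one_le_bracketSq n)

theorem sobolevWeight_eq (s : ℝ) (n : Fin 2 → ℤ) : sobolevWeight s n = bracketSq n ^ s := rfl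

/-- Comparison with the lattice sum of `‖n‖^{2s}` in the sup norm, which converges since `-2s > 2`.
The origin, where the comparison fails, is a single exception. -/
theorem summable_sobolevWeight {s : ℝ} (hs : s < -1) : Summable (sobolevWeight s) := by
  have h := EisensteinSeries.summable_one_div_norm_rpow (k := -(2 * s)) (by linarith)
  refine Summable.of_norm_bounded_eventually h ?_
  have : ∀ᶠ n : Fin 2 → ℤ in cofinite, n ≠ 0 := by
    exact (Set.finite_singleton (0 : Fin 2 → ℤ)).compl_mem_cofinite
  filter_upwards [this] with n hn
  have hn' : 0 < ‖n‖ := norm_pos_iff.2 hn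
  rw [Real.norm_of_nonneg (sobolevWeight_nonneg s n), neg_neg, Real.rpow_mul hn'.le,
    Real.rpow_two, sobolevWeight_eq]
  refine Real.rpow_le_rpow_of_nonpos (by positivity) ?_ (by linarith)
  obtain ⟨i, hi⟩ : ∃ i, ‖n‖ = ‖n i‖ := by
    obtain ⟨i, -, hi⟩ := Finset.exists_mem_eq_sup' Finset.univ_nonempty fun i => ‖n i‖₊
    exact ⟨i, by rw [Pi.norm_def, ← Finset.sup'_eq_sup Finset.univ_nonempty, hi]; rfl⟩
  rw [hi, Int.norm_eq_abs, sq_abs, bracketSq]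
  have := Finset.single_le_sum (f := fun i => (n i : ℝ) ^ 2) (fun i _ => sq_nonneg _)
    (Finset.mem_univ i)
  linarith

/-- The bound `A + 4 log (1 + |n|²)`. -/
def logBound (A : ℝ) (n : Fin 2 → ℤ) : ℝ := A + 4 * Real.log (bracketSq n)

theorem le_logBound (A : ℝ) (n : Fin 2 → ℤ) : A ≤ logBound A n :=
  le_add_of_nonneg_right (by have := Real.log_nonneg (one_le_bracketSq n); positivity)

/-- A logarithm costs less than any power: `logBound A n` is at most a constant times `(1 +
|n|²)^{δ/4}`. Its square uses up `δ/2`, and the exponent `-1 - δ/2` is still summable. -/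
theorem summable_sobolevWeight_mul_logBound {δ A : ℝ} (hδ : 0 < δ) (hA : 0 ≤ A) :
    Summable fun n => sobolevWeight (-1 - δ) n * logBound A n ^ 2 := by
  refine Summable.of_nonneg_of_le (fun _ => mul_nonneg (sobolevWeight_nonneg _ _) (sq_nonneg _))
    (fun n => ?_) ((summable_sobolevWeight (s := -1 - δ / 2) (by linarith)).mul_left
      ((A + 4 / (δ / 4)) ^ 2))
  have hb := bracketSq_pos n
  have h1 : 1 ≤ bracketSq n ^ (δ / 4) := Real.one_le_rpow (one_le_bracketSq n) (by positivity)
  have h2 := Real.log_le_rpow_div hb.le (ε := δ / 4) (by positivity)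
  have h3 : logBound A n ≤ (A + 4 / (δ / 4)) * bracketSq n ^ (δ / 4) := by
    calc logBound A n ≤ A * bracketSq n ^ (δ / 4) + 4 * (bracketSq n ^ (δ / 4) / (δ / 4)) :=
          add_le_add (le_mul_of_one_le_right hA h1) (by linarith)
      _ = _ := by ring
  have h4 : 0 ≤ logBound A n := hA.trans (le_logBound A n)
  have h5 : sobolevWeight (-1 - δ / 2) n =
      sobolevWeight (-1 - δ) n * (bracketSq n ^ (δ / 4)) ^ 2 := by
    rw [sobolevWeight_eq, sobolevWeight_eq, ← Real.rpow_natCast, ← Real.rpow_mul hb.le,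
      ← Real.rpow_add hb]
    congr 1
    push_cast
    ring
  calc sobolevWeight (-1 - δ) n * logBound A n ^ 2
      ≤ sobolevWeight (-1 - δ) n * ((A + 4 / (δ / 4)) * bracketSq n ^ (δ / 4)) ^ 2 :=
        mul_le_mul_of_nonneg_left (pow_le_pow_left₀ h4 h3 2) (sobolevWeight_nonneg _ _)
    _ = _ := by rw [h5]; ring

theorem memSobolev_of_le_logBound {ω : Distribution} {A δ : ℝ} (hA : 0 ≤ A) (hδ : 0 < δ)
    (h : ∀ n, ‖fourierCoeff ω n‖ ≤ logBound A n) : MemSobolev (-1 - δ) ω :=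
  Summable.of_nonneg_of_le (fun _ => mul_nonneg (sobolevWeight_nonneg _ _) (sq_nonneg _))
    (fun n => mul_le_mul_of_nonneg_left (pow_le_pow_left₀ (norm_nonneg _) (h n) 2)
      (sobolevWeight_nonneg _ _)) (summable_sobolevWeight_mul_logBound hδ hA)

theorem mem_hMinusOneMinus_of_le_logBound {ω : Distribution} {A : ℝ} (hA : 0 ≤ A)
    (h : ∀ n, ‖fourierCoeff ω n‖ ≤ logBound A n) : ω ∈ hMinusOneMinus :=
  fun _ hδ => memSobolev_of_le_logBound hA hδ h

theorem fourierCoeff_sub (ω ω' : Distribution) (n : Fin 2 → ℤ) :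
    fourierCoeff (ω - ω') n = fourierCoeff ω n - fourierCoeff ω' n := rfl

theorem fourierCoeff_neg_index (ω : Distribution) (n : Fin 2 → ℤ) :
    fourierCoeff ω (-n) = (starRingEnd ℂ) (fourierCoeff ω n) := by
  have h1 : cosFun (-n) = cosFun n := Subtype.ext (funext fun x => by
    simp [cosFun, UnitAddTorus.mFourier_neg])
  have h2 : sinFun (-n) = -sinFun n := Subtype.ext (funext fun x => by
    simp [sinFun, UnitAddTorus.mFourier_neg])
  have h3 : ω.pair (-sinFun n) = -ω.pair (sinFun n) := map_neg ω.1 _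
  apply Complex.ext <;> simp [fourierCoeff, h1, h2, h3]

/-! ### Convergence in `H^{-1-}` from convergence of Fourier coefficients -/

theorem HMinus.dist_eq (ω ω' : HMinus) : dist ω ω' = ∑' k : ℕ, HMinus.distTerm ω ω' k := rfl

/-- Dominated convergence, twice: the logarithmic bound dominates the Fourier series of each Sobolev
norm, and the factors `2^{-(k+1)}` dominate the series of the metric. -/
theorem HMinus.tendsto_of_fourierCoeff {α : Type*} {l : Filter α} {u : α → HMinus} {w : HMinus}
    {A : ℝ} (hA : 0 ≤ A)
    (hu : ∀ᶠ a in l, ∀ n, ‖fourierCoeff (u a).toDistribution n‖ ≤ logBound A n)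
    (hw : ∀ n, ‖fourierCoeff w.toDistribution n‖ ≤ logBound A n)
    (h : ∀ n, Tendsto (fun a => fourierCoeff (u a).toDistribution n) l
      (𝓝 (fourierCoeff w.toDistribution n))) : Tendsto u l (𝓝 w) := by
  rw [tendsto_iff_dist_tendsto_zero]
  have hk : ∀ k : ℕ, Tendsto (fun a => HMinus.distTerm (u a) w k) l (𝓝 0) := by
    intro k
    have hδ : (0 : ℝ) < 1 / ((k : ℝ) + 1) := by positivity
    have hs : Tendsto (fun a => ∑' n, sobolevWeight (-1 - 1 / ((k : ℝ) + 1)) n *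
        ‖fourierCoeff ((u a).toDistribution - w.toDistribution) n‖ ^ 2) l (𝓝 (∑' _ : Fin 2 → ℤ, 0)) := by
      refine tendsto_tsum_of_dominated_convergence
        ((summable_sobolevWeight_mul_logBound hδ hA).mul_left 4) (fun n => ?_) ?_
      · have := ((h n).sub_const (fourierCoeff w.toDistribution n)).norm.pow 2
        simpa [fourierCoeff_sub] using this.const_mul (sobolevWeight (-1 - 1 / ((k : ℝ) + 1)) n)
      · filter_upwards [hu] with a ha n
        rw [Real.norm_of_nonneg (mul_nonneg (sobolevWeight_nonneg _ _) (sq_nonneg _)),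
          fourierCoeff_sub]
        have h1 : ‖fourierCoeff (u a).toDistribution n - fourierCoeff w.toDistribution n‖ ≤
            2 * logBound A n := (norm_sub_le _ _).trans (by linarith [ha n, hw n])
        calc _ ≤ sobolevWeight (-1 - 1 / ((k : ℝ) + 1)) n * (2 * logBound A n) ^ 2 :=
              mul_le_mul_of_nonneg_left (pow_le_pow_left₀ (norm_nonneg _) h1 2)
                (sobolevWeight_nonneg _ _)
          _ = _ := by ring
    rw [tsum_zero] at hs
    have := ((hs.sqrt).min (tendsto_const_nhds (x := (1 : ℝ)))).const_mul ((1 / 2 : ℝ) ^ (k + 1))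
    simpa [HMinus.distTerm, sobolevNorm] using this
  have := tendsto_tsum_of_dominated_convergence (f := fun a k => HMinus.distTerm (u a) w k)
    (𝓕 := l) ((summable_nat_add_iff 1).2 summable_geometric_two) hk (Eventually.of_forall
      fun a k => by
        rw [Real.norm_of_nonneg (HMinus.distTerm_nonneg _ _ k)]
        exact mul_le_of_le_one_right (by positivity) (min_le_right _ _))
  simpa [HMinus.dist_eq] using this

/-! ### Decay of the Fourier coefficients of smooth functions -/

/-- The integral `∫ φ e_m`. -/
def smoothCoeff (φ : SmoothFun) (m : Fin 2 → ℤ) : ℂ :=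
  ∫ x : Torus, (φ.1 x : ℂ) * UnitAddTorus.mFourier m x

theorem toTorus_add (x y : Plane) : toTorus (x + y) = toTorus x + toTorus y := by
  funext i
  simp [toTorus]

theorem toTorus_neg (x : Plane) : toTorus (-x) = -toTorus x := by
  funext i
  simp [toTorus]

theorem toTorus_sub (x y : Plane) : toTorus (x - y) = toTorus x - toTorus y := by
  funext i
  simp [toTorus]

theorem toTorus_zero : toTorus 0 = 0 := by
  funext i
  simp [toTorus]

theorem isOpenQuotientMap_toTorus : IsOpenQuotientMap toTorus := by
  have h1 : IsOpenQuotientMap (fun (x : Fin 2 → ℝ) i => (x i : UnitAddCircle)) :=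
    IsOpenQuotientMap.piMap fun _ => QuotientAddGroup.isOpenQuotientMap_mk
  exact h1.comp (PiLp.homeomorph 2 fun _ : Fin 2 => ℝ).isOpenQuotientMap

theorem continuous_smoothFun (φ : SmoothFun) : Continuous φ.1 :=
  isOpenQuotientMap_toTorus.isQuotientMap.continuous_iff.2
    (show ContDiff ℝ (⊤ : ℕ∞) (fun x : Plane => φ.1 (toTorus x)) from φ.2).continuous

/-- The difference `φ(· + h) - φ`. -/
def shiftDiff (φ : SmoothFun) (h : Plane) : SmoothFun :=
  ⟨fun x => φ.1 (x + toTorus h) - φ.1 x, by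
    have h1 : ContDiff ℝ (⊤ : ℕ∞) (fun y : Plane => φ.1 (toTorus (y + h))) :=
      (show ContDiff ℝ (⊤ : ℕ∞) (fun x : Plane => φ.1 (toTorus x)) from φ.2).comp
        (contDiff_id.add contDiff_const)
    have h2 := h1.sub (show ContDiff ℝ (⊤ : ℕ∞) (fun x : Plane => φ.1 (toTorus x)) from φ.2)
    simp only [toTorus_add] at h2
    exact h2⟩

/-- Mean value inequality: a difference trades one derivative for a factor `‖h‖`. -/
theorem boundedBy_shiftDiff {φ : SmoothFun} {k : ℕ} {M : ℝ} (hφ : BoundedBy φ (k + 1) M)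
    (h : Plane) : BoundedBy (shiftDiff φ h) k (M * ‖h‖) := by
  intro j hj x
  set f : Plane → ℝ := fun y => φ.1 (toTorus y) with hf
  have hfd : ContDiff ℝ (⊤ : ℕ∞) f := φ.2
  have e : (fun y : Plane => (shiftDiff φ h).1 (toTorus y)) = (fun y => f (y + h)) - f := by
    funext y
    simp [shiftDiff, f, toTorus_add]
  have hj' : ContDiff ℝ j f := hfd.of_le (mod_cast le_top)
  have hjs : ContDiff ℝ j fun y => f (y + h) := hj'.comp (contDiff_id.add contDiff_const)
  rw [e, iteratedFDeriv_sub hjs hj',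
    Pi.sub_apply, iteratedFDeriv_comp_add_right]
  have hd : Differentiable ℝ (iteratedFDeriv ℝ j f) :=
    hfd.differentiable_iteratedFDeriv (mod_cast WithTop.coe_lt_top _)
  have := Convex.norm_image_sub_le_of_norm_fderiv_le (𝕜 := ℝ) (f := iteratedFDeriv ℝ j f) (C := M)
    (s := Set.univ) (x := x) (y := x + h) (fun y _ => hd y) (fun y _ => by
      rw [norm_fderiv_iteratedFDeriv]
      exact hφ (j + 1) (by omega) y) convex_univ trivial trivial
  simpa using this

theorem mFourier_add_apply (m : Fin 2 → ℤ) (x y : Torus) :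
    UnitAddTorus.mFourier m (x + y) = UnitAddTorus.mFourier m x * UnitAddTorus.mFourier m y := by
  simp only [UnitAddTorus.mFourier, fourier_apply, ContinuousMap.coe_mk, Pi.add_apply, smul_add,
    AddCircle.toCircle_add, Circle.coe_mul, Finset.prod_mul_distrib]

theorem norm_mFourier_apply (m : Fin 2 → ℤ) (x : Torus) : ‖UnitAddTorus.mFourier m x‖ = 1 := by
  simp only [UnitAddTorus.mFourier, fourier_apply, ContinuousMap.coe_mk, norm_prod,
    Circle.norm_coe, Finset.prod_const_one]

/-- A translation of the plane by which `e_m` changes sign. -/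
def halfPeriod (m : Fin 2 → ℤ) (i : Fin 2) : Plane := EuclideanSpace.single i (1 / (2 * (m i : ℝ)))

theorem mFourier_halfPeriod {m : Fin 2 → ℤ} {i : Fin 2} (hi : m i ≠ 0) :
    UnitAddTorus.mFourier m (toTorus (halfPeriod m i)) = -1 := by
  have h : ∀ j, fourier (m j) ((toTorus (halfPeriod m i)) j) = if j = i then (-1 : ℂ) else 1 := by
    intro j
    have hm : (m i : ℂ) ≠ 0 := by exact_mod_cast hi
    by_cases hj : j = i
    · subst hj
      simp only [toTorus, halfPeriod, fourier_coe_apply]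
      simp only [PiLp.single_apply, if_true]
      rw [← Complex.exp_pi_mul_I]
      congr 1
      push_cast
      field_simp
    · simp [toTorus, halfPeriod, hj]
  simp only [UnitAddTorus.mFourier, ContinuousMap.coe_mk, h]
  simp

theorem norm_halfPeriod (m : Fin 2 → ℤ) (i : Fin 2) :
    ‖halfPeriod m i‖ = 1 / (2 * |(m i : ℝ)|) := by
  simp [halfPeriod]

instance : IsProbabilityMeasure (volume : Measure UnitAddCircle) := ⟨UnitAddCircle.measure_univ⟩

instance : IsProbabilityMeasure (volume : Measure Torus) :=
  inferInstanceAs (IsProbabilityMeasure (Measure.pi fun _ : Fin 2 => (volume : Measure UnitAddCircle)))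

theorem integrable_of_continuous_torus {E : Type*} [NormedAddCommGroup E] {f : Torus → E}
    (hf : Continuous f) : Integrable f := by
  rw [← integrableOn_univ]
  exact hf.continuousOn.integrableOn_compact isCompact_univ

/-- Translation by half a period multiplies `e_m` by `-1`, so the translated function has the
opposite coefficient. Iterating this plays the role of integration by parts. -/
theorem smoothCoeff_shiftDiff {m : Fin 2 → ℤ} {i : Fin 2} (hi : m i ≠ 0) (φ : SmoothFun) :
    smoothCoeff (shiftDiff φ (halfPeriod m i)) m = -2 * smoothCoeff φ m := by
  set τ := toTorus (halfPeriod m i) with hτ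
  have h1 : smoothCoeff φ m = -∫ x : Torus, (φ.1 (x + τ) : ℂ) * UnitAddTorus.mFourier m x := by
    rw [smoothCoeff, ← integral_add_right_eq_self (μ := volume) _ τ, ← integral_neg]
    refine integral_congr_ae (Eventually.of_forall fun x => ?_)
    simp only [mFourier_add_apply, hτ, mFourier_halfPeriod hi]
    ring
  have hc : Continuous fun x : Torus => (φ.1 x : ℂ) * UnitAddTorus.mFourier m x :=
    (Complex.continuous_ofReal.comp (continuous_smoothFun φ)).mul (ContinuousMap.continuous _)
  have hc' : Continuous fun x : Torus => (φ.1 (x + τ) : ℂ) * UnitAddTorus.mFourier m x :=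
    (Complex.continuous_ofReal.comp ((continuous_smoothFun φ).comp (continuous_add_const τ))).mul
      (ContinuousMap.continuous _)
  have h2 : smoothCoeff (shiftDiff φ (halfPeriod m i)) m =
      (∫ x : Torus, (φ.1 (x + τ) : ℂ) * UnitAddTorus.mFourier m x) - smoothCoeff φ m := by
    rw [smoothCoeff, smoothCoeff, ← integral_sub (integrable_of_continuous_torus hc')
      (integrable_of_continuous_torus hc)]
    refine integral_congr_ae (Eventually.of_forall fun x => ?_)
    simp only [shiftDiff, Complex.ofReal_sub]
    ring
  rw [h2, h1]
  ring

theorem norm_smoothCoeff_le {m : Fin 2 → ℤ} {φ : SmoothFun} {k : ℕ} {M : ℝ}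
    (hφ : BoundedBy φ k M) : ‖smoothCoeff φ m‖ ≤ M := by
  have := norm_integral_le_of_norm_le_const (μ := (volume : Measure Torus)) (C := M)
    (f := fun x => (φ.1 x : ℂ) * UnitAddTorus.mFourier m x) (Eventually.of_forall fun x => by
      obtain ⟨y, rfl⟩ := toTorus_surjective x
      rw [norm_mul, norm_mFourier_apply, mul_one, Complex.norm_real]
      simpa using hφ 0 (Nat.zero_le _) y)
  simpa [smoothCoeff] using this

/-- Each passage to `shiftDiff` doubles the coefficient and multiplies the bound by the length `1 /
(2|m_i|)` of the translation. The net gain is `4|m_i|`, at the price of one derivative. -/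
theorem norm_smoothCoeff_le_div {m : Fin 2 → ℤ} {i : Fin 2} (hi : m i ≠ 0) (k : ℕ) :
    ∀ {φ : SmoothFun} {M : ℝ}, BoundedBy φ k M →
      ‖smoothCoeff φ m‖ ≤ M / (4 * |(m i : ℝ)|) ^ k := by
  have hm : 0 < |(m i : ℝ)| := abs_pos.2 (by exact_mod_cast hi)
  induction k with
  | zero => intro φ M h; simpa using norm_smoothCoeff_le h
  | succ k ih =>
    intro φ M h
    have h1 := ih (boundedBy_shiftDiff h (halfPeriod m i))
    rw [smoothCoeff_shiftDiff hi, norm_mul, norm_halfPeriod] at h1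
    have h2 : M * (1 / (2 * |(m i : ℝ)|)) / (4 * |(m i : ℝ)|) ^ k =
        2 * (M / (4 * |(m i : ℝ)|) ^ (k + 1)) := by
      field_simp
      ring
    rw [h2] at h1
    norm_num at h1
    exact h1

/-- Four gains in the direction of the largest component of `m`, where `1 + |m|² ≤ 3 m_i²`. For `m =
0` the sup bound is enough. -/
theorem norm_smoothCoeff_le_bracketSq (m : Fin 2 → ℤ) {φ : SmoothFun} {M : ℝ}
    (hφ : BoundedBy φ 4 M) : ‖smoothCoeff φ m‖ ≤ M * sobolevWeight (-2) m := by
  have hM : 0 ≤ M := (norm_nonneg _).trans (hφ 0 (Nat.zero_le _) 0)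
  have hw : sobolevWeight (-2) m = (bracketSq m ^ 2)⁻¹ := by
    rw [sobolevWeight_eq, Real.rpow_neg (bracketSq_pos m).le]
    norm_cast
  have key : ∀ i, m i ≠ 0 → (∀ j, (m j : ℝ) ^ 2 ≤ (m i : ℝ) ^ 2) →
      ‖smoothCoeff φ m‖ ≤ M * sobolevWeight (-2) m := by
    intro i hi hmax
    refine (norm_smoothCoeff_le_div hi 4 hφ).trans ?_
    rw [hw, div_eq_mul_inv]
    have h1 : (1 : ℝ) ≤ (m i : ℝ) ^ 2 := by
      have : (1 : ℤ) ≤ m i ^ 2 := by have := sq_pos_of_ne_zero hi; omega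
      exact_mod_cast this
    have h2 : bracketSq m ≤ 3 * (m i : ℝ) ^ 2 := by
      rw [bracketSq, Fin.sum_univ_two]
      linarith [hmax 0, hmax 1]
    refine mul_le_mul_of_nonneg_left (inv_anti₀ (pow_pos (bracketSq_pos m) 2) ?_) hM
    calc bracketSq m ^ 2 ≤ (3 * (m i : ℝ) ^ 2) ^ 2 :=
          pow_le_pow_left₀ (bracketSq_pos m).le h2 2
      _ ≤ (4 * |(m i : ℝ)|) ^ 4 := by
          have h3 : (4 * |(m i : ℝ)|) ^ 4 = 256 * ((m i : ℝ) ^ 2) ^ 2 := by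
            rw [← sq_abs (m i : ℝ)]
            ring
          rw [h3]
          nlinarith [sq_nonneg ((m i : ℝ) ^ 2)]
  obtain ⟨i, hi⟩ := Finite.exists_max fun j => (m j : ℝ) ^ 2
  by_cases h0 : m i = 0
  · have h3 : bracketSq m = 1 := by
      rw [bracketSq, Finset.sum_eq_zero, add_zero]
      intro j _
      have := hi j
      rw [h0] at this
      exact le_antisymm (by simpa using this) (sq_nonneg _)
    rw [hw, h3]
    simpa using norm_smoothCoeff_le hφ
  · exact key i h0 hi

/-! ### Distributions with prescribed Fourier coefficients -/

theorem integral_mFourier_of_ne_zero {m : Fin 2 → ℤ} (hm : m ≠ 0) :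
    ∫ x : Torus, UnitAddTorus.mFourier m x = 0 := by
  obtain ⟨i, hi⟩ := Function.ne_iff.1 hm
  have h := integral_add_right_eq_self (μ := (volume : Measure Torus))
    (fun x => UnitAddTorus.mFourier m x) (toTorus (halfPeriod m i))
  simp only [mFourier_add_apply, mFourier_halfPeriod hi, integral_mul_const] at h
  linear_combination (-1 / 2 : ℂ) * h

theorem integral_mFourier_mul (m n : Fin 2 → ℤ) :
    ∫ x : Torus, UnitAddTorus.mFourier n x * UnitAddTorus.mFourier m x =
      if m = -n then 1 else 0 := by
  have h : ∀ x : Torus, UnitAddTorus.mFourier n x * UnitAddTorus.mFourier m x =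
      UnitAddTorus.mFourier (n + m) x := fun x => UnitAddTorus.mFourier_add.symm
  simp only [h]
  split_ifs with hmn
  · subst hmn
    simp [UnitAddTorus.mFourier_zero]
  · exact integral_mFourier_of_ne_zero fun h0 => hmn (by rw [eq_neg_iff_add_eq_zero, add_comm, h0])

theorem integrable_mFourier_mul (m n : Fin 2 → ℤ) : Integrable fun x : Torus =>
    UnitAddTorus.mFourier n x * UnitAddTorus.mFourier m x :=
  integrable_of_continuous_torus
    ((ContinuousMap.continuous _).mul (ContinuousMap.continuous _))

theorem smoothCoeff_cosFun (m n : Fin 2 → ℤ) : smoothCoeff (cosFun n) m =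
    ((if m = -n then 1 else 0) + (if m = n then 1 else 0)) / 2 := by
  have h : ∀ x : Torus, ((cosFun n).1 x : ℂ) * UnitAddTorus.mFourier m x =
      (UnitAddTorus.mFourier n x * UnitAddTorus.mFourier m x +
        UnitAddTorus.mFourier (-n) x * UnitAddTorus.mFourier m x) / 2 := fun x => by
    simp only [cosFun, UnitAddTorus.mFourier_neg, Complex.re_eq_add_conj]
    ring
  rw [smoothCoeff, integral_congr_ae (Eventually.of_forall h), integral_div,
    integral_add (integrable_mFourier_mul _ _) (integrable_mFourier_mul _ _),
    integral_mFourier_mul, integral_mFourier_mul, neg_neg]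

theorem smoothCoeff_sinFun (m n : Fin 2 → ℤ) : smoothCoeff (sinFun n) m =
    ((if m = -n then 1 else 0) - (if m = n then 1 else 0)) / (2 * Complex.I) := by
  have h : ∀ x : Torus, ((sinFun n).1 x : ℂ) * UnitAddTorus.mFourier m x =
      (UnitAddTorus.mFourier n x * UnitAddTorus.mFourier m x -
        UnitAddTorus.mFourier (-n) x * UnitAddTorus.mFourier m x) / (2 * Complex.I) := fun x => by
    simp only [sinFun, UnitAddTorus.mFourier_neg, Complex.im_eq_sub_conj]
    ring
  rw [smoothCoeff, integral_congr_ae (Eventually.of_forall h), integral_div,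
    integral_sub (integrable_mFourier_mul _ _) (integrable_mFourier_mul _ _),
    integral_mFourier_mul, integral_mFourier_mul, neg_neg]

theorem smoothCoeff_add (φ ψ : SmoothFun) (m : Fin 2 → ℤ) :
    smoothCoeff (φ + ψ) m = smoothCoeff φ m + smoothCoeff ψ m := by
  have hi : ∀ φ : SmoothFun, Integrable fun x : Torus =>
      (φ.1 x : ℂ) * UnitAddTorus.mFourier m x := fun φ => integrable_of_continuous_torus
    ((Complex.continuous_ofReal.comp (continuous_smoothFun φ)).mul (ContinuousMap.continuous _))
  rw [smoothCoeff, smoothCoeff, smoothCoeff, ← integral_add (hi φ) (hi ψ)]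
  simp [add_mul]

theorem smoothCoeff_smul (a : ℝ) (φ : SmoothFun) (m : Fin 2 → ℤ) :
    smoothCoeff (a • φ) m = a * smoothCoeff φ m := by
  rw [smoothCoeff, smoothCoeff, ← integral_const_mul]
  simp [mul_assoc]

theorem exists_boundedBy (φ : SmoothFun) (k : ℕ) : ∃ M, BoundedBy φ k M := by
  have hf : ContDiff ℝ (⊤ : ℕ∞) (fun y : Plane => φ.1 (toTorus y)) := φ.2
  have h : ∀ j : ℕ, ∃ M, ∀ x : Plane,
      ‖iteratedFDeriv ℝ j (fun y : Plane => φ.1 (toTorus y)) x‖ ≤ M := by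
    intro j
    have hc := (hf.continuous_iteratedFDeriv (m := j) (mod_cast le_top)).norm
    obtain ⟨M, hM⟩ := (isCompact_closedBall (0 : Plane) 2).bddAbove_image hc.continuousOn
    refine ⟨M, fun x => ?_⟩
    set l : Plane := WithLp.toLp 2 fun i => ((⌊x i⌋ : ℤ) : ℝ) with hl
    have hl0 : toTorus l = 0 := funext fun i => by
      simp [toTorus, hl]
    have e : (fun y : Plane => φ.1 (toTorus y)) = fun y : Plane => φ.1 (toTorus (y + l)) := by
      funext y
      rw [toTorus_add, hl0, add_zero]
    have hx : iteratedFDeriv ℝ j (fun y : Plane => φ.1 (toTorus y)) x =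
        iteratedFDeriv ℝ j (fun y : Plane => φ.1 (toTorus y)) (x - l) := by
      conv_rhs => rw [e]
      rw [iteratedFDeriv_comp_add_right (f := fun y : Plane => φ.1 (toTorus y)), sub_add_cancel]
    rw [hx]
    refine hM (Set.mem_image_of_mem _ ?_)
    rw [mem_closedBall_zero_iff, EuclideanSpace.norm_eq, Real.sqrt_le_left (by norm_num),
      Fin.sum_univ_two]
    have hfr : ∀ i, ‖(x - l) i‖ ^ 2 ≤ 1 := fun i => by
      have : (x - l) i = Int.fract (x i) := by simp [hl]
      rw [this, Real.norm_of_nonneg (Int.fract_nonneg _)]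
      exact pow_le_one₀ (Int.fract_nonneg _) (Int.fract_lt_one _).le
    linarith [hfr 0, hfr 1]
  choose M hM using h
  exact ⟨∑ j ∈ Finset.range (k + 1), |M j|, fun j hj x => (hM j x).trans ((le_abs_self _).trans
    (Finset.single_le_sum (f := fun j => |M j|) (fun _ _ => abs_nonneg _)
      (Finset.mem_range.2 (by omega))))⟩

/-- Multisequences bounded by `A + 4 log (1 + |n|²)` with the symmetry of the Fourier coefficients
of a real distribution. -/
def coeffSet (A : ℝ) : Set ((Fin 2 → ℤ) → ℂ) :=
  {a | ∀ n, ‖a n‖ ≤ logBound A n ∧ a (-n) = (starRingEnd ℂ) (a n)}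

/-- Parseval's identity dictates the functional: pair the sequence with the decaying coefficients of
the test function. This is the completeness behind the compactness argument, as it makes a limit of
Fourier coefficients the coefficients of a distribution. -/
theorem exists_hMinus_of_mem_coeffSet {A : ℝ} (hA : 1 ≤ A) {a : (Fin 2 → ℤ) → ℂ}
    (ha : a ∈ coeffSet A) : ∃ ω : HMinus, ∀ n, fourierCoeff ω.toDistribution n = a n := by
  set S : ℝ := ∑' n, sobolevWeight (-2) n * logBound A n ^ 2 with hS
  have hsum : Summable fun n => sobolevWeight (-2) n * logBound A n ^ 2 := by
    have := summable_sobolevWeight_mul_logBound (δ := 1) (A := A) one_pos (by linarith)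
    norm_num at this
    exact this
  have hbd : ∀ {φ : SmoothFun} {M : ℝ}, BoundedBy φ 4 M → ∀ m,
      ‖((starRingEnd ℂ) (smoothCoeff φ m) * a m).re‖ ≤
        M * (sobolevWeight (-2) m * logBound A m ^ 2) := by
    intro φ M hφ m
    have hM : 0 ≤ M := (norm_nonneg _).trans (hφ 0 (Nat.zero_le _) 0)
    -- This is where `1 ≤ A` serves: it replaces `logBound` by its square, whose weighted sum is
    -- already known to converge.
    have h1 : 1 ≤ logBound A m := hA.trans (le_logBound A m)
    calc ‖((starRingEnd ℂ) (smoothCoeff φ m) * a m).re‖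
        ≤ ‖(starRingEnd ℂ) (smoothCoeff φ m) * a m‖ := Complex.abs_re_le_norm _
      _ = ‖smoothCoeff φ m‖ * ‖a m‖ := by rw [norm_mul, RCLike.norm_conj]
      _ ≤ (M * sobolevWeight (-2) m) * logBound A m ^ 2 := by
          refine mul_le_mul (norm_smoothCoeff_le_bracketSq m hφ) ((ha m).1.trans ?_)
            (norm_nonneg _) (mul_nonneg hM (sobolevWeight_nonneg _ _))
          nlinarith
      _ = _ := by ring
  have hsm : ∀ φ : SmoothFun, Summable fun m =>
      ((starRingEnd ℂ) (smoothCoeff φ m) * a m).re := fun φ => by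
    obtain ⟨M, hM⟩ := exists_boundedBy φ 4
    exact Summable.of_norm_bounded (hsum.mul_left M) (hbd hM)
  let ω : Distribution := ⟨{
      toFun := fun φ => ∑' m, ((starRingEnd ℂ) (smoothCoeff φ m) * a m).re
      map_add' := fun φ ψ => by
        rw [← (hsm φ).tsum_add (hsm ψ)]
        simp only [smoothCoeff_add, map_add, add_mul, Complex.add_re]
      map_smul' := fun r φ => by
        rw [RingHom.id_apply, smul_eq_mul, ← tsum_mul_left]
        simp only [smoothCoeff_smul, map_mul, Complex.conj_ofReal, mul_assoc,
          Complex.re_ofReal_mul] },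
    S, 4, fun φ M hM => by
      have h1 : ‖∑' m, ((starRingEnd ℂ) (smoothCoeff φ m) * a m).re‖ ≤ M * S :=
        tsum_of_norm_bounded (hsum.hasSum.mul_left M) (hbd hM)
      rw [mul_comm S M]
      exact h1⟩
  have hω : ∀ n, fourierCoeff ω n = a n := by
    intro n
    have hcos : HasSum (fun m => ((starRingEnd ℂ) (smoothCoeff (cosFun n) m) * a m).re)
        ((a (-n) / 2).re + (a n / 2).re) := by
      have h1 := (hasSum_ite_eq (-n) (a (-n) / 2).re).add (hasSum_ite_eq n (a n / 2).re)
      convert h1 using 2 with m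
      have e1 : (if m = -n then (a (-n) / 2).re else 0) = if m = -n then (a m / 2).re else 0 := by
        split_ifs with h <;> simp only [h]
      have e2 : (if m = n then (a n / 2).re else 0) = if m = n then (a m / 2).re else 0 := by
        split_ifs with h <;> simp only [h]
      rw [smoothCoeff_cosFun, e1, e2]
      split_ifs <;> simp [div_eq_inv_mul] <;> ring
    have hsin : HasSum (fun m => ((starRingEnd ℂ) (smoothCoeff (sinFun n) m) * a m).re)
        (-(a (-n) / 2).im + (a n / 2).im) := by
      have h1 := (hasSum_ite_eq (-n) (-(a (-n) / 2).im)).add (hasSum_ite_eq n (a n / 2).im)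
      convert h1 using 2 with m
      have e1 : (if m = -n then (-(a (-n) / 2).im) else 0) = if m = -n then (-(a m / 2).im) else 0 := by
        split_ifs with h <;> simp only [h]
      have e2 : (if m = n then (a n / 2).im else 0) = if m = n then (a m / 2).im else 0 := by
        split_ifs with h <;> simp only [h]
      rw [smoothCoeff_sinFun, e1, e2]
      split_ifs <;> simp [div_eq_inv_mul]
    have h2 := (ha n).2
    apply Complex.ext
    · change ∑' m, ((starRingEnd ℂ) (smoothCoeff (cosFun n) m) * a m).re = _
      rw [hcos.tsum_eq, h2]
      simp
    · change ∑' m, ((starRingEnd ℂ) (smoothCoeff (sinFun n) m) * a m).re = _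
      rw [hsin.tsum_eq, h2]
      simp
      ring
  exact ⟨⟨ω, mem_hMinusOneMinus_of_le_logBound (zero_le_one.trans hA) fun n => by
    rw [hω]; exact (ha n).1⟩, hω⟩

/-! ### Compact sets of paths -/

theorem isCompact_coeffSet (A : ℝ) : IsCompact (coeffSet A) := by
  have h1 : IsCompact (Set.univ.pi fun n : Fin 2 → ℤ => Metric.closedBall (0 : ℂ) (logBound A n)) :=
    isCompact_univ_pi fun n => isCompact_closedBall _ _
  refine h1.of_isClosed_subset ?_ fun a ha n _ => by simpa using (ha n).1
  have : coeffSet A = ⋂ n, {a | ‖a n‖ ≤ logBound A n ∧ a (-n) = (starRingEnd ℂ) (a n)} := by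
    ext a
    simp [coeffSet]
  rw [this]
  exact isClosed_iInter fun n => (isClosed_le (continuous_apply n).norm continuous_const).inter
    (isClosed_eq (continuous_apply _) (Complex.continuous_conj.comp (continuous_apply n)))

theorem HMinus.dist_eq_zero_of_fourierCoeff {ω ω' : HMinus}
    (h : ∀ n, fourierCoeff ω.toDistribution n = fourierCoeff ω'.toDistribution n) :
    dist ω ω' = 0 := by
  simp [HMinus.dist_eq, HMinus.distTerm, sobolevNorm, fourierCoeff_sub, h]

theorem equicontinuous_of_coordinates {ι X κ : Type*} [TopologicalSpace X]
    {F : ι → X → κ → ℂ} (h : ∀ n, Equicontinuous fun i x => F i x n) : Equicontinuous F := by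
  rw [Pi.uniformSpace_eq, equicontinuous_iInf_rng]
  intro n s
  have hi : @IsUniformInducing _ _ (UniformSpace.comap (Function.eval n) inferInstance) _
      (Function.eval n : (κ → ℂ) → ℂ) := @IsUniformInducing.mk _ _ (_) _ _ rfl
  rw [@IsUniformInducing.equicontinuousAt_iff _ _ _ _ _ (_) _ _ _ _ hi]
  exact h n s

/-- The compact space `coeffSet A` maps continuously to `HMinus`. Arzelà–Ascoli is therefore applied
to paths of coefficients, where equicontinuity is checked one frequency at a time, and the resulting
compact set is pushed forward. -/
theorem exists_isCompact_pathSpace (T A : ℝ) (hA : 1 ≤ A) (L : (Fin 2 → ℤ) → ℝ) :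
    ∃ K : Set (PathSpace T), IsCompact K ∧ ∀ u : PathSpace T,
      (∀ t n, ‖fourierCoeff (u t).toDistribution n‖ ≤ logBound A n) →
      (∀ s t n, ‖fourierCoeff (u t).toDistribution n - fourierCoeff (u s).toDistribution n‖ ≤
        L n * √|(t : ℝ) - s|) → u ∈ K := by
  have hA0 : 0 ≤ A := by linarith
  choose ψ₀ hψ₀ using fun a : coeffSet A => exists_hMinus_of_mem_coeffSet hA a.2
  have hψc : Continuous ψ₀ := continuous_iff_continuousAt.2 fun a =>
    HMinus.tendsto_of_fourierCoeff hA0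
      (Eventually.of_forall fun b n => by rw [hψ₀]; exact (b.2 n).1)
      (fun n => by rw [hψ₀]; exact (a.2 n).1)
      (fun n => by
        simp only [hψ₀]
        exact ((continuous_apply n).comp continuous_subtype_val).continuousAt)
  let ψ : C(coeffSet A, HMinus) := ⟨ψ₀, hψc⟩
  let S : Set C(Set.Icc (0 : ℝ) T, coeffSet A) :=
    {z | ∀ s t n, ‖(z t).1 n - (z s).1 n‖ ≤ L n * √|(t : ℝ) - s|}
  have : CompactSpace (coeffSet A) := isCompact_iff_compactSpace.1 (isCompact_coeffSet A)
  have hcont : ∀ z : Set.Icc (0 : ℝ) T → coeffSet A,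
      (∀ s t n, ‖(z t).1 n - (z s).1 n‖ ≤ L n * √|(t : ℝ) - s|) → Continuous z := by
    intro z hz
    refine continuous_induced_rng.2 (continuous_pi fun n => continuous_iff_continuousAt.2 fun s => ?_)
    have h0 : Tendsto (fun t : Set.Icc (0 : ℝ) T => L n * √|(t : ℝ) - s|) (𝓝 s) (𝓝 0) := by
      have : Continuous fun t : Set.Icc (0 : ℝ) T => L n * √|(t : ℝ) - s| := by fun_prop
      simpa using this.tendsto s
    rw [ContinuousAt, tendsto_iff_norm_sub_tendsto_zero]
    exact squeeze_zero (fun _ => norm_nonneg _) (fun t => hz s t n) h0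
  have hS : IsCompact S := by
    refine ArzelaAscoli.isCompact_of_equicontinuous S ?_ ?_
    · have : ContinuousMap.toFun '' S = {z : Set.Icc (0 : ℝ) T → coeffSet A |
          ∀ s t n, ‖(z t).1 n - (z s).1 n‖ ≤ L n * √|(t : ℝ) - s|} := by
        ext z
        constructor
        · rintro ⟨z, hz, rfl⟩
          exact hz
        · exact fun hz => ⟨⟨z, hcont z hz⟩, hz, rfl⟩
      rw [this]
      refine IsClosed.isCompact ?_
      simp only [Set.ofPred_forall]
      refine isClosed_iInter fun s => isClosed_iInter fun t => isClosed_iInter fun n =>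
        isClosed_le ?_ continuous_const
      have hc : ∀ t, Continuous fun z : Set.Icc (0 : ℝ) T → coeffSet A => (z t).1 n := fun t =>
        (continuous_apply n).comp (continuous_subtype_val.comp (continuous_apply t))
      exact ((hc t).sub (hc s)).norm
    · refine isUniformEmbedding_subtype_val.isUniformInducing.equicontinuous_iff.2
        (equicontinuous_of_coordinates fun n s => ?_)
      have h0 : Tendsto (fun t : Set.Icc (0 : ℝ) T => L n * √|(t : ℝ) - s|) (𝓝 s) (𝓝 0) := by
        have : Continuous fun t : Set.Icc (0 : ℝ) T => L n * √|(t : ℝ) - s| := by fun_prop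
        simpa using this.tendsto s
      refine Metric.equicontinuousAt_of_continuity_modulus _ h0 _
        (Eventually.of_forall fun t z => ?_)
      rw [dist_comm, dist_eq_norm]
      exact z.2 s t n
  -- The closure is taken because `HMinus` is only treated as a pseudometric space: a path is shown
  -- to be at distance zero from its reconstruction, not equal to it.
  refine ⟨closure ((fun z => ψ.comp z) '' S), (hS.image (ContinuousMap.continuous_postcomp ψ)).closure,
    fun u h1 h2 => ?_⟩
  have hmem : ∀ t, (fun n => fourierCoeff (u t).toDistribution n) ∈ coeffSet A := fun t n =>
    ⟨h1 t n, fourierCoeff_neg_index _ n⟩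
  let z : C(Set.Icc (0 : ℝ) T, coeffSet A) := ⟨fun t => ⟨_, hmem t⟩, hcont _ h2⟩
  have hz : z ∈ S := h2
  have hd : dist u (ψ.comp z) = 0 := by
    refine le_antisymm ((ContinuousMap.dist_le le_rfl).2 fun t => ?_) dist_nonneg
    refine (HMinus.dist_eq_zero_of_fourierCoeff fun n => ?_).le
    change _ = fourierCoeff (ψ₀ (z t)).toDistribution n
    rw [hψ₀]
    rfl
  exact Metric.mem_closure_iff.2 fun ε hε => ⟨_, Set.mem_image_of_mem _ hz, by
    rwa [hd]⟩

/-! ### The geometry of the torus and singular integrals -/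

theorem toTorus_latticePoint (l : Fin 2 → ℤ) : toTorus (latticePoint l) = 0 := by
  funext i
  simp [toTorus, latticePoint]

theorem exists_latticePoint_of_toTorus_eq {x y : Plane} (h : toTorus x = toTorus y) :
    ∃ l : Fin 2 → ℤ, x = y + latticePoint l := by
  have h1 : ∀ i, ∃ k : ℤ, x i = y i + k := fun i => by
    have h2 : ((x i - y i : ℝ) : UnitAddCircle) = 0 := by
      have := congrFun h i
      simp only [toTorus] at this
      rw [AddCircle.coe_sub, this, sub_self]
    obtain ⟨k, hk⟩ := (AddCircle.coe_eq_zero_iff (1 : ℝ)).1 h2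
    refine ⟨k, ?_⟩
    simp only [zsmul_eq_mul, mul_one] at hk
    linarith
  choose l hl using h1
  refine ⟨l, ?_⟩
  ext i
  simp [latticePoint, hl]

theorem abs_apply_le_norm (x : Plane) (i : Fin 2) : |x i| ≤ ‖x‖ := PiLp.norm_apply_le x i

theorem norm_le_two_mul {x : Plane} {r : ℝ} (h : ∀ i, |x i| ≤ r) : ‖x‖ ≤ 2 * r := by
  have hr : 0 ≤ r := (abs_nonneg _).trans (h 0)
  rw [EuclideanSpace.norm_eq, Real.sqrt_le_left (by positivity), Fin.sum_univ_two]
  have h1 : ∀ i, ‖x i‖ ^ 2 ≤ r ^ 2 := fun i => pow_le_pow_left₀ (norm_nonneg _) (h i) 2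
  nlinarith [h1 0, h1 1]

theorem norm_coe_unitAddCircle_le (x : ℝ) : ‖(x : UnitAddCircle)‖ ≤ |x| := by
  rw [UnitAddCircle.norm_eq]
  simpa using round_le x 0

theorem norm_toTorus_le (x : Plane) : ‖toTorus x‖ ≤ ‖x‖ :=
  (pi_norm_le_iff_of_nonneg (norm_nonneg _)).2 fun i =>
    (norm_coe_unitAddCircle_le _).trans (abs_apply_le_norm x i)

/-- Every point of the torus has a representative in the square `[-1/2, 1/2]²`. -/
theorem exists_rep (x : Torus) : ∃ z : Plane, toTorus z = x ∧ (∀ i, |z i| ≤ 1 / 2) ∧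
    (∀ i, |z i| = ‖x i‖) ∧ ‖z‖ ≤ 2 * ‖x‖ := by
  obtain ⟨y, rfl⟩ := toTorus_surjective x
  have h : ∀ i, |y i - round (y i)| = ‖(toTorus y) i‖ := fun i => by
    simp [toTorus, UnitAddCircle.norm_eq]
  refine ⟨WithLp.toLp 2 fun i => y i - round (y i), ?_, fun i => ?_, fun i => h i,
    norm_le_two_mul fun i => ?_⟩
  · funext i
    simp [toTorus]
  · exact abs_sub_round _
  · exact (h i).trans_le (norm_le_pi_norm _ i)

/-- The singular weight `‖x‖^{-a}` on the torus, infinite at `0` for `a > 0`. -/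
def singWeight (a : ℝ) (x : Torus) : ENNReal := ‖x‖ₑ ^ (-a)

theorem measurable_singWeight (a : ℝ) : Measurable (singWeight a) :=
  (measurable_enorm.comp measurable_id).pow_const _

theorem singWeight_neg (a : ℝ) (x : Torus) : singWeight a (-x) = singWeight a x := by
  simp [singWeight]

theorem lintegral_enorm_rpow_circle_lt_top {b : ℝ} (hb : b < 1) :
    ∫⁻ x : UnitAddCircle, ‖x‖ₑ ^ (-b) < ⊤ := by
  have h0 : IntervalIntegrable (fun x : ℝ => |x| ^ (-b)) volume 0 (1 / 2) := by
    refine (intervalIntegral.intervalIntegrable_rpow' (r := -b) (by linarith)).congr ?_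
    intro x hx
    rw [Set.uIoc_of_le (by norm_num)] at hx
    simp [abs_of_pos hx.1]
  have h1 : IntervalIntegrable (fun x : ℝ => |x| ^ (-b)) volume (-1 / 2) 0 := by
    rw [IntervalIntegrable.iff_comp_neg]
    simpa [neg_div] using h0.symm
  have h2 := (h1.trans h0).1
  have h3 := h2.hasFiniteIntegral
  rw [hasFiniteIntegral_iff_enorm] at h3
  rw [← UnitAddCircle.lintegral_preimage (-1 / 2)]
  rw [show (-1 / 2 : ℝ) + 1 = 1 / 2 by norm_num]
  refine lt_of_le_of_lt (lintegral_mono_ae ?_) h3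
  have hne : ∀ᵐ x : ℝ ∂volume.restrict (Set.Ioc (-1 / 2) (1 / 2)), x ≠ 0 :=
    ae_restrict_of_ae (by simp [ae_iff])
  filter_upwards [hne, ae_restrict_mem measurableSet_Ioc] with x hx hx'
  have hn : ‖(x : UnitAddCircle)‖ = |x| := by
    exact AddCircle.norm_coe_eq_abs_iff (1 : ℝ) one_ne_zero |>.2 (by
      rw [abs_le, abs_one]; constructor <;> linarith [hx'.1, hx'.2])
  rw [← ofReal_norm, hn, ENNReal.ofReal_rpow_of_pos (abs_pos.2 hx),
    ← ofReal_norm, Real.norm_of_nonneg (by positivity)]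

/-- The torus carries the sup norm, so `‖x‖^{-a}` is at most the product of the `‖x_i‖^{-a/2}`, and
each factor is integrable on the circle because `a/2 < 1`. -/
theorem lintegral_singWeight_lt_top {a : ℝ} (ha0 : 0 ≤ a) (ha : a < 2) :
    ∫⁻ x : Torus, singWeight a x < ⊤ := by
  have h1 : ∀ x : Torus, singWeight a x ≤ ‖x 0‖ₑ ^ (-(a / 2)) * ‖x 1‖ₑ ^ (-(a / 2)) := by
    intro x
    have e : singWeight a x = ‖x‖ₑ ^ (-(a / 2)) * ‖x‖ₑ ^ (-(a / 2)) := by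
      rw [singWeight, show -a = -(a / 2) * (2 : ℕ) by push_cast; ring, ENNReal.rpow_mul,
        ENNReal.rpow_natCast, sq]
    have h2 : ∀ i, ‖x‖ₑ ^ (-(a / 2)) ≤ ‖x i‖ₑ ^ (-(a / 2)) := fun i => by
      rw [ENNReal.rpow_neg, ENNReal.rpow_neg, ENNReal.inv_le_inv]
      refine ENNReal.rpow_le_rpow ?_ (by linarith)
      rw [enorm_le_iff_norm_le]
      exact norm_le_pi_norm x i
    rw [e]
    exact mul_le_mul' (h2 0) (h2 1)
  have hm : Measurable fun x : UnitAddCircle => ‖x‖ₑ ^ (-(a / 2)) :=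
    (measurable_enorm.comp measurable_id).pow_const _
  refine (lintegral_mono h1).trans_lt ?_
  have h3 := (volume_preserving_finTwoArrow UnitAddCircle).lintegral_comp
    (f := fun p : UnitAddCircle × UnitAddCircle => ‖p.1‖ₑ ^ (-(a / 2)) * ‖p.2‖ₑ ^ (-(a / 2)))
    ((hm.comp measurable_fst).mul (hm.comp measurable_snd))
  have h4 : ∫⁻ p : UnitAddCircle × UnitAddCircle, ‖p.1‖ₑ ^ (-(a / 2)) * ‖p.2‖ₑ ^ (-(a / 2)) < ⊤ := by
    rw [Measure.volume_eq_prod, lintegral_prod_mul hm.aemeasurable hm.aemeasurable]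
    exact ENNReal.mul_lt_top (lintegral_enorm_rpow_circle_lt_top (by linarith))
      (lintegral_enorm_rpow_circle_lt_top (by linarith))
  exact h3.trans_lt h4

/-! ### Periodisation of odd kernels -/

/-- An odd divergence free `C¹` kernel `κ` on the plane with derivative `κ'`, with
`κ = O(|x|^{-q})` and `κ' = O(|x|^{-p})`. -/
structure IsDecayingKernel (κ : Plane → Plane) (κ' : Plane → Plane →L[ℝ] Plane) (p q A : ℝ) :
    Prop where
  odd : ∀ x, κ (-x) = -κ x
  hasFDerivAt : ∀ x, HasFDerivAt κ (κ' x) x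
  continuous_deriv : Continuous κ'
  two_lt : 2 < p
  pos : 0 < q
  norm_le : ∀ x, ‖κ x‖ ≤ A * (1 + ‖x‖) ^ (-q)
  norm_deriv_le : ∀ x, ‖κ' x‖ ≤ A * (1 + ‖x‖) ^ (-p)
  div_eq_zero : ∀ x, ∑ i, κ' x (EuclideanSpace.single i 1) i = 0

/-- The periodisation of an odd kernel. -/
def periodize (κ : Plane → Plane) (x : Plane) : Plane :=
  ∑' m : Fin 2 → ℤ, (1 / 2 : ℝ) • (κ (x + latticePoint m) + κ (x - latticePoint m))

theorem latticePoint_add (l m : Fin 2 → ℤ) :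
    latticePoint (l + m) = latticePoint l + latticePoint m := by
  ext i
  simp [latticePoint]

theorem latticePoint_neg (m : Fin 2 → ℤ) : latticePoint (-m) = -latticePoint m := by
  ext i
  simp [latticePoint]

theorem latticePoint_zero : latticePoint 0 = 0 := by
  ext i
  simp [latticePoint]

theorem norm_latticePoint_sq (m : Fin 2 → ℤ) : 1 + ‖latticePoint m‖ ^ 2 = bracketSq m := by
  simp [bracketSq, EuclideanSpace.norm_sq_eq, latticePoint]

theorem summable_one_add_norm_latticePoint {p : ℝ} (hp : 2 < p) :
    Summable fun m : Fin 2 → ℤ => (1 + ‖latticePoint m‖) ^ (-p) := by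
  refine Summable.of_nonneg_of_le (fun m => by positivity) (fun m => ?_)
    (summable_sobolevWeight (s := -p / 2) (by linarith))
  have h : bracketSq m ≤ (1 + ‖latticePoint m‖) ^ (2 : ℝ) := by
    rw [← norm_latticePoint_sq, Real.rpow_two]
    nlinarith [norm_nonneg (latticePoint m)]
  calc (1 + ‖latticePoint m‖) ^ (-p) = ((1 + ‖latticePoint m‖) ^ (2 : ℝ)) ^ (-p / 2) := by
        rw [← Real.rpow_mul (by positivity)]
        congr 1
        ring
    _ ≤ bracketSq m ^ (-p / 2) :=
        Real.rpow_le_rpow_of_nonpos (bracketSq_pos m) h (by linarith)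

/-- Peetre's inequality `1 + ‖y‖ ≤ (1 + ‖x‖)(1 + ‖x + y‖)`, raised to a power. -/
theorem one_add_norm_add_rpow_le {p R : ℝ} (hp : 0 ≤ p) {x : Plane} (hx : ‖x‖ ≤ R) (y : Plane) :
    (1 + ‖x + y‖) ^ (-p) ≤ (1 + R) ^ p * (1 + ‖y‖) ^ (-p) := by
  have hR : 0 ≤ R := (norm_nonneg x).trans hx
  have h : 1 + ‖y‖ ≤ (1 + R) * (1 + ‖x + y‖) := by
    have : ‖y‖ ≤ ‖x + y‖ + ‖x‖ := by simpa using norm_sub_le (x + y) x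
    nlinarith [norm_nonneg (x + y)]
  rw [Real.rpow_neg (by positivity), Real.rpow_neg (by positivity), ← div_eq_mul_inv,
    inv_le_comm₀ (by positivity) (by positivity), inv_div, div_le_iff₀ (by positivity),
    ← Real.mul_rpow (by positivity) (by positivity), mul_comm (1 + ‖x + y‖)]
  exact Real.rpow_le_rpow (by positivity) h hp

/-- Telescoping on the two half-lines, whose sums are `-b 0` and `b 0`. -/
theorem tsum_int_sub_eq_zero {F : Type*} [NormedAddCommGroup F] [CompleteSpace F] {b : ℤ → F}
    (hb : Tendsto b cofinite (𝓝 0)) (hs : Summable fun n => b (n + 1) - b n) :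
    ∑' n, (b (n + 1) - b n) = 0 := by
  have h1 : Tendsto (fun n : ℕ => b n) atTop (𝓝 0) := by
    rw [← Nat.cofinite_eq_atTop]
    exact hb.comp Nat.cast_injective.tendsto_cofinite
  have h2 : Tendsto (fun n : ℕ => b (-n)) atTop (𝓝 0) := by
    rw [← Nat.cofinite_eq_atTop]
    exact hb.comp (neg_injective.comp Nat.cast_injective).tendsto_cofinite
  have e1 : HasSum (fun n : ℕ => b ((n : ℤ) + 1) - b n) (0 - b 0) := by
    refine (Summable.hasSum_iff_tendsto_nat
      (hs.comp_injective (i := fun n : ℕ => (n : ℤ)) Nat.cast_injective)).2 ?_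
    have := h1.sub_const (b 0)
    refine this.congr fun n => ?_
    have := Finset.sum_range_sub (fun n : ℕ => b n) n
    simpa using this.symm
  have e2 : HasSum (fun n : ℕ => b (-((n : ℤ) + 1) + 1) - b (-((n : ℤ) + 1))) (b 0 - 0) := by
    refine (Summable.hasSum_iff_tendsto_nat
      (hs.comp_injective (i := fun n : ℕ => -((n : ℤ) + 1)) fun a b h => by simpa using h)).2 ?_
    have := h2.const_sub (b 0)
    refine this.congr fun n => ?_
    have := Finset.sum_range_sub' (fun n : ℕ => b (-n)) n
    simp only [Nat.cast_zero, neg_zero] at this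
    rw [← this]
    refine Finset.sum_congr rfl fun k _ => ?_
    push_cast
    congr 2
    ring
  have := HasSum.of_nat_of_neg_add_one (f := fun n => b (n + 1) - b n) e1 e2
  simpa using this.tsum_eq

/-- Telescoping along each line parallel to the axis `i`, then summation over the lines. -/
theorem tsum_shift_sub_eq_zero {F : Type*} [NormedAddCommGroup F] [CompleteSpace F] (i : Fin 2)
    {b : (Fin 2 → ℤ) → F} (hb : Tendsto b cofinite (𝓝 0))
    (hs : Summable fun m => b (m + Pi.single i 1) - b m) :
    ∑' m, (b (m + Pi.single i 1) - b m) = 0 := by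
  obtain ⟨e, he⟩ : ∃ e : ℤ × ℤ ≃ (Fin 2 → ℤ), ∀ q p, e (q, p + 1) = e (q, p) + Pi.single i 1 := by
    have h0 := fun q p : ℤ => show (![p + 1, q] : Fin 2 → ℤ) = ![p, q] + Pi.single 0 1 by
      ext j; fin_cases j <;> simp
    have h1 := fun q p : ℤ => show (![q, p + 1] : Fin 2 → ℤ) = ![q, p] + Pi.single 1 1 by
      ext j; fin_cases j <;> simp
    fin_cases i
    · exact ⟨(Equiv.prodComm ℤ ℤ).trans (finTwoArrowEquiv ℤ).symm, fun q p => by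
        simpa [finTwoArrowEquiv] using h0 q p⟩
    · exact ⟨(finTwoArrowEquiv ℤ).symm, fun q p => by simpa [finTwoArrowEquiv] using h1 q p⟩
  rw [← e.tsum_eq]
  have hs' := e.summable_iff.2 hs
  rw [Summable.tsum_prod (f := fun c => b (e c + Pi.single i 1) - b (e c)) hs']
  have : ∀ q, ∑' p, (b (e (q, p) + Pi.single i 1) - b (e (q, p))) = 0 := fun q => by
    have h := hs'.prod_factor q
    simp only [Function.comp_def, ← he] at h ⊢
    exact tsum_int_sub_eq_zero (b := fun p => b (e (q, p)))
      (hb.comp (e.injective.comp (Prod.mk_right_injective q)).tendsto_cofinite) h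
  simp only [this, tsum_zero]

/-! ### Convergence, differentiability and periodicity of a periodised kernel. -/

namespace IsDecayingKernel

variable {κ : Plane → Plane} {κ' : Plane → Plane →L[ℝ] Plane} {p q A : ℝ}

theorem const_nonneg (h : IsDecayingKernel κ κ' p q A) : 0 ≤ A := by
  have := (norm_nonneg _).trans (h.norm_le 0)
  simpa using this

theorem zero (h : IsDecayingKernel κ κ' p q A) : κ 0 = 0 := by
  have := h.odd 0
  rw [neg_zero] at this
  ext i
  have h2 := congrArg (fun v : Plane => v i) this
  simp only [PiLp.neg_apply] at h2
  simp only [PiLp.zero_apply]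
  linarith

theorem norm_deriv_add_le (h : IsDecayingKernel κ κ' p q A) {R : ℝ} {x : Plane} (hx : ‖x‖ ≤ R)
    (m : Fin 2 → ℤ) : ‖κ' (x + latticePoint m)‖ ≤
      A * ((1 + R) ^ p * (1 + ‖latticePoint m‖) ^ (-p)) :=
  (h.norm_deriv_le _).trans (mul_le_mul_of_nonneg_left
    (one_add_norm_add_rpow_le (by linarith [h.two_lt]) hx _) h.const_nonneg)

theorem norm_deriv_sub_le (h : IsDecayingKernel κ κ' p q A) {R : ℝ} {x : Plane} (hx : ‖x‖ ≤ R)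
    (m : Fin 2 → ℤ) : ‖κ' (x - latticePoint m)‖ ≤
      A * ((1 + R) ^ p * (1 + ‖latticePoint m‖) ^ (-p)) := by
  have := h.norm_deriv_add_le hx (-m)
  rwa [latticePoint_neg, norm_neg, ← sub_eq_add_neg] at this

theorem summable_bound (h : IsDecayingKernel κ κ' p q A) (R : ℝ) :
    Summable fun m : Fin 2 → ℤ => A * ((1 + R) ^ p * (1 + ‖latticePoint m‖) ^ (-p)) :=
  ((summable_one_add_norm_latticePoint h.two_lt).mul_left _).mul_left _

theorem summable_deriv (h : IsDecayingKernel κ κ' p q A) (x : Plane) :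
    Summable fun m : Fin 2 → ℤ => κ' (x + latticePoint m) :=
  Summable.of_norm_bounded (h.summable_bound ‖x‖) fun m => h.norm_deriv_add_le le_rfl m

theorem summable_deriv_sub (h : IsDecayingKernel κ κ' p q A) (x : Plane) :
    Summable fun m : Fin 2 → ℤ => κ' (x - latticePoint m) :=
  Summable.of_norm_bounded (h.summable_bound ‖x‖) fun m => h.norm_deriv_sub_le le_rfl m

theorem hasFDerivAt_term (h : IsDecayingKernel κ κ' p q A) (m : Fin 2 → ℤ) (x : Plane) :
    HasFDerivAt (fun x => (1 / 2 : ℝ) • (κ (x + latticePoint m) + κ (x - latticePoint m)))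
      ((1 / 2 : ℝ) • (κ' (x + latticePoint m) + κ' (x - latticePoint m))) x :=
  (((hasFDerivAt_comp_add_right _).2 (h.hasFDerivAt _)).add
    ((hasFDerivAt_comp_sub _).2 (h.hasFDerivAt _))).const_smul (1 / 2 : ℝ)

theorem norm_term_deriv_le (h : IsDecayingKernel κ κ' p q A) {R : ℝ} {x : Plane} (hx : ‖x‖ ≤ R)
    (m : Fin 2 → ℤ) : ‖(1 / 2 : ℝ) • (κ' (x + latticePoint m) + κ' (x - latticePoint m))‖ ≤
      A * ((1 + R) ^ p * (1 + ‖latticePoint m‖) ^ (-p)) := by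
  rw [norm_smul, Real.norm_of_nonneg (by norm_num)]
  have := norm_add_le (κ' (x + latticePoint m)) (κ' (x - latticePoint m))
  linarith [h.norm_deriv_add_le hx m, h.norm_deriv_sub_le hx m]

theorem term_zero (h : IsDecayingKernel κ κ' p q A) (m : Fin 2 → ℤ) :
    (1 / 2 : ℝ) • (κ (0 + latticePoint m) + κ (0 - latticePoint m)) = 0 := by
  rw [zero_add, zero_sub, h.odd, add_neg_cancel, smul_zero]

/-- The kernel itself may decay too slowly to be summed over the lattice; the application has
exponent `2 - ε`. But the averaged terms vanish at `0` by oddness and their derivatives are summable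
uniformly on balls, so they are summable everywhere. -/
theorem summable_term (h : IsDecayingKernel κ κ' p q A) (x : Plane) : Summable fun m : Fin 2 → ℤ =>
    (1 / 2 : ℝ) • (κ (x + latticePoint m) + κ (x - latticePoint m)) :=
  summable_of_summable_hasFDerivAt_of_isPreconnected (h.summable_bound (‖x‖ + 1))
    Metric.isOpen_ball (convex_ball (0 : Plane) (‖x‖ + 1)).isPreconnected
    (f := fun m x => (1 / 2 : ℝ) • (κ (x + latticePoint m) + κ (x - latticePoint m)))
    (f' := fun m x => (1 / 2 : ℝ) • (κ' (x + latticePoint m) + κ' (x - latticePoint m)))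
    (fun m y _ => h.hasFDerivAt_term m y)
    (fun m y hy => h.norm_term_deriv_le (mem_ball_zero_iff.1 hy).le m)
    (x₀ := 0) (by simp; positivity) (by simp only [h.term_zero]; exact summable_zero)
    (by simp)

/-- The derivative of the periodisation. -/
theorem hasFDerivAt_periodize (h : IsDecayingKernel κ κ' p q A) (x : Plane) :
    HasFDerivAt (periodize κ) (∑' m : Fin 2 → ℤ, κ' (x + latticePoint m)) x := by
  have h1 := hasFDerivAt_tsum_of_isPreconnected (h.summable_bound (‖x‖ + 1))
    Metric.isOpen_ball (convex_ball (0 : Plane) (‖x‖ + 1)).isPreconnected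
    (f := fun m x => (1 / 2 : ℝ) • (κ (x + latticePoint m) + κ (x - latticePoint m)))
    (f' := fun m x => (1 / 2 : ℝ) • (κ' (x + latticePoint m) + κ' (x - latticePoint m)))
    (fun m y _ => h.hasFDerivAt_term m y)
    (fun m y hy => h.norm_term_deriv_le (mem_ball_zero_iff.1 hy).le m)
    (x₀ := 0) (by simp; positivity) (by simp only [h.term_zero]; exact summable_zero)
    (x := x) (by simp)
  have h2 : ∑' m : Fin 2 → ℤ, κ' (x - latticePoint m) = ∑' m, κ' (x + latticePoint m) := by
    rw [← (Equiv.neg (Fin 2 → ℤ)).tsum_eq]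
    simp [latticePoint_neg]
  have h3 : ∑' m : Fin 2 → ℤ, (1 / 2 : ℝ) • (κ' (x + latticePoint m) + κ' (x - latticePoint m)) =
      ∑' m, κ' (x + latticePoint m) := by
    rw [Summable.tsum_const_smul _ ((h.summable_deriv x).add (h.summable_deriv_sub x)),
      (h.summable_deriv x).tsum_add (h.summable_deriv_sub x), h2, ← two_smul ℝ, smul_smul]
    norm_num
  rw [h3] at h1
  exact h1

theorem continuous_tsum_deriv (h : IsDecayingKernel κ κ' p q A) :
    Continuous fun x : Plane => ∑' m : Fin 2 → ℤ, κ' (x + latticePoint m) := by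
  refine continuous_iff_continuousAt.2 fun x => ?_
  have := continuousOn_tsum (f := fun (m : Fin 2 → ℤ) (x : Plane) => κ' (x + latticePoint m))
    (s := Metric.ball 0 (‖x‖ + 1))
    (fun m => (h.continuous_deriv.comp (continuous_add_const _)).continuousOn)
    (h.summable_bound (‖x‖ + 1))
    (fun m y hy => h.norm_deriv_add_le (mem_ball_zero_iff.1 hy).le m)
  exact this.continuousAt (Metric.isOpen_ball.mem_nhds (by simp))

theorem tsum_deriv_add_latticePoint (κ' : Plane → Plane →L[ℝ] Plane) (x : Plane) (l : Fin 2 → ℤ) :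
    ∑' m : Fin 2 → ℤ, κ' (x + latticePoint l + latticePoint m) =
      ∑' m : Fin 2 → ℤ, κ' (x + latticePoint m) := by
  rw [← (Equiv.addLeft l).tsum_eq fun m => κ' (x + latticePoint m)]
  simp [latticePoint_add, add_assoc]

theorem tsum_deriv_div (h : IsDecayingKernel κ κ' p q A) (x : Plane) :
    ∑ i, (∑' m : Fin 2 → ℤ, κ' (x + latticePoint m)) (EuclideanSpace.single i 1) i = 0 := by
  let tr : (Plane →L[ℝ] Plane) →L[ℝ] ℝ := ∑ i : Fin 2,
    (EuclideanSpace.proj i).comp (ContinuousLinearMap.apply ℝ Plane (EuclideanSpace.single i 1))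
  have htr : ∀ B : Plane →L[ℝ] Plane, tr B = ∑ i, B (EuclideanSpace.single i 1) i := fun B => by
    simp [tr]
  rw [← htr, tr.map_tsum (h.summable_deriv x)]
  simp only [htr, h.div_eq_zero, tsum_zero]

theorem periodize_neg (h : IsDecayingKernel κ κ' p q A) (x : Plane) :
    periodize κ (-x) = -periodize κ x := by
  rw [periodize, periodize, ← tsum_neg]
  refine tsum_congr fun m => ?_
  rw [show -x + latticePoint m = -(x - latticePoint m) by abel,
    show -x - latticePoint m = -(x + latticePoint m) by abel, h.odd, h.odd, ← smul_neg]
  congr 1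
  abel

theorem tendsto_add_latticePoint (h : IsDecayingKernel κ κ' p q A) (x : Plane) :
    Tendsto (fun m : Fin 2 → ℤ => κ (x + latticePoint m)) cofinite (𝓝 0) := by
  have hq := h.pos
  have h1 := (summable_one_add_norm_latticePoint (p := 3) (by norm_num)).tendsto_cofinite_zero
  have h2 := h1.rpow_const (p := q / 3) (Or.inr (by positivity))
  rw [Real.zero_rpow (by positivity)] at h2
  have h3 := (h2.const_mul ((1 + ‖x‖) ^ q)).const_mul A
  simp only [mul_zero] at h3
  refine squeeze_zero_norm (fun m => ?_) h3
  refine (h.norm_le _).trans (mul_le_mul_of_nonneg_left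
    ((one_add_norm_add_rpow_le h.pos.le le_rfl _).trans (le_of_eq ?_)) h.const_nonneg)
  rw [← Real.rpow_mul (by positivity)]
  congr 2
  ring

theorem norm_add_sub_le (h : IsDecayingKernel κ κ' p q A) (x v : Plane) (m : Fin 2 → ℤ) :
    ‖κ (x + v + latticePoint m) - κ (x + latticePoint m)‖ ≤
      A * ((1 + (‖x‖ + ‖v‖)) ^ p * (1 + ‖latticePoint m‖) ^ (-p)) * ‖v‖ := by
  have := Convex.norm_image_sub_le_of_norm_hasFDerivWithin_le (𝕜 := ℝ)
    (f := fun y => κ (y + latticePoint m)) (f' := fun y => κ' (y + latticePoint m))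
    (s := Metric.closedBall 0 (‖x‖ + ‖v‖)) (x := x) (y := x + v)
    (fun y _ => ((hasFDerivAt_comp_add_right _).2 (h.hasFDerivAt _)).hasFDerivWithinAt)
    (fun y hy => h.norm_deriv_add_le (mem_closedBall_zero_iff.1 hy) m) (convex_closedBall _ _)
    (by simp) (by simpa using norm_add_le x v)
  simpa using this

/-- The increments `κ (x + e + m) - κ (x + m)` are summable by the mean value inequality even if the
values of `κ` are not, and they telescope to zero because `κ` vanishes at infinity. The other half
of each averaged term is the reflection `m ↦ -m`. -/
theorem periodize_add_single (h : IsDecayingKernel κ κ' p q A) (x : Plane) (i : Fin 2) :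
    periodize κ (x + latticePoint (Pi.single i 1)) = periodize κ x := by
  set e : Fin 2 → ℤ := Pi.single i 1 with he
  set a : (Fin 2 → ℤ) → Plane := fun m =>
    κ (x + latticePoint e + latticePoint m) - κ (x + latticePoint m) with ha
  have hsa : Summable a := Summable.of_norm_bounded
    ((h.summable_bound (‖x‖ + ‖latticePoint e‖)).mul_right _) fun m => h.norm_add_sub_le x _ m
  have ha0 : ∑' m, a m = 0 := by
    have e1 : a = fun m => κ (x + latticePoint (m + e)) - κ (x + latticePoint m) := by
      funext m
      rw [add_comm m e, latticePoint_add, ← add_assoc]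
    rw [e1] at hsa ⊢
    exact tsum_shift_sub_eq_zero i (b := fun m => κ (x + latticePoint m))
      (h.tendsto_add_latticePoint x) hsa
  have hsn : Summable fun m => a (-m) := (Equiv.neg (Fin 2 → ℤ)).summable_iff.2 hsa
  have han : ∑' m, a (-m) = 0 := by
    rw [← ha0]
    exact (Equiv.neg (Fin 2 → ℤ)).tsum_eq a
  rw [← sub_eq_zero, periodize, periodize, ← (h.summable_term _).tsum_sub (h.summable_term _)]
  have e2 : ∀ m, (1 / 2 : ℝ) • (κ (x + latticePoint e + latticePoint m) +
        κ (x + latticePoint e - latticePoint m)) -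
      (1 / 2 : ℝ) • (κ (x + latticePoint m) + κ (x - latticePoint m)) =
      (1 / 2 : ℝ) • (a m + a (-m)) := fun m => by
    simp only [ha, latticePoint_neg, ← sub_eq_add_neg, ← smul_sub]
    congr 1
    abel
  simp only [e2]
  rw [Summable.tsum_const_smul _ (hsa.add hsn), hsa.tsum_add hsn, ha0, han, add_zero, smul_zero]

theorem periodize_add_latticePoint (h : IsDecayingKernel κ κ' p q A) (x : Plane) (l : Fin 2 → ℤ) :
    periodize κ (x + latticePoint l) = periodize κ x := by
  have h1 : ∀ i, Function.Periodic (periodize κ) (latticePoint (Pi.single i 1)) := fun i x =>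
    h.periodize_add_single x i
  have h2 : latticePoint l = l 0 • latticePoint (Pi.single 0 1) +
      l 1 • latticePoint (Pi.single 1 1) := by
    ext i
    fin_cases i <;> simp [latticePoint]
  rw [h2]
  exact (((h1 0).zsmul (l 0)).add_period ((h1 1).zsmul (l 1))) x

end IsDecayingKernel

/-! ### The regularised kernel -/

/-- The rotation `x ↦ x^⊥`. -/
def rotL : Plane →L[ℝ] Plane :=
  LinearMap.toContinuousLinearMap
    { toFun := fun x => !₂[-(x 1), x 0]
      map_add' := fun x y => by ext i; fin_cases i <;> simp [add_comm]
      map_smul' := fun a x => by ext i; fin_cases i <;> simp }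

theorem rotL_apply (x : Plane) : rotL x = !₂[-(x 1), x 0] := rfl

theorem rotL_zero_coord (x : Plane) : rotL x 0 = -(x 1) := rfl

theorem rotL_one_coord (x : Plane) : rotL x 1 = x 0 := rfl

theorem norm_rotL_apply (x : Plane) : ‖rotL x‖ = ‖x‖ := by
  rw [EuclideanSpace.norm_eq, EuclideanSpace.norm_eq, Fin.sum_univ_two, Fin.sum_univ_two,
    rotL_zero_coord, rotL_one_coord, norm_neg, add_comm]

theorem norm_rotL_le : ‖rotL‖ ≤ 1 :=
  ContinuousLinearMap.opNorm_le_bound _ zero_le_one fun x => by rw [norm_rotL_apply, one_mul]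

theorem norm_planeKernel (ε : ℝ) (hε : ε < 1) (x : Plane) :
    ‖planeKernel ε x‖ = ‖x‖ ^ (-(2 - ε)) := by
  rw [planeKernel, ← rotL_apply, norm_smul, norm_rotL_apply, norm_inv,
    Real.norm_of_nonneg (by positivity)]
  rcases eq_or_ne x 0 with rfl | hx
  · rw [norm_zero, mul_zero, Real.zero_rpow (by linarith)]
  · have hx' : 0 < ‖x‖ := norm_pos_iff.2 hx
    rw [← Real.rpow_neg hx'.le]
    nth_rewrite 2 [← Real.rpow_one ‖x‖]
    rw [← Real.rpow_add hx']
    congr 1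
    ring

theorem planeKernel_neg (ε : ℝ) (x : Plane) : planeKernel ε (-x) = -planeKernel ε x := by
  rw [planeKernel, planeKernel, ← rotL_apply, ← rotL_apply, norm_neg, map_neg, smul_neg]

/-- The radial profile of the regularised kernel. -/
def cutProfile (ε δ r : ℝ) : ℝ :=
  Real.smoothTransition (2 * r / δ ^ 2 - 1) * r ^ (-((3 - ε) / 2))

/-- The kernel `x^⊥ / |x|^{3-ε}`, smoothly cut off in the ball of radius `δ`. -/
def cutKernel (ε δ : ℝ) (x : Plane) : Plane :=
  Real.smoothTransition (2 * ‖x‖ ^ 2 / δ ^ 2 - 1) • planeKernel ε x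

theorem cutKernel_eq (ε δ : ℝ) (x : Plane) :
    cutKernel ε δ x = cutProfile ε δ (‖x‖ ^ 2) • rotL x := by
  rw [cutKernel, planeKernel, ← rotL_apply, smul_smul, cutProfile, ← Real.rpow_natCast ‖x‖ 2,
    ← Real.rpow_mul (norm_nonneg x), ← Real.rpow_neg (norm_nonneg x)]
  congr 3
  push_cast
  ring

theorem contDiff_cutProfile (ε : ℝ) {δ : ℝ} (hδ : 0 < δ) : ContDiff ℝ 1 (cutProfile ε δ) := by
  refine contDiff_iff_contDiffAt.2 fun r => ?_
  rcases lt_or_ge 0 r with hr | hr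
  · have h1 : ContDiffAt ℝ 1 (fun r : ℝ => Real.smoothTransition (2 * r / δ ^ 2 - 1)) r :=
      (Real.smoothTransition.contDiff (n := 1)).contDiffAt.comp r (by fun_prop)
    exact h1.mul (Real.contDiffAt_rpow_const_of_ne hr.ne')
  -- For arguments below `δ² / 2` the transition function is zero, so the profile vanishes near
  -- every `r ≤ 0` and the power is never differentiated at its singularity.
  · have h1 : ∀ᶠ y in 𝓝 r, cutProfile ε δ y = 0 := by
      filter_upwards [gt_mem_nhds (hr.trans_lt (by positivity : 0 < δ ^ 2 / 2))] with y hy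
      rw [cutProfile, Real.smoothTransition.zero_of_nonpos, zero_mul]
      rw [sub_nonpos, div_le_one (by positivity)]
      linarith
    exact contDiffAt_const.congr_of_eventuallyEq h1

/-- The derivative of the regularised kernel. -/
def cutKernelDeriv (ε δ : ℝ) (x : Plane) : Plane →L[ℝ] Plane :=
  cutProfile ε δ (‖x‖ ^ 2) • rotL +
    (deriv (cutProfile ε δ) (‖x‖ ^ 2) • ((2 : ℝ) • innerSL ℝ x)).smulRight (rotL x)

theorem hasFDerivAt_cutKernel (ε : ℝ) {δ : ℝ} (hδ : 0 < δ) (x : Plane) :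
    HasFDerivAt (cutKernel ε δ) (cutKernelDeriv ε δ x) x := by
  have h1 : HasFDerivAt (fun x : Plane => ‖x‖ ^ 2) ((2 : ℝ) • innerSL ℝ x) x := by
    have := (hasStrictFDerivAt_norm_sq x).hasFDerivAt
    simpa only [two_smul] using this
  have h2 := (((contDiff_cutProfile ε hδ).differentiable one_ne_zero
    (‖x‖ ^ 2)).hasDerivAt).comp_hasFDerivAt x h1
  have h3 := h2.smul rotL.hasFDerivAt (x := x)
  rw [show cutKernel ε δ = fun x => cutProfile ε δ (‖x‖ ^ 2) • rotL x from
    funext (cutKernel_eq ε δ)]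
  exact h3

theorem continuous_cutKernelDeriv (ε : ℝ) {δ : ℝ} (hδ : 0 < δ) :
    Continuous (cutKernelDeriv ε δ) := by
  have h0 := contDiff_cutProfile ε hδ
  have h1 : Continuous (cutProfile ε δ) := h0.continuous
  have h2 : Continuous (deriv (cutProfile ε δ)) := h0.continuous_deriv le_rfl
  have h3 : Continuous fun x : Plane => ‖x‖ ^ 2 := by fun_prop
  have h4 : Continuous fun x : Plane =>
      deriv (cutProfile ε δ) (‖x‖ ^ 2) • ((2 : ℝ) • innerSL ℝ x) :=
    (h2.comp h3).smul ((innerSL ℝ).continuous.const_smul (2 : ℝ))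
  have h5 : Continuous fun x : Plane => ContinuousLinearMap.smulRightL ℝ Plane Plane
      (deriv (cutProfile ε δ) (‖x‖ ^ 2) • ((2 : ℝ) • innerSL ℝ x)) (rotL x) :=
    ((ContinuousLinearMap.smulRightL ℝ Plane Plane).continuous.comp h4).clm_apply rotL.continuous
  exact ((h1.comp h3).smul continuous_const).add h5

theorem cutKernel_eq_planeKernel {ε δ : ℝ} (hδ : 0 < δ) {x : Plane} (hx : δ ≤ ‖x‖) :
    cutKernel ε δ x = planeKernel ε x := by
  rw [cutKernel, Real.smoothTransition.one_of_one_le, one_smul]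
  have : 1 ≤ ‖x‖ ^ 2 / δ ^ 2 := by
    rw [one_le_div (by positivity)]
    exact pow_le_pow_left₀ hδ.le hx 2
  rw [mul_div_assoc]
  linarith

theorem norm_cutKernel_le {ε : ℝ} (hε : ε < 1) (δ : ℝ) (x : Plane) :
    ‖cutKernel ε δ x‖ ≤ ‖x‖ ^ (-(2 - ε)) := by
  rw [cutKernel, norm_smul, norm_planeKernel ε hε,
    Real.norm_of_nonneg (Real.smoothTransition.nonneg _)]
  exact mul_le_of_le_one_left (by positivity) (Real.smoothTransition.le_one _)

theorem norm_cutKernelDeriv_le {ε δ : ℝ} (hε : ε < 1) (hδ : 0 < δ) (hδ1 : δ ≤ 1) {x : Plane}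
    (hx : 1 < ‖x‖) : ‖cutKernelDeriv ε δ x‖ ≤ (1 + (3 - ε)) * ‖x‖ ^ (-(3 - ε)) := by
  set s := (3 - ε) / 2 with hs
  have hs0 : 0 < s := by rw [hs]; linarith
  have hr : 1 < ‖x‖ ^ 2 := one_lt_pow₀ hx two_ne_zero
  have hr0 : 0 < ‖x‖ ^ 2 := by linarith
  have he : ∀ r : ℝ, 1 < r → cutProfile ε δ r = r ^ (-s) := fun r h => by
    rw [cutProfile, Real.smoothTransition.one_of_one_le, one_mul]
    have : 1 ≤ r / δ ^ 2 := by
      rw [one_le_div (by positivity)]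
      exact (pow_le_one₀ hδ.le hδ1).trans h.le
    rw [mul_div_assoc]
    linarith
  have hd : deriv (cutProfile ε δ) (‖x‖ ^ 2) = -s * (‖x‖ ^ 2) ^ (-s - 1) := by
    have h1 : cutProfile ε δ =ᶠ[𝓝 (‖x‖ ^ 2)] fun r => r ^ (-s) := by
      filter_upwards [lt_mem_nhds hr] with r h using he r h
    rw [h1.deriv_eq, Real.deriv_rpow_const]
  have e1 : (‖x‖ ^ 2) ^ (-s) = ‖x‖ ^ (-(3 - ε)) := by
    rw [← Real.rpow_natCast ‖x‖ 2, ← Real.rpow_mul (norm_nonneg x)]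
    congr 1
    rw [hs]
    push_cast
    ring
  have e2 : (‖x‖ ^ 2) ^ (-s - 1) * (‖x‖ * ‖x‖) = (‖x‖ ^ 2) ^ (-s) := by
    rw [Real.rpow_sub hr0, Real.rpow_one, ← sq]
    field_simp
  rw [cutKernelDeriv, he _ hr, hd]
  refine (norm_add_le _ _).trans ?_
  rw [norm_smul, ContinuousLinearMap.norm_smulRight_apply, norm_smul, norm_smul, innerSL_apply_norm,
    norm_rotL_apply, norm_mul, norm_neg, Real.norm_of_nonneg hs0.le,
    Real.norm_of_nonneg (by positivity : 0 ≤ (‖x‖ ^ 2) ^ (-s)),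
    Real.norm_of_nonneg (by positivity : 0 ≤ (‖x‖ ^ 2) ^ (-s - 1)), Real.norm_two]
  have e3 : s * (‖x‖ ^ 2) ^ (-s - 1) * (2 * ‖x‖) * ‖x‖ = 2 * s * (‖x‖ ^ 2) ^ (-s) := by
    rw [← e2]
    ring
  rw [e3, e1]
  have := mul_le_of_le_one_right (by positivity : 0 ≤ ‖x‖ ^ (-(3 - ε))) norm_rotL_le
  have h2s : 2 * s = 3 - ε := by rw [hs]; ring
  rw [h2s]
  linarith

theorem exists_forall_norm_le_rpow {F : Type*} [NormedAddCommGroup F] {f : Plane → F} {q C : ℝ}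
    (hq : 0 ≤ q) (hf : Continuous f) (h : ∀ x, 1 < ‖x‖ → ‖f x‖ ≤ C * ‖x‖ ^ (-q)) :
    ∃ A, ∀ x, ‖f x‖ ≤ A * (1 + ‖x‖) ^ (-q) := by
  obtain ⟨B, hB⟩ := (isCompact_closedBall (0 : Plane) 1).bddAbove_image hf.norm.continuousOn
  have key : ∀ x : Plane, ∀ y : ℝ, 0 < y → 1 + ‖x‖ ≤ 2 * y →
      y ^ (-q) ≤ 2 ^ q * (1 + ‖x‖) ^ (-q) := by
    intro x y hy hxy
    have h1 : (2 * y) ^ (-q) ≤ (1 + ‖x‖) ^ (-q) :=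
      Real.rpow_le_rpow_of_nonpos (by positivity) hxy (by linarith)
    rw [Real.mul_rpow (by norm_num) hy.le] at h1
    calc y ^ (-q) = 2 ^ q * (2 ^ (-q) * y ^ (-q)) := by
          rw [← mul_assoc, ← Real.rpow_add two_pos, add_neg_cancel, Real.rpow_zero, one_mul]
      _ ≤ _ := mul_le_mul_of_nonneg_left h1 (by positivity)
  refine ⟨max |B| |C| * 2 ^ q, fun x => ?_⟩
  rw [mul_assoc]
  rcases le_or_gt ‖x‖ 1 with hx | hx
  · have h1 : ‖f x‖ ≤ B := hB (Set.mem_image_of_mem _ (by simpa using hx))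
    have h2 := key x 1 one_pos (by linarith)
    rw [Real.one_rpow] at h2
    calc ‖f x‖ ≤ max |B| |C| * 1 := by
          rw [mul_one]
          exact h1.trans ((le_abs_self B).trans (le_max_left _ _))
      _ ≤ _ := mul_le_mul_of_nonneg_left h2 (by positivity)
  · calc ‖f x‖ ≤ C * ‖x‖ ^ (-q) := h x hx
      _ ≤ max |B| |C| * ‖x‖ ^ (-q) := mul_le_mul_of_nonneg_right
          ((le_abs_self C).trans (le_max_right _ _)) (by positivity)
      _ ≤ _ := mul_le_mul_of_nonneg_left (key x ‖x‖ (by linarith) (by linarith)) (by positivity)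

/-- A radial multiple of `x^⊥` is divergence free: the rotation has trace zero and the gradient of
the profile is parallel to `x`. The derivative decays with exponent `3 - ε`, which exceeds the
dimension because `ε < 1`. -/
theorem isDecayingKernel_cutKernel {ε δ : ℝ} (hε₁ : ε < 1) (hδ : 0 < δ)
    (hδ1 : δ ≤ 1) : ∃ A, IsDecayingKernel (cutKernel ε δ) (cutKernelDeriv ε δ) (3 - ε) (2 - ε) A := by
  have hc : Continuous (cutKernel ε δ) :=
    continuous_iff_continuousAt.2 fun x => (hasFDerivAt_cutKernel ε hδ x).continuousAt
  obtain ⟨A₁, h₁⟩ := exists_forall_norm_le_rpow (q := 2 - ε) (C := 1) (by linarith) hc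
    fun x _ => by rw [one_mul]; exact norm_cutKernel_le hε₁ δ x
  obtain ⟨A₂, h₂⟩ := exists_forall_norm_le_rpow (by linarith) (continuous_cutKernelDeriv ε hδ)
    fun x hx => norm_cutKernelDeriv_le hε₁ hδ hδ1 hx
  refine ⟨max A₁ A₂, fun x => ?_, hasFDerivAt_cutKernel ε hδ, continuous_cutKernelDeriv ε hδ,
    by linarith, by linarith, fun x => (h₁ x).trans ?_, fun x => (h₂ x).trans ?_, fun x => ?_⟩
  · rw [cutKernel, cutKernel, norm_neg, planeKernel_neg, smul_neg]
  · exact mul_le_mul_of_nonneg_right (le_max_left _ _) (by positivity)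
  · exact mul_le_mul_of_nonneg_right (le_max_right _ _) (by positivity)
  · simp only [cutKernelDeriv, Fin.sum_univ_two, _root_.add_apply,
      _root_.smul_apply, ContinuousLinearMap.smulRight_apply, PiLp.add_apply,
      PiLp.smul_apply, rotL_zero_coord, rotL_one_coord, innerSL_apply_apply, smul_eq_mul,
      EuclideanSpace.inner_single_right]
    simp
    ring

/-- The regularised periodic kernel. -/
def regKernel (c ε δ : ℝ) (x : Plane) : Plane := c • periodize (cutKernel ε δ) x

theorem kernel_zero (c ε : ℝ) : kernel c ε 0 = 0 := by
  simp [kernel, planeKernel_neg]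

theorem regKernel_zero (c ε δ : ℝ) : regKernel c ε δ 0 = 0 := by
  have : ∀ x, cutKernel ε δ (-x) = -cutKernel ε δ x := fun x => by
    rw [cutKernel, cutKernel, norm_neg, planeKernel_neg, smul_neg]
  simp [regKernel, periodize, this]

/-- The projection to the torus does not increase norms, so all lattice translates of `x` lie
outside the ball of radius `δ` and no term of the series is cut. -/
theorem regKernel_eq_kernel (c ε : ℝ) {δ : ℝ} (hδ : 0 < δ) {x : Plane} (hx : δ ≤ ‖toTorus x‖) :
    regKernel c ε δ x = kernel c ε x := by
  have h1 : ∀ m, δ ≤ ‖x + latticePoint m‖ := fun m => by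
    refine hx.trans ?_
    have : toTorus x = toTorus (x + latticePoint m) := by
      rw [toTorus_add, toTorus_latticePoint, add_zero]
    rw [this]
    exact norm_toTorus_le _
  rw [regKernel, kernel, periodize]
  congr 1
  refine tsum_congr fun m => ?_
  have h2 := h1 (-m)
  rw [latticePoint_neg, ← sub_eq_add_neg] at h2
  rw [cutKernel_eq_planeKernel hδ (h1 m), cutKernel_eq_planeKernel hδ h2]

/-- In the cell `[-1/2, 1/2]²` every nonzero lattice point is at distance at least `1/2`, so only
the term `m = 0` feels the truncation. The remainder does not depend on `δ`, and this is the source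
of the uniformity in `δ` of all kernel bounds. -/
theorem periodize_cutKernel_sub {ε δ δ' : ℝ} (hε₁ : ε < 1) (hδ : 0 < δ)
    (hδ1 : δ ≤ 1 / 2) (hδ' : 0 < δ') (hδ1' : δ' ≤ 1 / 2) {z : Plane} (hz : ∀ i, |z i| ≤ 1 / 2) :
    periodize (cutKernel ε δ) z - cutKernel ε δ z =
      periodize (cutKernel ε δ') z - cutKernel ε δ' z := by
  obtain ⟨A, hA⟩ := isDecayingKernel_cutKernel (ε := ε) hε₁ hδ (by linarith)
  obtain ⟨A', hA'⟩ := isDecayingKernel_cutKernel (ε := ε) hε₁ hδ' (by linarith)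
  have hfar : ∀ m : Fin 2 → ℤ, m ≠ 0 → 1 / 2 ≤ ‖z + latticePoint m‖ := fun m hm => by
    obtain ⟨i, hi⟩ := Function.ne_iff.1 hm
    refine le_trans ?_ (abs_apply_le_norm _ i)
    have h1 : (1 : ℝ) ≤ |(m i : ℝ)| := by
      exact_mod_cast Int.one_le_abs hi
    have h2 : |(m i : ℝ)| ≤ |(z + latticePoint m) i| + |z i| := by
      have := abs_sub ((z + latticePoint m) i) (z i)
      simpa [latticePoint] using this
    linarith [hz i]
  have key : periodize (cutKernel ε δ) z - periodize (cutKernel ε δ') z =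
      cutKernel ε δ z - cutKernel ε δ' z := by
    rw [periodize, periodize, ← (hA.summable_term z).tsum_sub (hA'.summable_term z),
      tsum_eq_single 0]
    · simp only [latticePoint_zero, add_zero, sub_zero, ← two_smul ℝ, smul_smul]
      norm_num
    · intro m hm
      have h1 := hfar m hm
      have h2 := hfar (-m) (neg_ne_zero.2 hm)
      rw [latticePoint_neg, ← sub_eq_add_neg] at h2
      rw [cutKernel_eq_planeKernel hδ (hδ1.trans h1), cutKernel_eq_planeKernel hδ (hδ1.trans h2),
        cutKernel_eq_planeKernel hδ' (hδ1'.trans h1), cutKernel_eq_planeKernel hδ' (hδ1'.trans h2),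
        sub_self]
  rw [sub_eq_sub_iff_sub_eq_sub, key]

/-- Up to a Lipschitz error independent of `δ`, the regularised periodic kernel is the cut off
kernel of the plane. -/
theorem exists_norm_regKernel_sub_le (c : ℝ) {ε : ℝ} (hε₁ : ε < 1) :
    ∃ C, 0 ≤ C ∧ ∀ δ : ℝ, 0 < δ → δ ≤ 1 / 2 → ∀ z : Plane, (∀ i, |z i| ≤ 1 / 2) →
      ‖regKernel c ε δ z - c • cutKernel ε δ z‖ ≤ C * ‖z‖ := by
  obtain ⟨A, hA⟩ := isDecayingKernel_cutKernel (ε := ε) hε₁ (δ := 1 / 2) (by norm_num) (by norm_num)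
  set f' : Plane → Plane →L[ℝ] Plane := fun x =>
    (∑' m : Fin 2 → ℤ, cutKernelDeriv ε (1 / 2) (x + latticePoint m)) - cutKernelDeriv ε (1 / 2) x
  have hd : ∀ x, HasFDerivAt (fun x => periodize (cutKernel ε (1 / 2)) x - cutKernel ε (1 / 2) x)
      (f' x) x := fun x => (hA.hasFDerivAt_periodize x).sub (hA.hasFDerivAt x)
  have hc : Continuous f' := hA.continuous_tsum_deriv.sub hA.continuous_deriv
  obtain ⟨B, hB⟩ := (isCompact_closedBall (0 : Plane) 1).bddAbove_image hc.norm.continuousOn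
  have hB0 : 0 ≤ B := (norm_nonneg _).trans
    (hB (Set.mem_image_of_mem _ (Metric.mem_closedBall_self zero_le_one)))
  refine ⟨|c| * B, by positivity, fun δ hδ hδ1 z hz => ?_⟩
  have hz1 : ‖z‖ ≤ 1 := by simpa using norm_le_two_mul hz
  have h1 := (convex_closedBall (0 : Plane) 1).norm_image_sub_le_of_norm_hasFDerivWithin_le
    (fun x _ => (hd x).hasFDerivWithinAt) (fun x hx => hB (Set.mem_image_of_mem _ hx))
    (Metric.mem_closedBall_self zero_le_one) (mem_closedBall_zero_iff.2 hz1)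
  -- Oddness makes the remainder vanish at the origin, which improves the bound from a constant to a
  -- multiple of `‖z‖`. The collision estimate relies on this.
  have h0 : periodize (cutKernel ε (1 / 2)) 0 - cutKernel ε (1 / 2) 0 = 0 := by
    have := regKernel_zero 1 ε (1 / 2)
    rw [regKernel, one_smul] at this
    rw [this, hA.zero, sub_zero]
  rw [h0, sub_zero, sub_zero, ← periodize_cutKernel_sub hε₁ hδ hδ1 (by norm_num) le_rfl hz] at h1
  rw [regKernel, ← smul_sub, norm_smul, Real.norm_eq_abs, mul_assoc]
  exact mul_le_mul_of_nonneg_left h1 (abs_nonneg c)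

theorem exists_norm_regKernel_le (c : ℝ) {ε : ℝ} (hε₀ : 0 < ε) (hε₁ : ε < 1) :
    ∃ C, 0 ≤ C ∧ ∀ δ : ℝ, 0 < δ → δ ≤ 1 / 2 → ∀ z : Plane, (∀ i, |z i| ≤ 1 / 2) →
      ‖regKernel c ε δ z‖ ≤ C * ‖z‖ ^ (-(2 - ε)) := by
  obtain ⟨C, hC, h⟩ := exists_norm_regKernel_sub_le c hε₁
  refine ⟨|c| + C, by positivity, fun δ hδ hδ1 z hz => ?_⟩
  have h1 := h δ hδ hδ1 z hz
  rcases eq_or_ne z 0 with rfl | hz0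
  · rw [regKernel_zero, norm_zero]
    positivity
  have hz1 : ‖z‖ ≤ 1 := by simpa using norm_le_two_mul hz
  have hz2 : ‖z‖ ≤ ‖z‖ ^ (-(2 - ε)) := by
    nth_rewrite 1 [← Real.rpow_one ‖z‖]
    exact Real.rpow_le_rpow_of_exponent_ge (norm_pos_iff.2 hz0) hz1 (by linarith)
  have h2 : ‖c • cutKernel ε δ z‖ ≤ |c| * ‖z‖ ^ (-(2 - ε)) := by
    rw [norm_smul, Real.norm_eq_abs]
    exact mul_le_mul_of_nonneg_left (norm_cutKernel_le hε₁ δ z) (abs_nonneg c)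
  have h3 := norm_add_le (regKernel c ε δ z - c • cutKernel ε δ z) (c • cutKernel ε δ z)
  rw [sub_add_cancel] at h3
  nlinarith [mul_le_mul_of_nonneg_left hz2 hC]

/-! ### The flow of a bounded Lipschitz vector field -/

section Flow

variable {E : Type*} [NormedAddCommGroup E] [NormedSpace ℝ E]

/-- The integral curve of `b` starting at `x` (a junk value if there is none). -/
def flowOf (b : E → E) (x : E) : ℝ → E :=
  Classical.epsilon fun α => α 0 = x ∧ ∀ t, HasDerivAt α (b (α t)) t

/-- Since the field is bounded, Picard–Lindelöf applies on every interval `[-R, R]` at once; the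
solutions are glued by uniqueness. -/
theorem exists_integralCurve [CompleteSpace E] {b : E → E} {L B : NNReal} (hL : LipschitzWith L b)
    (hB : ∀ x, ‖b x‖ ≤ B) (x : E) : ∃ α : ℝ → E, α 0 = x ∧ ∀ t, HasDerivAt α (b (α t)) t := by
  have hR : ∀ R : ℝ, 0 < R → ∃ α : ℝ → E, α 0 = x ∧
      ∀ t ∈ Set.Icc (-R) R, HasDerivWithinAt α (b (α t)) (Set.Icc (-R) R) t := by
    intro R hR
    let t₀ : Set.Icc (-R) R := ⟨0, by constructor <;> linarith⟩
    have hpl : IsPicardLindelof (fun _ => b) t₀ x (B * R.toNNReal) 0 B L :=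
      IsPicardLindelof.of_time_independent (fun y _ => hB y) hL.lipschitzOnWith
        (by simp [t₀, hR.le])
    exact hpl.exists_eq_forall_mem_Icc_hasDerivWithinAt₀
  choose! α hα0 hα using hR
  have hagree : ∀ R R' : ℝ, 0 < R → R ≤ R' → Set.EqOn (α R) (α R') (Set.Icc (-R) R) := by
    intro R R' hRp hRR'
    have hsub : Set.Icc (-R) R ⊆ Set.Icc (-R') R' := Set.Icc_subset_Icc (by linarith) hRR'
    have hd : ∀ r, R ≤ r → ∀ t ∈ Set.Ioo (-R) R, HasDerivAt (α r) (b (α r t)) t := fun r hr t ht =>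
      (hα r (by linarith) t ⟨by linarith [ht.1], by linarith [ht.2]⟩).hasDerivAt
        (Icc_mem_nhds (by linarith [ht.1]) (by linarith [ht.2]))
    have hcR : ContinuousOn (α R) (Set.Icc (-R) R) := fun t ht =>
      (hα R hRp t ht).continuousWithinAt
    have hcR' : ContinuousOn (α R') (Set.Icc (-R) R) := fun t ht =>
      (hα R' (by linarith) t (hsub ht)).continuousWithinAt.mono hsub
    exact ODE_solution_unique_of_mem_Icc (v := fun _ => b) (s := fun _ => Set.univ) (t₀ := 0)
      (fun _ _ => hL.lipschitzOnWith) (by constructor <;> linarith) hcR (hd R le_rfl)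
      (fun _ _ => trivial) hcR' (hd R' hRR') (fun _ _ => trivial)
      (by rw [hα0 R hRp, hα0 R' (by linarith)])
  refine ⟨fun t => α (|t| + 1) t, hα0 _ (by positivity), fun t => ?_⟩
  have hev : (fun t => α (|t| + 1) t) =ᶠ[𝓝 t] α (|t| + 2) := by
    have h1 : ∀ᶠ s in 𝓝 t, |s| < |t| + 1 :=
      continuous_abs.continuousAt.eventually_lt_const (by linarith)
    filter_upwards [h1] with s hs
    exact hagree _ _ (by positivity) (by linarith) (abs_le.1 (by linarith))
  have hlt : |t| < |t| + 2 := by linarith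
  have hd := (hα (|t| + 2) (by positivity) t (abs_le.1 hlt.le)).hasDerivAt
    (Icc_mem_nhds (abs_lt.1 hlt).1 (abs_lt.1 hlt).2)
  rw [← hev.eq_of_nhds] at hd
  exact hd.congr_of_eventuallyEq hev

variable [CompleteSpace E] {b b' : E → E} {L L' B B' : NNReal}

theorem flowOf_zero (hL : LipschitzWith L b) (hB : ∀ x, ‖b x‖ ≤ B) (x : E) : flowOf b x 0 = x :=
  (Classical.epsilon_spec (exists_integralCurve hL hB x)).1

theorem hasDerivAt_flowOf (hL : LipschitzWith L b) (hB : ∀ x, ‖b x‖ ≤ B) (x : E) (t : ℝ) :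
    HasDerivAt (flowOf b x) (b (flowOf b x t)) t :=
  (Classical.epsilon_spec (exists_integralCurve hL hB x)).2 t

theorem continuous_flowOf_time (hL : LipschitzWith L b) (hB : ∀ x, ‖b x‖ ≤ B) (x : E) :
    Continuous (flowOf b x) :=
  continuous_iff_continuousAt.2 fun t => (hasDerivAt_flowOf hL hB x t).continuousAt

theorem eqOn_flowOf (hL : LipschitzWith L b) (hB : ∀ x, ‖b x‖ ≤ B) {T : ℝ} {α : ℝ → E}
    (hc : ContinuousOn α (Set.Icc 0 T))
    (hα : ∀ t ∈ Set.Ico 0 T, HasDerivWithinAt α (b (α t)) (Set.Ici t) t) :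
    Set.EqOn α (flowOf b (α 0)) (Set.Icc 0 T) :=
  ODE_solution_unique (v := fun _ => b) (fun _ => hL) hc hα
    (continuous_flowOf_time hL hB _).continuousOn
    (fun t _ => (hasDerivAt_flowOf hL hB _ t).hasDerivWithinAt) (flowOf_zero hL hB _).symm

theorem flowOf_add (hL : LipschitzWith L b) (hB : ∀ x, ‖b x‖ ≤ B) (x : E) (s : ℝ) {t : ℝ}
    (ht : 0 ≤ t) : flowOf b x (s + t) = flowOf b (flowOf b x s) t := by
  have hd : ∀ r, HasDerivAt (fun r => flowOf b x (s + r)) (b (flowOf b x (s + r))) r := fun r =>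
    (hasDerivAt_flowOf hL hB x (s + r)).comp_const_add s r
  have h := eqOn_flowOf hL hB (T := t) (α := fun r => flowOf b x (s + r))
    (fun r _ => (hd r).continuousAt.continuousWithinAt) (fun r _ => (hd r).hasDerivWithinAt)
    (Set.right_mem_Icc.2 ht)
  simpa using h

theorem dist_flowOf_le (hL : LipschitzWith L b) (hB : ∀ x, ‖b x‖ ≤ B) (x y : E) {t : ℝ}
    (ht : 0 ≤ t) : dist (flowOf b x t) (flowOf b y t) ≤ dist x y * Real.exp (L * t) := by
  have := dist_le_of_trajectories_ODE (v := fun _ => b) (fun _ => hL) (a := 0) (b := t)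
    (continuous_flowOf_time hL hB x).continuousOn
    (fun t _ => (hasDerivAt_flowOf hL hB x t).hasDerivWithinAt)
    (continuous_flowOf_time hL hB y).continuousOn
    (fun t _ => (hasDerivAt_flowOf hL hB y t).hasDerivWithinAt) le_rfl t (Set.right_mem_Icc.2 ht)
  rwa [flowOf_zero hL hB, flowOf_zero hL hB, sub_zero] at this

theorem dist_flowOf_flowOf_le (hL : LipschitzWith L b) (hB : ∀ x, ‖b x‖ ≤ B)
    (hL' : LipschitzWith L' b') (hB' : ∀ x, ‖b' x‖ ≤ B') {η : ℝ} (h : ∀ x, dist (b' x) (b x) ≤ η)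
    (x y : E) {t : ℝ} (ht : 0 ≤ t) :
    dist (flowOf b x t) (flowOf b' y t) ≤ gronwallBound (dist x y) L η t := by
  have := dist_le_of_approx_trajectories_ODE (v := fun _ => b) (εf := 0) (εg := η)
    (δ := dist x y) (fun _ => hL) (a := 0) (b := t)
    (continuous_flowOf_time hL hB x).continuousOn
    (fun t _ => (hasDerivAt_flowOf hL hB x t).hasDerivWithinAt)
    (fun t _ => (dist_self _).le)
    (continuous_flowOf_time hL' hB' y).continuousOn
    (fun t _ => (hasDerivAt_flowOf hL' hB' y t).hasDerivWithinAt)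
    (fun t _ => h _) (by rw [flowOf_zero hL hB, flowOf_zero hL' hB']) t (Set.right_mem_Icc.2 ht)
  rwa [zero_add, sub_zero] at this

theorem norm_flowOf_sub_le (hL : LipschitzWith L b) (hB : ∀ x, ‖b x‖ ≤ B) (x : E) (s t : ℝ) :
    ‖flowOf b x t - flowOf b x s‖ ≤ B * |t - s| :=
  convex_univ.norm_image_sub_le_of_norm_hasDerivWithin_le
    (fun r _ => (hasDerivAt_flowOf hL hB x r).hasDerivWithinAt) (fun _ _ => hB _) trivial trivial

/-- One step of Euler's scheme: during time `h` the point moves by at most `B h`, so the velocity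
changes by at most `L B h`. -/
theorem norm_flowOf_sub_sub_le (hL : LipschitzWith L b) (hB : ∀ x, ‖b x‖ ≤ B) (x : E) {h : ℝ}
    (hh : 0 ≤ h) : ‖flowOf b x h - (x + h • b x)‖ ≤ L * B * h ^ 2 := by
  have hd : ∀ r ∈ Set.Icc 0 h, HasDerivWithinAt (fun r => flowOf b x r - r • b x)
      (b (flowOf b x r) - b x) (Set.Icc 0 h) r := fun r _ => by
    have := (hasDerivAt_flowOf hL hB x r).sub ((hasDerivAt_id r).smul_const (b x))
    rw [one_smul] at this
    exact this.hasDerivWithinAt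
  have hb : ∀ r ∈ Set.Icc 0 h, ‖b (flowOf b x r) - b x‖ ≤ L * (B * h) := fun r hr => by
    have h1 := hL.norm_sub_le (flowOf b x r) x
    have h2 := norm_flowOf_sub_le hL hB x 0 r
    rw [flowOf_zero hL hB, sub_zero, abs_of_nonneg hr.1] at h2
    refine h1.trans (mul_le_mul_of_nonneg_left (h2.trans ?_) L.2)
    exact mul_le_mul_of_nonneg_left hr.2 B.2
  have := (convex_Icc (0 : ℝ) h).norm_image_sub_le_of_norm_hasDerivWithin_le hd hb
    (Set.left_mem_Icc.2 hh) (Set.right_mem_Icc.2 hh)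
  rw [flowOf_zero hL hB, sub_zero, zero_smul, sub_zero, Real.norm_of_nonneg hh] at this
  calc ‖flowOf b x h - (x + h • b x)‖ = ‖flowOf b x h - h • b x - x‖ := by congr 1; abel
    _ ≤ L * (B * h) * h := this
    _ = _ := by ring

end Flow

/-! ### Flows of divergence free fields preserve the Haar measure -/

section Divergence

variable {E M : Type*} [NormedAddCommGroup E] [NormedSpace ℝ E] [NormedAddCommGroup M]
  [CompactSpace M] [MeasurableSpace M] [BorelSpace M]

/-- `d` is the divergence of the field `b` on `M`, in the weak sense that the maps
`x ↦ x + h b(x)` push `μ` to `(1 - h d) μ` up to an error of order `h²`; `q` is the quotient map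
from the space `E` of directions to `M`. -/
structure HasDivergence (μ : Measure M) (q : E →+ M) (b : M → E) (d : M → ℝ) : Prop where
  lipschitz : ∃ K : NNReal, LipschitzWith K (b ∘ q)
  continuous : Continuous d
  expand : ∀ L A : NNReal, ∃ C : ℝ, ∀ G : M → ℝ, LipschitzWith L (G ∘ q) → (∀ x, |G x| ≤ A) →
    ∀ h ∈ Set.Icc (0 : ℝ) 1,
      |∫ x, G (x + q (h • b x)) ∂μ - ∫ x, G x ∂μ + h * ∫ x, G x * d x ∂μ| ≤ C * h ^ 2

variable {μ : Measure M} {q : E →+ M}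

theorem continuous_of_lipschitz_lift {F : Type*} [PseudoEMetricSpace F] (hq : IsOpenQuotientMap q)
    {G : M → F} {L : NNReal} (h : LipschitzWith L (G ∘ q)) : Continuous G :=
  hq.isQuotientMap.continuous_iff.2 h.continuous

theorem exists_bound_of_continuous {F : Type*} [SeminormedAddCommGroup F] {G : M → F}
    (h : Continuous G) : ∃ B : NNReal, ∀ x, ‖G x‖ ≤ B := by
  obtain ⟨C, hC⟩ := isCompact_univ.exists_bound_of_continuousOn h.continuousOn
  exact ⟨C.toNNReal, fun x => (hC x trivial).trans (Real.le_coe_toNNReal C)⟩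

theorem integrable_of_continuous_compact [IsFiniteMeasure μ] {G : M → ℝ} (h : Continuous G) :
    Integrable G μ :=
  h.integrable_of_hasCompactSupport (HasCompactSupport.of_compactSpace _)

theorem norm_apply_add_sub_le {F : Type*} [SeminormedAddCommGroup F] (hq : IsOpenQuotientMap q)
    {G : M → F} {L : NNReal} (h : LipschitzWith L (G ∘ q)) (x : M) (z z' : E) :
    ‖G (x + q z) - G (x + q z')‖ ≤ L * ‖z - z'‖ := by
  obtain ⟨y, rfl⟩ := hq.surjective x
  have := h.norm_sub_le (y + z) (y + z')
  simpa using this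

theorem abs_integral_sub_le [IsProbabilityMeasure μ] {f g : M → ℝ} (hf : Continuous f)
    (hg : Continuous g) {C : ℝ} (h : ∀ x, |f x - g x| ≤ C) : |∫ x, f x ∂μ - ∫ x, g x ∂μ| ≤ C := by
  rw [← integral_sub (integrable_of_continuous_compact hf) (integrable_of_continuous_compact hg)]
  have := norm_integral_le_of_norm_le_const (μ := μ) (f := fun x => f x - g x)
    (Eventually.of_forall h)
  simpa using this

theorem HasDivergence.zero : HasDivergence μ q 0 0 where
  lipschitz := ⟨0, LipschitzWith.const _⟩
  continuous := continuous_const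
  expand L A := ⟨0, fun G _ _ h _ => by simp⟩

theorem HasDivergence.continuous_field {b : M → E} {d : M → ℝ} (hq : IsOpenQuotientMap q)
    (h : HasDivergence μ q b d) : Continuous b :=
  continuous_of_lipschitz_lift hq h.lipschitz.choose_spec

/-- A step along `b + b'` is, up to `O(h²)`, a step along `b` followed by one along `b'`. The
expansion of `b` is applied to `x ↦ G (x + h b'(x))`, which depends on `h`; hence the requirement
that the constant in `expand` depend only on the Lipschitz constant and the bound of the test
function. -/
theorem HasDivergence.add [IsProbabilityMeasure μ] (hq : IsOpenQuotientMap q) {b b' : M → E}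
    {d d' : M → ℝ} (hb : HasDivergence μ q b d) (hb' : HasDivergence μ q b' d') :
    HasDivergence μ q (b + b') (d + d') := by
  obtain ⟨K, hK⟩ := hb.lipschitz
  obtain ⟨K', hK'⟩ := hb'.lipschitz
  have hbc := hb.continuous_field hq
  have hbc' := hb'.continuous_field hq
  obtain ⟨B, hB⟩ := exists_bound_of_continuous hbc
  obtain ⟨B', hB'⟩ := exists_bound_of_continuous hbc'
  obtain ⟨D, hD⟩ := exists_bound_of_continuous hb.continuous
  have hqc : Continuous q := hq.continuous
  refine ⟨⟨K + K', hK.add hK'⟩, hb.continuous.add hb'.continuous, fun L A => ?_⟩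
  obtain ⟨C₁, hC₁⟩ := hb.expand (L * (1 + K')) A
  obtain ⟨C₂, hC₂⟩ := hb'.expand L A
  -- The four terms come from splitting the step in two, from the two expansions, and from replacing
  -- `G'` by `G` in the integral against `d`.
  refine ⟨L * (K' * B) + C₁ + C₂ + L * B' * D, fun G hG hA h hh => ?_⟩
  have hGc : Continuous G := continuous_of_lipschitz_lift hq hG
  let G' : M → ℝ := fun x => G (x + q (h • b' x))
  have hG'c : Continuous G' := by dsimp only [G']; fun_prop
  have hG' : LipschitzWith (L * (1 + K')) (G' ∘ q) := by
    have h1 : LipschitzWith (1 + K') fun y => y + h • (b' ∘ q) y := by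
      refine LipschitzWith.id.add (LipschitzWith.of_dist_le_mul fun x y => ?_)
      rw [dist_smul₀, Real.norm_of_nonneg hh.1]
      exact (mul_le_of_le_one_left dist_nonneg hh.2).trans (hK'.dist_le_mul x y)
    have : G' ∘ q = (G ∘ q) ∘ fun y => y + h • (b' ∘ q) y := by
      funext y; simp [G']
    rw [this]
    exact hG.comp h1
  have e1 := hC₁ G' hG' (fun x => hA _) h hh
  have e2 := hC₂ G hG hA h hh
  have e3 : |∫ x, G (x + q (h • (b + b') x)) ∂μ - ∫ x, G' (x + q (h • b x)) ∂μ| ≤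
      L * (K' * B) * h ^ 2 := by
    refine abs_integral_sub_le (by simp only [Pi.add_apply]; fun_prop)
      (by fun_prop) fun x => ?_
    have h1 := norm_apply_add_sub_le hq hG x (h • (b + b') x)
      (h • b x + h • b' (x + q (h • b x)))
    have h2 := norm_apply_add_sub_le hq hK' x 0 (h • b x)
    have h3 : ‖h • (b + b') x - (h • b x + h • b' (x + q (h • b x)))‖ ≤ K' * B * h ^ 2 := by
      have : h • (b + b') x - (h • b x + h • b' (x + q (h • b x))) =
        h • (b' (x + q 0) - b' (x + q (h • b x))) := by simp [smul_sub]
      rw [this, norm_smul, Real.norm_of_nonneg hh.1]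
      calc h * ‖b' (x + q 0) - b' (x + q (h • b x))‖ ≤ h * (K' * ‖0 - h • b x‖) := by
            gcongr; exact hh.1
        _ = h * (K' * (h * ‖b x‖)) := by
            rw [zero_sub, norm_neg, norm_smul, Real.norm_of_nonneg hh.1]
        _ ≤ h * (K' * (h * B)) := by
            have := hB x
            have := hh.1
            gcongr
        _ = _ := by ring
    have h4 : G (x + q (h • b x + h • b' (x + q (h • b x)))) = G' (x + q (h • b x)) := by
      simp [G', add_assoc]
    rw [h4] at h1
    exact h1.trans ((mul_le_mul_of_nonneg_left h3 L.coe_nonneg).trans_eq (by ring))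
  have e4 : |∫ x, G' x * d x ∂μ - ∫ x, G x * d x ∂μ| ≤ L * B' * D * h := by
    refine abs_integral_sub_le (hG'c.mul hb.continuous) (hGc.mul hb.continuous) fun x => ?_
    change |G' x * d x - G x * d x| ≤ _
    rw [← sub_mul, abs_mul]
    have h1 := norm_apply_add_sub_le hq hG x (h • b' x) 0
    rw [map_zero, add_zero, sub_zero, norm_smul, Real.norm_of_nonneg hh.1] at h1
    have h5 : |G' x - G x| ≤ L * (h * B') := h1.trans (by
      have := hB' x
      have := hh.1
      gcongr)
    calc |G' x - G x| * |d x| ≤ L * (h * B') * D :=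
          mul_le_mul h5 (hD x) (abs_nonneg _) (by have := hh.1; positivity)
      _ = _ := by ring
  have e5 : ∫ x, G x * (d + d') x ∂μ = ∫ x, G x * d x ∂μ + ∫ x, G x * d' x ∂μ := by
    simp only [Pi.add_apply, mul_add]
    exact integral_add (integrable_of_continuous_compact (hGc.mul hb.continuous))
      (integrable_of_continuous_compact (hGc.mul hb'.continuous))
  have e6 : |h * (∫ x, G' x * d x ∂μ - ∫ x, G x * d x ∂μ)| ≤ L * B' * D * h ^ 2 := by
    rw [abs_mul, abs_of_nonneg hh.1]
    calc h * _ ≤ h * (L * B' * D * h) := mul_le_mul_of_nonneg_left e4 hh.1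
      _ = _ := by ring
  rw [e5]
  have e7 : ∫ x, G' x ∂μ = ∫ x, G (x + q (h • b' x)) ∂μ := rfl
  rw [e7] at e1
  rw [abs_le] at *
  constructor <;> nlinarith [e1.1, e1.2, e2.1, e2.2, e3.1, e3.2, e6.1, e6.2]

theorem HasDivergence.sum [IsProbabilityMeasure μ] (hq : IsOpenQuotientMap q) {ι : Type*}
    (s : Finset ι) {b : ι → M → E} {d : ι → M → ℝ} (h : ∀ i ∈ s, HasDivergence μ q (b i) (d i)) :
    HasDivergence μ q (∑ i ∈ s, b i) (∑ i ∈ s, d i) := by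
  classical
  induction s using Finset.induction_on with
  | empty => simpa using HasDivergence.zero
  | insert i s hi ih =>
    rw [Finset.sum_insert hi, Finset.sum_insert hi]
    exact (h i (Finset.mem_insert_self _ _)).add hq
      (ih fun j hj => h j (Finset.mem_insert_of_mem hj))

theorem integral_eq_integral_average [IsProbabilityMeasure μ] [μ.IsAddRightInvariant]
    (hq : IsOpenQuotientMap q) {F : M → ℝ} (hF : Continuous F) (e : E) :
    ∫ x, F x ∂μ = ∫ x, (∫ s in (0 : ℝ)..1, F (x + q (s • e))) ∂μ := by
  have hqc : Continuous q := hq.continuous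
  obtain ⟨B, hB⟩ := exists_bound_of_continuous hF
  rw [← intervalIntegral_integral_swap]
  · simp_rw [integral_add_right_eq_self F]
    simp
  · have hc : Continuous (Function.uncurry fun (s : ℝ) (x : M) => F (x + q (s • e))) := by
      unfold Function.uncurry; fun_prop
    have _ : IsFiniteMeasure ((volume : Measure ℝ).restrict (Set.uIoc 0 1)) := by
      rw [Set.uIoc_of_le zero_le_one]; infer_instance
    refine Integrable.of_bound hc.aestronglyMeasurable B (Eventually.of_forall fun p => hB _)

/-- Since `q e = 0`, the translates of a point along `e` form a closed loop. On it `s ↦ s + h β` is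
a map of degree one with derivative `1 + h d`, and substitution gives `∫ G (x + h β e) (1 + h d) = ∫
G` exactly, with no injectivity needed. Moving the argument of `G` in the term of order `h` costs
`O(h²)`. -/
theorem hasDivergence_smul_const [IsProbabilityMeasure μ] [μ.IsAddRightInvariant]
    (hq : IsOpenQuotientMap q) {β d : M → ℝ} {e : E} {K : NNReal} (hβ : LipschitzWith K (β ∘ q))
    (hd : Continuous d) (he : q e = 0)
    (hβd : ∀ x s, HasDerivAt (fun s : ℝ => β (x + q (s • e))) (d (x + q (s • e))) s) :
    HasDivergence μ q (fun x => β x • e) d := by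
  have hqc : Continuous q := hq.continuous
  have hβc : Continuous β := continuous_of_lipschitz_lift hq hβ
  obtain ⟨B, hB⟩ := exists_bound_of_continuous hβc
  obtain ⟨D, hD⟩ := exists_bound_of_continuous hd
  refine ⟨⟨K * ‖e‖₊, LipschitzWith.of_dist_le_mul fun x y => ?_⟩, hd, fun L A =>
    ⟨L * B * ‖e‖ * D, fun G hG hA h hh => ?_⟩⟩
  · have h1 := hβ.dist_le_mul x y
    simp only [Function.comp_apply, dist_eq_norm, ← sub_smul, norm_smul] at h1 ⊢
    push_cast
    calc _ ≤ K * ‖x - y‖ * ‖e‖ := by gcongr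
      _ = _ := by ring
  have hGc : Continuous G := continuous_of_lipschitz_lift hq hG
  have key : ∫ x, G (x + q (h • β x • e)) * (1 + h * d x) ∂μ = ∫ x, G x ∂μ := by
    rw [integral_eq_integral_average hq (F := fun x => G (x + q (h • β x • e)) * (1 + h * d x))
      (by fun_prop) e, integral_eq_integral_average hq hGc e]
    refine integral_congr_ae (Eventually.of_forall fun x => ?_)
    dsimp only
    have hφ : ∀ s ∈ Set.uIcc (0 : ℝ) 1, HasDerivAt (fun s => s + h * β (x + q (s • e)))
        (1 + h * d (x + q (s • e))) s := fun s _ =>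
      (hasDerivAt_id s).add ((hβd x s).const_mul h)
    have hsub := intervalIntegral.integral_comp_mul_deriv
      (g := fun u : ℝ => G (x + q (u • e))) hφ
      (Continuous.continuousOn (by fun_prop)) (by fun_prop)
    have hper : Function.Periodic (fun u : ℝ => G (x + q (u • e))) 1 := fun u => by
      simp [add_smul, he]
    -- The loop closes, so both endpoints of the substituted interval are shifted by the same amount
    -- and it remains a full period.
    have h0 : x + q ((1 : ℝ) • e) = x + q ((0 : ℝ) • e) := by simp [he]
    calc ∫ s in (0 : ℝ)..1, G (x + q (s • e) + q (h • β (x + q (s • e)) • e)) *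
          (1 + h * d (x + q (s • e)))
        = ∫ s in (0 : ℝ)..1, ((fun u : ℝ => G (x + q (u • e))) ∘
            fun s => s + h * β (x + q (s • e))) s * (1 + h * d (x + q (s • e))) := by
          refine intervalIntegral.integral_congr fun s _ => ?_
          simp [add_smul, mul_smul, add_assoc]
      _ = ∫ u in (0 : ℝ)..1, G (x + q (u • e)) := by
          rw [hsub, h0, zero_add, add_comm (1 : ℝ), hper.intervalIntegral_add_eq _ 0, zero_add]
  have hc1 : Continuous fun x => G (x + q (h • β x • e)) := by fun_prop
  have hi1 : Integrable (fun x => G (x + q (h • β x • e))) μ :=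
    integrable_of_continuous_compact hc1
  have hi2 : Integrable (fun x => h * (G (x + q (h • β x • e)) * d x)) μ :=
    (integrable_of_continuous_compact (hc1.mul hd)).const_mul h
  have e1 : ∫ x, G (x + q (h • β x • e)) ∂μ + h * ∫ x, G (x + q (h • β x • e)) * d x ∂μ =
      ∫ x, G x ∂μ := by
    rw [← key, ← integral_const_mul, ← integral_add hi1 hi2]
    exact integral_congr_ae (Eventually.of_forall fun x => by dsimp only; ring)
  have e2 : |∫ x, G x * d x ∂μ - ∫ x, G (x + q (h • β x • e)) * d x ∂μ| ≤
      L * B * ‖e‖ * D * h := by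
    refine abs_integral_sub_le (hGc.mul hd) (hc1.mul hd) fun x => ?_
    change |G x * d x - G (x + q (h • β x • e)) * d x| ≤ _
    rw [← sub_mul, abs_mul]
    have h1 := norm_apply_add_sub_le hq hG x 0 (h • β x • e)
    rw [map_zero, add_zero, zero_sub, norm_neg, norm_smul, norm_smul,
      Real.norm_of_nonneg hh.1] at h1
    have h2 : ‖G x - G (x + q (h • β x • e))‖ ≤ L * (h * (B * ‖e‖)) := h1.trans (by
      have := hB x
      have := hh.1
      gcongr)
    calc _ ≤ L * (h * (B * ‖e‖)) * D :=
          mul_le_mul h2 (hD x) (abs_nonneg _) (by have := hh.1; positivity)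
      _ = _ := by ring
  have e3 : ∫ x, G (x + q (h • β x • e)) ∂μ - ∫ x, G x ∂μ + h * ∫ x, G x * d x ∂μ =
      h * (∫ x, G x * d x ∂μ - ∫ x, G (x + q (h • β x • e)) * d x ∂μ) := by
    rw [← e1]; ring
  rw [e3, abs_mul, abs_of_nonneg hh.1]
  calc h * _ ≤ h * (L * B * ‖e‖ * D * h) := mul_le_mul_of_nonneg_left e2 hh.1
    _ = _ := by ring

end Divergence

/-! ### Flows on a quotient and their invariant measure. -/

section QuotientFlow

variable {E M : Type*} [NormedAddCommGroup E] [NormedSpace ℝ E] [CompleteSpace E]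
  [NormedAddCommGroup M] [CompactSpace M] [MeasurableSpace M] [BorelSpace M]

/-- The flow on the quotient `M` of `E` of the field `b`. -/
def quotientFlow (q : E →+ M) (b : M → E) (t : ℝ) (x : M) : M :=
  q (flowOf (b ∘ q) (Function.invFun q x) t)

variable {μ : Measure M} {q : E →+ M} {b : M → E} {K B : NNReal}

/-- Two lifts of a point differ by an element of the kernel of `q`, and translating an integral
curve by it gives another integral curve. So the choice made by `Function.invFun` is immaterial. -/
theorem quotientFlow_apply (hq : IsOpenQuotientMap q) (hK : LipschitzWith K (b ∘ q))
    (hB : ∀ x, ‖b x‖ ≤ B) {t : ℝ} (ht : 0 ≤ t) (y : E) :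
    quotientFlow q b t (q y) = q (flowOf (b ∘ q) y t) := by
  have hB' : ∀ y, ‖(b ∘ q) y‖ ≤ B := fun y => hB _
  set z := Function.invFun q (q y) with hz
  have hzq : q z = q y := Function.rightInverse_invFun hq.surjective (q y)
  have hk : q (z - y) = 0 := by rw [map_sub, hzq, sub_self]
  have hd : ∀ r, HasDerivAt (fun r => flowOf (b ∘ q) y r + (z - y))
      ((b ∘ q) (flowOf (b ∘ q) y r + (z - y))) r := fun r => by
    have := (hasDerivAt_flowOf hK hB' y r).add_const (z - y)
    simpa [hk] using this
  have h := eqOn_flowOf hK hB' (T := t) (fun r _ => (hd r).continuousAt.continuousWithinAt)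
    (fun r _ => (hd r).hasDerivWithinAt) (Set.right_mem_Icc.2 ht)
  simp only [flowOf_zero hK hB', add_sub_cancel] at h
  rw [quotientFlow, ← hz, ← h, map_add, hk, add_zero]

theorem quotientFlow_zero (hq : IsOpenQuotientMap q) (hK : LipschitzWith K (b ∘ q))
    (hB : ∀ x, ‖b x‖ ≤ B) (x : M) : quotientFlow q b 0 x = x := by
  obtain ⟨y, rfl⟩ := hq.surjective x
  rw [quotientFlow_apply hq hK hB le_rfl, flowOf_zero hK fun y => hB _]

theorem quotientFlow_add (hq : IsOpenQuotientMap q) (hK : LipschitzWith K (b ∘ q))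
    (hB : ∀ x, ‖b x‖ ≤ B) {s t : ℝ} (hs : 0 ≤ s) (ht : 0 ≤ t) (x : M) :
    quotientFlow q b (s + t) x = quotientFlow q b t (quotientFlow q b s x) := by
  obtain ⟨y, rfl⟩ := hq.surjective x
  rw [quotientFlow_apply hq hK hB (add_nonneg hs ht), quotientFlow_apply hq hK hB hs,
    quotientFlow_apply hq hK hB ht, flowOf_add hK (fun y => hB _) y s ht]

theorem continuous_quotientFlow (hq : IsOpenQuotientMap q) (hK : LipschitzWith K (b ∘ q))
    (hB : ∀ x, ‖b x‖ ≤ B) {t : ℝ} (ht : 0 ≤ t) : Continuous (quotientFlow q b t) := by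
  rw [hq.isQuotientMap.continuous_iff]
  have : quotientFlow q b t ∘ q = q ∘ fun y => flowOf (b ∘ q) y t :=
    funext fun y => quotientFlow_apply hq hK hB ht y
  rw [this]
  refine hq.continuous.comp (LipschitzWith.continuous (K := (Real.exp (K * t)).toNNReal) ?_)
  refine LipschitzWith.of_dist_le_mul fun x y => ?_
  rw [Real.coe_toNNReal _ (Real.exp_pos _).le, mul_comm]
  exact dist_flowOf_le hK (fun y => hB _) x y ht

theorem hasDerivWithinAt_zero_of_sq_bound {φ : ℝ → ℝ} {s : Set ℝ} {t C : ℝ}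
    (h : ∀ r ∈ s, |r - t| ≤ 1 → |φ r - φ t| ≤ C * |r - t| ^ 2) :
    HasDerivWithinAt φ 0 s t := by
  rw [hasDerivWithinAt_iff_isLittleO]
  have h1 : (fun r => φ r - φ t - (r - t) • (0 : ℝ)) =O[𝓝[s] t] fun r => |r - t| ^ 2 := by
    refine Asymptotics.IsBigO.of_bound C ?_
    have : ∀ᶠ r in 𝓝[s] t, |r - t| < 1 := nhdsWithin_le_nhds
      ((by fun_prop : Continuous fun r => |r - t|).continuousAt.eventually_lt_const (by simp))
    filter_upwards [self_mem_nhdsWithin, this] with r hr hr1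
    simpa using h r hr hr1.le
  refine h1.trans_isLittleO ?_
  have h2 : (fun r => |r - t| ^ 2) =o[𝓝 t] fun r => r - t := by
    have := Asymptotics.isLittleO_pow_sub_sub t (m := 2) (by norm_num)
    simpa using this
  exact h2.mono nhdsWithin_le_nhds

/-- The function `t ↦ ∫ F (flow_t)` changes by `O(h²)` over time `h`, so its derivative is zero. For
the increment, `flow_h` is replaced by an Euler step and the expansion with zero divergence is
applied to `F ∘ flow_t`, whose Lipschitz constant stays bounded on `[0, T]`. -/
theorem integral_comp_quotientFlow [IsProbabilityMeasure μ] (hq : IsOpenQuotientMap q)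
    (hb : HasDivergence μ q b 0) {F : M → ℝ} {L : NNReal} (hF : LipschitzWith L (F ∘ q)) {T : ℝ}
    (hT : 0 ≤ T) : ∫ x, F (quotientFlow q b T x) ∂μ = ∫ x, F x ∂μ := by
  obtain ⟨K, hK⟩ := hb.lipschitz
  have hFc : Continuous F := continuous_of_lipschitz_lift hq hF
  obtain ⟨A, hA⟩ := exists_bound_of_continuous hFc
  obtain ⟨B, hB⟩ := exists_bound_of_continuous (hb.continuous_field hq)
  set L' : NNReal := L * (Real.exp (K * T)).toNNReal
  obtain ⟨C, hC⟩ := hb.expand L' A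
  let φ : ℝ → ℝ := fun t => ∫ x, F (quotientFlow q b t x) ∂μ
  have hstep : ∀ t ∈ Set.Icc 0 T, ∀ h ∈ Set.Icc (0 : ℝ) 1,
      |φ (t + h) - φ t| ≤ (L' * (K * B) + C) * h ^ 2 := by
    intro t ht h hh
    let G : M → ℝ := fun x => F (quotientFlow q b t x)
    have hG : LipschitzWith L' (G ∘ q) := by
      have h1 : LipschitzWith (Real.exp (K * T)).toNNReal fun y => flowOf (b ∘ q) y t := by
        refine LipschitzWith.of_dist_le_mul fun x y => ?_
        rw [Real.coe_toNNReal _ (Real.exp_pos _).le, mul_comm]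
        refine (dist_flowOf_le hK (fun y => hB _) x y ht.1).trans ?_
        have := ht.2
        gcongr
      have : G ∘ q = (F ∘ q) ∘ fun y => flowOf (b ∘ q) y t :=
        funext fun y => by simp [G, quotientFlow_apply hq hK hB ht.1]
      rw [this]
      exact hF.comp h1
    have hGc : Continuous G := continuous_of_lipschitz_lift hq hG
    have e1 := hC G hG (fun x => hA _) h hh
    have e2 : |φ (t + h) - ∫ x, G (x + q (h • b x)) ∂μ| ≤ L' * (K * B) * h ^ 2 := by
      have e : φ (t + h) = ∫ x, G (quotientFlow q b h x) ∂μ :=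
        integral_congr_ae (Eventually.of_forall fun x => by
          simp only [G]
          rw [add_comm, quotientFlow_add hq hK hB hh.1 ht.1])
      have hbc := hb.continuous_field hq
      have hqc : Continuous q := hq.continuous
      rw [e]
      refine abs_integral_sub_le (hGc.comp (continuous_quotientFlow hq hK hB hh.1))
        (by fun_prop) fun x => ?_
      obtain ⟨y, rfl⟩ := hq.surjective x
      rw [Function.comp_apply, quotientFlow_apply hq hK hB hh.1, ← map_add]
      have h1 := hG.norm_sub_le (flowOf (b ∘ q) y h) (y + h • b (q y))
      have h2 := norm_flowOf_sub_sub_le hK (fun y => hB (q y)) y hh.1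
      exact h1.trans ((mul_le_mul_of_nonneg_left h2 L'.coe_nonneg).trans_eq (by ring))
    simp only [Pi.zero_apply, mul_zero, integral_zero, add_zero] at e1
    have e3 : φ t = ∫ x, G x ∂μ := rfl
    rw [← e3] at e1
    rw [abs_le] at *
    constructor <;> nlinarith [e1.1, e1.2, e2.1, e2.2]
  have hder : ∀ t ∈ Set.Icc 0 T, HasDerivWithinAt φ 0 (Set.Icc 0 T) t := by
    intro t ht
    refine hasDerivWithinAt_zero_of_sq_bound (C := L' * (K * B) + C) fun r hr hrt => ?_
    rcases le_total t r with h | h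
    · have := hstep t ht (r - t) ⟨by linarith, (le_abs_self _).trans hrt⟩
      rwa [add_sub_cancel, ← sq_abs] at this
    · rw [abs_sub_comm] at hrt
      have := hstep r hr (t - r) ⟨by linarith, (le_abs_self _).trans hrt⟩
      rwa [add_sub_cancel, abs_sub_comm, ← sq_abs, abs_sub_comm t r] at this
  have := (convex_Icc (0 : ℝ) T).norm_image_sub_le_of_norm_hasDerivWithin_le (C := 0) hder
    (fun _ _ => by simp) (Set.left_mem_Icc.2 hT) (Set.right_mem_Icc.2 hT)
  rw [zero_mul, norm_le_zero_iff, sub_eq_zero] at this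
  refine this.trans (integral_congr_ae (Eventually.of_forall fun x => ?_))
  simp only [quotientFlow_zero hq hK hB]

theorem measurePreserving_quotientFlow [IsProbabilityMeasure μ] (hq : IsOpenQuotientMap q)
    (hq1 : LipschitzWith 1 q) (hb : HasDivergence μ q b 0) {T : ℝ} (hT : 0 ≤ T) :
    MeasurePreserving (quotientFlow q b T) μ μ := by
  obtain ⟨K, hK⟩ := hb.lipschitz
  obtain ⟨B, hB⟩ := exists_bound_of_continuous (hb.continuous_field hq)
  have hcont := continuous_quotientFlow hq hK hB hT
  have hmeas : Measurable (quotientFlow q b T) := hcont.measurable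
  refine ⟨hmeas, ?_⟩
  have _ : IsProbabilityMeasure (μ.map (quotientFlow q b T)) :=
    Measure.isProbabilityMeasure_map hmeas.aemeasurable
  let P : ProbabilityMeasure M := ⟨μ, inferInstance⟩
  let P' : ProbabilityMeasure M := ⟨μ.map (quotientFlow q b T), inferInstance⟩
  -- Bounded Lipschitz functions determine a probability measure; this is read off from the
  -- convergence criterion applied to a constant sequence.
  have h : Tendsto (fun _ : ℕ => P') atTop (𝓝 P) := by
    rw [tendsto_iff_forall_lipschitz_integral_tendsto]
    rintro f - ⟨L, hL⟩
    have hfL : LipschitzWith L (f ∘ q) := by simpa using hL.comp hq1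
    have : ∫ x, f x ∂(P' : Measure M) = ∫ x, f x ∂(P : Measure M) := by
      change ∫ x, f x ∂(μ.map _) = ∫ x, f x ∂μ
      rw [integral_map hmeas.aemeasurable hL.continuous.aestronglyMeasurable,
        integral_comp_quotientFlow hq hb hfL hT]
    simp_rw [this]
    exact tendsto_const_nhds
  have : P' = P := tendsto_nhds_unique tendsto_const_nhds h
  exact congrArg Subtype.val this

end QuotientFlow

/-! ### The vortex system with a regular interaction -/

/-- Configurations of `N` points on the torus. -/
abbrev Config (N : ℕ) : Type := Fin N → Torus

/-- Configurations of `N` points in the plane. -/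
abbrev LiftConfig (N : ℕ) : Type := Fin N → Plane

instance (N : ℕ) : BorelSpace (Config N) := Pi.borelSpace (ι := Fin N) (X := fun _ => Torus)

instance (N : ℕ) : (volume : Measure (Config N)).IsAddRightInvariant where
  map_add_right_eq_self g := by
    have _ : (volume : Measure (Config N)).IsAddLeftInvariant :=
      Measure.pi.isAddLeftInvariant (μ := fun _ : Fin N => (volume : Measure Torus))
    simp only [add_comm _ g]
    exact map_add_left_eq_self _ g

/-- The quotient map from planar to toral configurations. -/
def toConfig (N : ℕ) : LiftConfig N →+ Config N where
  toFun y i := toTorus (y i)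
  map_zero' := funext fun _ => toTorus_zero
  map_add' _ _ := funext fun _ => toTorus_add _ _

theorem toConfig_apply {N : ℕ} (y : LiftConfig N) (i : Fin N) : toConfig N y i = toTorus (y i) :=
  rfl

theorem isOpenQuotientMap_toConfig (N : ℕ) : IsOpenQuotientMap (toConfig N) :=
  IsOpenQuotientMap.piMap fun _ => isOpenQuotientMap_toTorus

theorem lipschitzWith_toTorus : LipschitzWith 1 toTorus :=
  LipschitzWith.of_dist_le_mul fun x y => by
    rw [dist_eq_norm, dist_eq_norm, ← toTorus_sub, NNReal.coe_one, one_mul]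
    exact norm_toTorus_le _

theorem lipschitzWith_toConfig (N : ℕ) : LipschitzWith 1 (toConfig N) :=
  LipschitzWith.of_dist_le_mul fun x y => by
    rw [NNReal.coe_one, one_mul]
    exact (dist_pi_le_iff dist_nonneg).2 fun i =>
      (lipschitzWith_toTorus.dist_le_mul (x i) (y i)).trans
        (by simpa using dist_le_pi_dist x y i)

/-- `k` is an odd divergence free `C¹` field on the torus, with derivative `k'`. -/
structure IsRegularKernel (k : Torus → Plane) (k' : Torus → Plane →L[ℝ] Plane) : Prop where
  odd : ∀ x, k (-x) = -k x
  hasFDerivAt : ∀ z, HasFDerivAt (fun z => k (toTorus z)) (k' (toTorus z)) z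
  continuous_deriv : Continuous k'
  div_eq_zero : ∀ x, ∑ i, k' x (EuclideanSpace.single i 1) i = 0

/-- The drift of the vortex system with interaction `k` and intensities `ξ`. -/
def drift {N : ℕ} (k : Torus → Plane) (ξ : Fin N → ℝ) (x : Config N) : LiftConfig N :=
  fun i => (√(N : ℝ))⁻¹ • ∑ j, ξ j • k (x i - x j)

/-! ### Bounds and divergence of the vortex drift. -/

namespace IsRegularKernel

variable {k : Torus → Plane} {k' : Torus → Plane →L[ℝ] Plane} {N : ℕ}

theorem zero (h : IsRegularKernel k k') : k 0 = 0 := by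
  have := h.odd 0
  rw [neg_zero] at this
  have h2 : (2 : ℝ) • k 0 = 0 := by
    rw [two_smul, ← eq_neg_iff_add_eq_zero]
    exact this
  simpa using h2

theorem continuous (h : IsRegularKernel k k') : Continuous k :=
  isOpenQuotientMap_toTorus.isQuotientMap.continuous_iff.2
    (continuous_iff_continuousAt.2 fun z => (h.hasFDerivAt z).continuousAt)

theorem exists_bound (h : IsRegularKernel k k') : ∃ B : NNReal, ∀ x, ‖k x‖ ≤ B :=
  exists_bound_of_continuous h.continuous

theorem exists_lipschitz (h : IsRegularKernel k k') :
    ∃ K : NNReal, LipschitzWith K fun z => k (toTorus z) := by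
  obtain ⟨K, hK⟩ := exists_bound_of_continuous h.continuous_deriv
  exact ⟨K, lipschitzWith_of_nnnorm_fderiv_le (fun z => (h.hasFDerivAt z).differentiableAt)
    fun z => by rw [(h.hasFDerivAt z).fderiv]; exact hK _⟩

/-- The bounds are linear in the intensities. As the drift is linear in `ξ`, they also control its
variation with `ξ`, hence the joint continuity of the flow. -/
theorem exists_drift_bounds (h : IsRegularKernel k k') (N : ℕ) : ∃ C : NNReal,
    (∀ (ξ : Fin N → ℝ) (x : Config N), ‖drift k ξ x‖ ≤ C * ‖ξ‖) ∧
    ∀ (ξ : Fin N → ℝ), LipschitzWith (C * ‖ξ‖₊) (drift k ξ ∘ toConfig N) := by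
  obtain ⟨B, hB⟩ := h.exists_bound
  obtain ⟨K, hK⟩ := h.exists_lipschitz
  have hN : (√(N : ℝ))⁻¹ ≤ 1 := by
    rcases Nat.eq_zero_or_pos N with rfl | hN
    · simp
    · exact inv_le_one_of_one_le₀ (Real.one_le_sqrt.2 (by exact_mod_cast hN))
  have hN0 : 0 ≤ (√(N : ℝ))⁻¹ := by positivity
  have key : ∀ (ξ : Fin N → ℝ) (f : Fin N → Plane) (D : ℝ), 0 ≤ D → (∀ j, ‖f j‖ ≤ D) →
      ‖(√(N : ℝ))⁻¹ • ∑ j, ξ j • f j‖ ≤ N * ‖ξ‖ * D := by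
    intro ξ f D hD hf
    rw [norm_smul, Real.norm_of_nonneg hN0]
    calc (√(N : ℝ))⁻¹ * ‖∑ j, ξ j • f j‖ ≤ 1 * ∑ j : Fin N, ‖ξ‖ * D := by
          refine mul_le_mul hN ((norm_sum_le _ _).trans (Finset.sum_le_sum fun j _ => ?_))
            (norm_nonneg _) zero_le_one
          rw [norm_smul]
          exact mul_le_mul (norm_le_pi_norm ξ j) (hf j) (norm_nonneg _) (norm_nonneg _)
      _ = _ := by simp; ring
  refine ⟨N * (B + 2 * K), fun ξ x => ?_, fun ξ => LipschitzWith.of_dist_le_mul fun y y' => ?_⟩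
  · refine (pi_norm_le_iff_of_nonneg (by positivity)).2 fun i =>
      (key ξ (fun j => k (x i - x j)) B B.coe_nonneg fun j => hB _).trans ?_
    push_cast
    have : 0 ≤ N * ‖ξ‖ * (2 * K) := by positivity
    nlinarith
  · refine (dist_pi_le_iff (by positivity)).2 fun i => ?_
    have h1 : ∀ j, ‖k (toTorus (y i - y j)) - k (toTorus (y' i - y' j))‖ ≤ 2 * K * dist y y' :=
      fun j => by
      refine (hK.norm_sub_le _ _).trans ?_
      have e1 : y i - y j - (y' i - y' j) = (y i - y' i) - (y j - y' j) := by abel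
      have e2 := norm_sub_le (y i - y' i) (y j - y' j)
      have e3 : ‖y i - y' i‖ ≤ dist y y' := by
        rw [← dist_eq_norm]; exact dist_le_pi_dist y y' i
      have e4 : ‖y j - y' j‖ ≤ dist y y' := by
        rw [← dist_eq_norm]; exact dist_le_pi_dist y y' j
      rw [e1]
      calc K * ‖y i - y' i - (y j - y' j)‖ ≤ K * (dist y y' + dist y y') := by
            have := K.coe_nonneg
            gcongr
            linarith
        _ = _ := by ring
    have h2 := key ξ (fun j => k (toTorus (y i - y j)) - k (toTorus (y' i - y' j))) _
      (by positivity) h1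
    have h3 : dist ((drift k ξ ∘ toConfig N) y i) ((drift k ξ ∘ toConfig N) y' i) =
        ‖(√(N : ℝ))⁻¹ • ∑ j, ξ j • (k (toTorus (y i - y j)) - k (toTorus (y' i - y' j)))‖ := by
      rw [dist_eq_norm]
      simp only [drift, Function.comp_apply, toConfig_apply, ← toTorus_sub, ← smul_sub,
        ← Finset.sum_sub_distrib]
    rw [h3]
    refine h2.trans ?_
    push_cast
    have : 0 ≤ (N : ℝ) * B * ‖ξ‖ * dist y y' := by positivity
    nlinarith

theorem drift_sub (ξ ξ' : Fin N → ℝ) (x : Config N) :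
    drift k ξ x - drift k ξ' x = drift k (ξ - ξ') x := by
  funext i
  simp only [drift, Pi.sub_apply, ← smul_sub, ← Finset.sum_sub_distrib, sub_smul]

/-- The action of one vortex on one coordinate of another is a field in a fixed direction, and a
unit step in that direction is a lattice vector, so `hasDivergence_smul_const` applies. The diagonal
terms vanish because `k 0 = 0`. -/
theorem hasDivergence_drift_term (h : IsRegularKernel k k') (a : ℝ) (i j : Fin N) (l : Fin 2) :
    HasDivergence (volume : Measure (Config N)) (toConfig N)
      (fun x => (a * k (x i - x j) l) • Pi.single i (EuclideanSpace.single l 1))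
      (fun x => if i = j then 0 else a * k' (x i - x j) (EuclideanSpace.single l 1) l) := by
  by_cases hij : i = j
  · subst hij
    simp only [sub_self, h.zero, PiLp.zero_apply, mul_zero, zero_smul, if_true]
    exact HasDivergence.zero
  simp only [if_neg hij]
  obtain ⟨K, hK⟩ := h.exists_lipschitz
  refine hasDivergence_smul_const (K := ‖a‖₊ * (K * 2)) (isOpenQuotientMap_toConfig N) ?_ ?_ ?_ ?_
  · have h1 : LipschitzWith 2 fun y : LiftConfig N => y i - y j := by
      have := (LipschitzWith.eval (α := fun _ : Fin N => Plane) i).sub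
        (LipschitzWith.eval (α := fun _ : Fin N => Plane) j)
      rwa [one_add_one_eq_two] at this
    have h2 := hK.comp h1
    refine LipschitzWith.of_dist_le_mul fun y y' => ?_
    have h3 := h2.dist_le_mul y y'
    simp only [Function.comp_apply, toConfig_apply, ← toTorus_sub, Real.dist_eq, ← mul_sub,
      abs_mul] at h3 ⊢
    have h4 := abs_apply_le_norm (k (toTorus (y i - y j)) - k (toTorus (y' i - y' j))) l
    rw [PiLp.sub_apply] at h4
    rw [dist_eq_norm] at h3
    push_cast at h3 ⊢
    calc |a| * _ ≤ |a| * (K * 2 * dist y y') := by gcongr; exact h4.trans h3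
      _ = _ := by rw [Real.norm_eq_abs]; ring
  · have := h.continuous_deriv
    fun_prop
  · funext m
    rw [toConfig_apply, Pi.zero_apply]
    by_cases hm : m = i
    · subst hm
      have : (EuclideanSpace.single l (1 : ℝ) : Plane) = latticePoint (Pi.single l 1) := by
        ext p
        by_cases hp : p = l
        · subst hp; simp [latticePoint]
        · simp [latticePoint, hp]
      rw [Pi.single_eq_same, this, toTorus_latticePoint]
    · rw [Pi.single_eq_of_ne hm, toTorus_zero]
  · intro x s
    obtain ⟨y, rfl⟩ := (isOpenQuotientMap_toConfig N).surjective x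
    have e1 : ∀ r : ℝ, (toConfig N y + toConfig N (r • Pi.single i (EuclideanSpace.single l 1))) i -
        (toConfig N y + toConfig N (r • Pi.single i (EuclideanSpace.single l 1))) j =
        toTorus (y i - y j + r • EuclideanSpace.single l 1) := fun r => by
      simp only [Pi.add_apply, toConfig_apply, Pi.smul_apply, Pi.single_eq_same,
        Pi.single_eq_of_ne (Ne.symm hij), smul_zero, toTorus_zero, add_zero, toTorus_add,
        toTorus_sub]
      abel
    simp only [e1]
    have e2 : HasDerivAt (fun r : ℝ => y i - y j + r • (EuclideanSpace.single l 1 : Plane))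
        (EuclideanSpace.single l 1) s := by
      simpa using ((hasDerivAt_id s).smul_const (EuclideanSpace.single l 1 : Plane)).const_add
        (y i - y j)
    have e3 := (h.hasFDerivAt (y i - y j + s • EuclideanSpace.single l 1)).comp_hasDerivAt s e2
    have e4 := (EuclideanSpace.proj (𝕜 := ℝ) l).hasFDerivAt.comp_hasDerivAt s e3
    exact e4.const_mul a

/-- For each pair of distinct vortices the divergences of the two components add up to the
divergence of `k`, which is zero. -/
theorem hasDivergence_drift (h : IsRegularKernel k k') (ξ : Fin N → ℝ) :
    HasDivergence (volume : Measure (Config N)) (toConfig N) (drift k ξ) 0 := by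
  have key := HasDivergence.sum (isOpenQuotientMap_toConfig N)
    (Finset.univ : Finset (Fin N × Fin N × Fin 2))
    fun p _ => h.hasDivergence_drift_term ((√(N : ℝ))⁻¹ * ξ p.2.1) p.1 p.2.1 p.2.2
  have e1 : drift k ξ = ∑ p : Fin N × Fin N × Fin 2, fun x : Config N =>
      ((√(N : ℝ))⁻¹ * ξ p.2.1 * k (x p.1 - x p.2.1) p.2.2) •
        (Pi.single p.1 (EuclideanSpace.single p.2.2 1) : LiftConfig N) := by
    funext x i
    ext l
    simp only [Finset.sum_apply, Fintype.sum_prod_type, drift]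
    simp only [PiLp.smul_apply, WithLp.ofLp_sum, Finset.sum_apply, Pi.smul_apply, smul_eq_mul,
      Finset.mul_sum]
    symm
    rw [Finset.sum_eq_single i]
    · refine Finset.sum_congr rfl fun j _ => ?_
      rw [Finset.sum_eq_single l]
      · simp; ring
      · intro m _ hm
        simp [hm.symm]
      · simp
    · intro m _ hm
      simp [hm.symm]
    · simp
  have e2 : (0 : Config N → ℝ) = ∑ p : Fin N × Fin N × Fin 2, fun x : Config N =>
      if p.1 = p.2.1 then 0 else (√(N : ℝ))⁻¹ * ξ p.2.1 *
        k' (x p.1 - x p.2.1) (EuclideanSpace.single p.2.2 1) p.2.2 := by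
    funext x
    simp only [Finset.sum_apply, Fintype.sum_prod_type]
    refine (Finset.sum_eq_zero fun i _ => Finset.sum_eq_zero fun j _ => ?_).symm
    by_cases hij : i = j
    · simp [hij]
    · simp only [if_neg hij, ← Finset.mul_sum, h.div_eq_zero, mul_zero]
  rw [e1, e2]
  exact key

end IsRegularKernel

/-- Intensities and positions of `N` vortices. -/
abbrev Param (N : ℕ) : Type := (Fin N → ℝ) × Config N

/-- The flow of the vortex system with interaction `k`. -/
def vortexFlow {N : ℕ} (k : Torus → Plane) (t : ℝ) (p : Param N) : Config N :=
  quotientFlow (toConfig N) (drift k p.1) t p.2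

/-- The lift to the plane of the flow of the vortex system with interaction `k`. -/
def liftFlow {N : ℕ} (k : Torus → Plane) (ξ : Fin N → ℝ) (y : LiftConfig N) (t : ℝ) :
    LiftConfig N :=
  flowOf (drift k ξ ∘ toConfig N) y t

/-! ### The flow of a regular interaction and its continuity. -/

namespace IsRegularKernel

variable {k : Torus → Plane} {k' : Torus → Plane →L[ℝ] Plane} {N : ℕ}

theorem exists_drift_bounds_intensity (h : IsRegularKernel k k') (ξ : Fin N → ℝ) : ∃ B L : NNReal,
    (∀ x : Config N, ‖drift k ξ x‖ ≤ B) ∧ LipschitzWith L (drift k ξ ∘ toConfig N) := by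
  obtain ⟨C, h1, h2⟩ := h.exists_drift_bounds N
  exact ⟨C * ‖ξ‖₊, C * ‖ξ‖₊, h1 ξ, h2 ξ⟩

theorem vortexFlow_toConfig (h : IsRegularKernel k k') (ξ : Fin N → ℝ) (y : LiftConfig N) {t : ℝ}
    (ht : 0 ≤ t) : vortexFlow k t (ξ, toConfig N y) = toConfig N (liftFlow k ξ y t) := by
  obtain ⟨B, L, hB, hL⟩ := h.exists_drift_bounds_intensity ξ
  exact quotientFlow_apply (isOpenQuotientMap_toConfig N) hL hB ht y

theorem liftFlow_zero (h : IsRegularKernel k k') (ξ : Fin N → ℝ) (y : LiftConfig N) :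
    liftFlow k ξ y 0 = y := by
  obtain ⟨B, L, hB, hL⟩ := h.exists_drift_bounds_intensity ξ
  exact flowOf_zero hL (fun y => hB _) y

theorem hasDerivAt_liftFlow (h : IsRegularKernel k k') (ξ : Fin N → ℝ) (y : LiftConfig N) (t : ℝ) :
    HasDerivAt (liftFlow k ξ y) (drift k ξ (toConfig N (liftFlow k ξ y t))) t := by
  obtain ⟨B, L, hB, hL⟩ := h.exists_drift_bounds_intensity ξ
  exact hasDerivAt_flowOf hL (fun y => hB _) y t

theorem vortexFlow_zero (h : IsRegularKernel k k') (p : Param N) : vortexFlow k 0 p = p.2 := by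
  obtain ⟨B, L, hB, hL⟩ := h.exists_drift_bounds_intensity p.1
  exact quotientFlow_zero (isOpenQuotientMap_toConfig N) hL hB p.2

theorem eqOn_liftFlow (h : IsRegularKernel k k') (ξ : Fin N → ℝ) {T : ℝ} {α : ℝ → LiftConfig N}
    (hc : ContinuousOn α (Set.Icc 0 T))
    (hα : ∀ t ∈ Set.Ico 0 T, HasDerivWithinAt α (drift k ξ (toConfig N (α t))) (Set.Ici t) t) :
    Set.EqOn α (liftFlow k ξ (α 0)) (Set.Icc 0 T) := by
  obtain ⟨B, L, hB, hL⟩ := h.exists_drift_bounds_intensity ξ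
  exact eqOn_flowOf hL (fun y => hB _) hc hα

theorem continuous_liftFlow (h : IsRegularKernel k k') (T : ℝ) :
    Continuous fun p : ((Fin N → ℝ) × LiftConfig N) × Set.Icc (0 : ℝ) T =>
      liftFlow k p.1.1 p.1.2 p.2 := by
  obtain ⟨C, hC1, hC2⟩ := h.exists_drift_bounds N
  refine continuous_iff_continuousAt.2 fun p₀ => ?_
  obtain ⟨⟨ξ₀, y₀⟩, t₀⟩ := p₀
  have hL : ∀ ξ : Fin N → ℝ, LipschitzWith (C * ‖ξ‖₊ + 1) (drift k ξ ∘ toConfig N) := fun ξ =>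
    (hC2 ξ).weaken le_self_add
  have hB : ∀ (ξ : Fin N → ℝ) y, ‖(drift k ξ ∘ toConfig N) y‖ ≤ (C * ‖ξ‖₊ : NNReal) :=
    fun ξ y => hC1 ξ _
  -- The summand `1` keeps the Gronwall constant nonzero even for `ξ₀ = 0`, so that a single closed
  -- formula applies.
  set L₀ : NNReal := C * ‖ξ₀‖₊ + 1 with hL₀
  have hL₀' : (L₀ : ℝ) ≠ 0 := by rw [hL₀]; push_cast; positivity
  set g : ((Fin N → ℝ) × LiftConfig N) × Set.Icc (0 : ℝ) T → ℝ := fun p =>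
    dist y₀ p.1.2 * Real.exp (L₀ * p.2) +
      (C * ‖p.1.1 - ξ₀‖) / L₀ * (Real.exp (L₀ * p.2) - 1) +
      (C * ‖ξ₀‖) * |(t₀ : ℝ) - p.2| with hg
  have hgc : Continuous g := by rw [hg]; fun_prop
  have hg0 : g ((ξ₀, y₀), t₀) = 0 := by simp [hg]
  have hgt : Tendsto g (𝓝 ((ξ₀, y₀), t₀)) (𝓝 0) := by
    have := hgc.tendsto ((ξ₀, y₀), t₀)
    rwa [hg0] at this
  rw [ContinuousAt, tendsto_iff_dist_tendsto_zero]
  refine squeeze_zero (fun _ => dist_nonneg) (fun p => ?_) hgt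
  obtain ⟨⟨ξ, y⟩, t⟩ := p
  have e1 := dist_flowOf_flowOf_le (hL ξ₀) (hB ξ₀) (hL ξ) (hB ξ) (η := C * ‖ξ - ξ₀‖) (fun z => by
    rw [dist_eq_norm, Function.comp_apply, Function.comp_apply, drift_sub]
    exact hC1 _ _) y₀ y t.2.1
  rw [gronwallBound_of_K_ne_0 hL₀'] at e1
  have e2 := norm_flowOf_sub_le (hL ξ₀) (hB ξ₀) y₀ t t₀
  rw [← dist_eq_norm] at e2
  push_cast at e2
  calc dist (liftFlow k ξ y t) (liftFlow k ξ₀ y₀ t₀)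
      ≤ dist (liftFlow k ξ y t) (liftFlow k ξ₀ y₀ t) +
        dist (liftFlow k ξ₀ y₀ t) (liftFlow k ξ₀ y₀ t₀) := dist_triangle _ _ _
    _ ≤ _ := by
        rw [dist_comm (liftFlow k ξ y t), dist_comm (liftFlow k ξ₀ y₀ t) (liftFlow k ξ₀ y₀ t₀)]
        exact add_le_add e1 e2

theorem continuous_vortexFlow (h : IsRegularKernel k k') (T : ℝ) :
    Continuous fun p : Param N × Set.Icc (0 : ℝ) T => vortexFlow k p.2 p.1 := by
  have hq := ((IsOpenQuotientMap.id (X := Fin N → ℝ)).prodMap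
    (isOpenQuotientMap_toConfig N)).prodMap (IsOpenQuotientMap.id (X := Set.Icc (0 : ℝ) T))
  rw [hq.isQuotientMap.continuous_iff]
  exact ((isOpenQuotientMap_toConfig N).continuous.comp (h.continuous_liftFlow T)).congr fun p =>
    (h.vortexFlow_toConfig p.1.1 p.1.2 p.2.2.1).symm

theorem continuous_vortexFlow_left (h : IsRegularKernel k k') {t : ℝ} (ht : 0 ≤ t) :
    Continuous fun p : Param N => vortexFlow k t p := by
  obtain ⟨τ, hτ⟩ : ∃ τ : Set.Icc (0 : ℝ) t, (τ : ℝ) = t := ⟨⟨t, ht, le_rfl⟩, rfl⟩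
  have h0 : Continuous fun p : Param N => (p, τ) := by fun_prop
  have h1 := (h.continuous_vortexFlow (N := N) t).comp h0
  simp only [Function.comp_def, hτ] at h1
  exact h1

end IsRegularKernel

/-! ### The invariant law -/

/-- The joint law of the intensities and the positions. -/
def paramLaw (N : ℕ) : Measure (Param N) := (Measure.pi fun _ => gaussianReal 0 1).prod volume

instance (N : ℕ) : IsProbabilityMeasure (paramLaw N) :=
  inferInstanceAs (IsProbabilityMeasure ((Measure.pi fun _ : Fin N => gaussianReal 0 1).prod
    (volume : Measure (Config N))))

instance (N : ℕ) : IsProbabilityMeasure (initialLaw N) :=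
  inferInstanceAs (IsProbabilityMeasure
    (Measure.pi fun _ : Fin N => (gaussianReal 0 1).prod (volume : Measure Torus)))

/-- Separates intensities and positions. -/
def splitParam {N : ℕ} (v : Fin N → ℝ × Torus) : Param N := (fun i => (v i).1, fun i => (v i).2)

theorem measurePreserving_splitParam (N : ℕ) :
    MeasurePreserving splitParam (initialLaw N) (paramLaw N) :=
  measurePreserving_arrowProdEquivProdArrow ℝ Torus (Fin N) (fun _ => gaussianReal 0 1)
    fun _ => volume

/-- The intensities do not move, so the map is a skew product over the identity whose fibre maps
preserve Lebesgue measure. -/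
theorem IsRegularKernel.measurePreserving_vortexFlow {k : Torus → Plane}
    {k' : Torus → Plane →L[ℝ] Plane} (h : IsRegularKernel k k') (N : ℕ) {t : ℝ} (ht : 0 ≤ t) :
    MeasurePreserving (fun p : Param N => (p.1, vortexFlow k t p)) (paramLaw N) (paramLaw N) :=
  (MeasurePreserving.id _).skew_product (g := fun ξ x => vortexFlow k t (ξ, x))
    (h.continuous_vortexFlow_left ht).measurable
    (Eventually.of_forall fun ξ => (measurePreserving_quotientFlow (isOpenQuotientMap_toConfig N)
      (lipschitzWith_toConfig N) (h.hasDivergence_drift ξ) ht).map_eq)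

/-! ### The field of a configuration -/

/-- The Fourier mode `N^{-1/2} ∑_i ξ_i e_n(x_i)` of the point vortex field. -/
def modeSum {N : ℕ} (n : Fin 2 → ℤ) (p : Param N) : ℂ :=
  ((√(N : ℝ))⁻¹ : ℝ) * ∑ i, (p.1 i : ℂ) * UnitAddTorus.mFourier n (p.2 i)

theorem fourierCoeff_sum {ι : Type*} (s : Finset ι) (ω : ι → Distribution) (n : Fin 2 → ℤ) :
    fourierCoeff (∑ i ∈ s, ω i) n = ∑ i ∈ s, fourierCoeff (ω i) n :=
  map_sum (AddMonoidHom.mk' (fun ω => fourierCoeff ω n) fun ω ω' => fourierCoeff_add ω ω' n) ω s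

theorem fourierCoeff_dirac (x : Torus) (n : Fin 2 → ℤ) :
    fourierCoeff (dirac x) n = UnitAddTorus.mFourier n x := rfl

theorem fourierCoeff_vortexField {N : ℕ} (v : Fin N → ℝ × Torus) (x : Config N) (n : Fin 2 → ℤ) :
    fourierCoeff (vortexField v x) n = modeSum n (fun i => (v i).1, x) := by
  simp only [vortexField, fourierCoeff_smul, fourierCoeff_sum, fourierCoeff_dirac, modeSum]

theorem norm_modeSum_le {N : ℕ} (n : Fin 2 → ℤ) (p : Param N) : ‖modeSum n p‖ ≤ N * ‖p.1‖ := by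
  have hN : (√(N : ℝ))⁻¹ ≤ 1 := by
    rcases Nat.eq_zero_or_pos N with rfl | hN
    · simp
    · exact inv_le_one_of_one_le₀ (Real.one_le_sqrt.2 (by exact_mod_cast hN))
  rw [modeSum, norm_mul, Complex.norm_real, Real.norm_of_nonneg (by positivity)]
  calc _ ≤ 1 * ∑ i : Fin N, ‖p.1‖ := by
        refine mul_le_mul hN ((norm_sum_le _ _).trans (Finset.sum_le_sum fun i _ => ?_))
          (norm_nonneg _) zero_le_one
        rw [norm_mul, norm_mFourier_apply, mul_one, Complex.norm_real]
        exact norm_le_pi_norm _ _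
    _ = _ := by simp

theorem continuous_modeSum {N : ℕ} (n : Fin 2 → ℤ) : Continuous (modeSum (N := N) n) := by
  unfold modeSum
  fun_prop

/-- The point vortex field as an element of `H^{-1-}`. -/
def fieldOf {N : ℕ} (p : Param N) : HMinus :=
  ⟨vortexField (fun i => (p.1 i, p.2 i)) p.2,
    mem_hMinusOneMinus_of_le_logBound (A := N * ‖p.1‖) (by positivity) fun n => by
      rw [fourierCoeff_vortexField]
      exact (norm_modeSum_le n p).trans (le_logBound _ n)⟩

theorem fourierCoeff_fieldOf {N : ℕ} (p : Param N) (n : Fin 2 → ℤ) :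
    fourierCoeff (fieldOf p).toDistribution n = modeSum n p :=
  fourierCoeff_vortexField _ _ n

theorem continuous_fieldOf {N : ℕ} : Continuous (fieldOf (N := N)) := by
  refine continuous_iff_continuousAt.2 fun p₀ => ?_
  refine HMinus.tendsto_of_fourierCoeff (A := N * (‖p₀.1‖ + 1)) (by positivity) ?_ ?_ ?_
  · have : ∀ᶠ p : Param N in 𝓝 p₀, ‖p.1‖ < ‖p₀.1‖ + 1 :=
      (by fun_prop : Continuous fun p : Param N => ‖p.1‖).continuousAt.eventually_lt_const
        (by linarith)
    filter_upwards [this] with p hp n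
    rw [fourierCoeff_fieldOf]
    refine (norm_modeSum_le n p).trans (le_trans ?_ (le_logBound _ n))
    gcongr
  · intro n
    rw [fourierCoeff_fieldOf]
    refine (norm_modeSum_le n p₀).trans (le_trans ?_ (le_logBound _ n))
    gcongr
    linarith
  · intro n
    simp only [fourierCoeff_fieldOf]
    exact (continuous_modeSum n).continuousAt

/-- The path of the point vortex field of the system with a regular interaction. -/
def IsRegularKernel.path {k : Torus → Plane} {k' : Torus → Plane →L[ℝ] Plane}
    (h : IsRegularKernel k k') (T : ℝ) (N : ℕ) : C(Param N, PathSpace T) :=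
  ContinuousMap.curry
    ⟨fun p : Param N × Set.Icc (0 : ℝ) T => fieldOf (p.1.1, vortexFlow k p.2 p.1),
      continuous_fieldOf.comp ((continuous_fst.comp continuous_fst).prodMk
        (h.continuous_vortexFlow T))⟩

theorem IsRegularKernel.path_apply {k : Torus → Plane} {k' : Torus → Plane →L[ℝ] Plane}
    (h : IsRegularKernel k k') (T : ℝ) {N : ℕ} (p : Param N) (t : Set.Icc (0 : ℝ) T) :
    h.path T N p t = fieldOf (p.1, vortexFlow k t p) := rfl

/-! ### The regularised kernel on the torus -/

theorem singWeight_of_ne_zero (a : ℝ) {x : Torus} (hx : x ≠ 0) :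
    singWeight a x = ENNReal.ofReal (‖x‖ ^ (-a)) := by
  rw [singWeight, ← ofReal_norm, ENNReal.ofReal_rpow_of_pos (norm_pos_iff.2 hx)]

/-- The regularised kernel as a function on the torus. -/
def torusKernel (c ε δ : ℝ) (x : Torus) : Plane := regKernel c ε δ (Function.invFun toTorus x)

/-- The derivative of the regularised kernel as a function on the torus. -/
def torusKernelDeriv (c ε δ : ℝ) (x : Torus) : Plane →L[ℝ] Plane :=
  c • ∑' m : Fin 2 → ℤ, cutKernelDeriv ε δ (Function.invFun toTorus x + latticePoint m)

theorem exists_invFun_toTorus_eq (z : Plane) :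
    ∃ l, Function.invFun toTorus (toTorus z) = z + latticePoint l :=
  exists_latticePoint_of_toTorus_eq (Function.rightInverse_invFun toTorus_surjective (toTorus z))

theorem torusKernel_toTorus (c : ℝ) {ε δ : ℝ} (hε₁ : ε < 1) (hδ : 0 < δ) (hδ1 : δ ≤ 1) (z : Plane) :
    torusKernel c ε δ (toTorus z) = regKernel c ε δ z := by
  obtain ⟨A, hA⟩ := isDecayingKernel_cutKernel hε₁ hδ hδ1
  obtain ⟨l, hl⟩ := exists_invFun_toTorus_eq z
  rw [torusKernel, hl, regKernel, hA.periodize_add_latticePoint, regKernel]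

theorem isRegularKernel_torusKernel (c : ℝ) {ε δ : ℝ} (hε₁ : ε < 1) (hδ : 0 < δ) (hδ1 : δ ≤ 1) :
    IsRegularKernel (torusKernel c ε δ) (torusKernelDeriv c ε δ) := by
  obtain ⟨A, hA⟩ := isDecayingKernel_cutKernel hε₁ hδ hδ1
  have hd : ∀ z, torusKernelDeriv c ε δ (toTorus z) =
      c • ∑' m : Fin 2 → ℤ, cutKernelDeriv ε δ (z + latticePoint m) := fun z => by
    obtain ⟨l, hl⟩ := exists_invFun_toTorus_eq z
    rw [torusKernelDeriv, hl, IsDecayingKernel.tsum_deriv_add_latticePoint]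
  refine ⟨fun x => ?_, fun z => ?_, ?_, fun x => ?_⟩
  · obtain ⟨z, rfl⟩ := toTorus_surjective x
    rw [← toTorus_neg, torusKernel_toTorus c hε₁ hδ hδ1, torusKernel_toTorus c hε₁ hδ hδ1,
      regKernel, regKernel, hA.periodize_neg, smul_neg]
  · rw [hd]
    simp only [torusKernel_toTorus c hε₁ hδ hδ1]
    exact (hA.hasFDerivAt_periodize z).const_smul c
  · rw [isOpenQuotientMap_toTorus.isQuotientMap.continuous_iff]
    exact (hA.continuous_tsum_deriv.const_smul c).congr fun z => (hd z).symm
  · have := hA.tsum_deriv_div (Function.invFun toTorus x)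
    simp only [torusKernelDeriv, smul_apply, PiLp.smul_apply, smul_eq_mul]
    rw [← Finset.mul_sum, this, mul_zero]

theorem torusKernel_eq_kernel (c : ℝ) {ε δ : ℝ} (hε₁ : ε < 1) (hδ : 0 < δ) (hδ1 : δ ≤ 1) {z : Plane}
    (hz : δ ≤ ‖toTorus z‖) : torusKernel c ε δ (toTorus z) = kernel c ε z := by
  rw [torusKernel_toTorus c hε₁ hδ hδ1, regKernel_eq_kernel c ε hδ hz]

theorem torusKernel_zero (c : ℝ) {ε δ : ℝ} (hε₁ : ε < 1) (hδ : 0 < δ) (hδ1 : δ ≤ 1) :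
    torusKernel c ε δ 0 = 0 :=
  (isRegularKernel_torusKernel c hε₁ hδ hδ1).zero

theorem ofReal_le_singWeight {a r C : ℝ} (ha : 0 ≤ a) {z : Plane}
    (hz : toTorus z ≠ 0) (hC : 0 ≤ C) (h : r ≤ C * ‖z‖ ^ (-a)) :
    ENNReal.ofReal r ≤ ENNReal.ofReal C * singWeight a (toTorus z) := by
  rw [singWeight_of_ne_zero a hz, ← ENNReal.ofReal_mul hC]
  refine ENNReal.ofReal_le_ofReal (h.trans (mul_le_mul_of_nonneg_left ?_ hC))
  exact Real.rpow_le_rpow_of_nonpos (norm_pos_iff.2 hz) (norm_toTorus_le z) (by linarith)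

theorem exists_enorm_torusKernel_le (c : ℝ) {ε : ℝ} (hε₀ : 0 < ε) (hε₁ : ε < 1) :
    ∃ C : NNReal, ∀ δ : ℝ, 0 < δ → δ ≤ 1 / 2 → ∀ x,
      ‖torusKernel c ε δ x‖ₑ ≤ C * singWeight (2 - ε) x := by
  obtain ⟨C, hC, h⟩ := exists_norm_regKernel_le c hε₀ hε₁
  refine ⟨C.toNNReal, fun δ hδ hδ1 x => ?_⟩
  rcases eq_or_ne x 0 with rfl | hx
  · rw [torusKernel_zero c hε₁ hδ (by linarith), enorm_zero]
    exact bot_le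
  obtain ⟨z, rfl, hz, -, -⟩ := exists_rep x
  rw [← ofReal_norm]
  refine ofReal_le_singWeight (by linarith) hx hC ?_
  rw [torusKernel_toTorus c hε₁ hδ (by linarith)]
  exact h δ hδ hδ1 z hz

/-! ### A smooth substitute for the squared distance -/

/-- A smooth periodic function comparable to the squared distance to the lattice. -/
def gap (z : Plane) : ℝ := (Real.sin (Real.pi * z 0) ^ 2 + Real.sin (Real.pi * z 1) ^ 2) / 4

/-- The derivative of `gap`. -/
def gapDeriv (z v : Plane) : ℝ :=
  Real.pi / 4 * (Real.sin (2 * Real.pi * z 0) * v 0 + Real.sin (2 * Real.pi * z 1) * v 1)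

theorem gap_nonneg (z : Plane) : 0 ≤ gap z := by unfold gap; positivity

theorem gap_add_latticePoint (z : Plane) (l : Fin 2 → ℤ) : gap (z + latticePoint l) = gap z := by
  have h : ∀ (x : ℝ) (n : ℤ), Real.sin (Real.pi * (x + n)) ^ 2 = Real.sin (Real.pi * x) ^ 2 := by
    intro x n
    rw [Real.sin_sq_eq_half_sub, Real.sin_sq_eq_half_sub,
      show 2 * (Real.pi * (x + n)) = 2 * (Real.pi * x) + n * (2 * Real.pi) by ring,
      Real.cos_add_int_mul_two_pi]
  simp only [gap, PiLp.add_apply, latticePoint, h]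

theorem gapDeriv_add_latticePoint (z v : Plane) (l : Fin 2 → ℤ) :
    gapDeriv (z + latticePoint l) v = gapDeriv z v := by
  have h : ∀ (x : ℝ) (n : ℤ), Real.sin (2 * Real.pi * (x + n)) = Real.sin (2 * Real.pi * x) := by
    intro x n
    rw [show 2 * Real.pi * (x + n) = 2 * Real.pi * x + n * (2 * Real.pi) by ring,
      Real.sin_add_int_mul_two_pi]
  simp only [gapDeriv, PiLp.add_apply, latticePoint, h]

theorem norm_sq_eq (z : Plane) : ‖z‖ ^ 2 = z 0 ^ 2 + z 1 ^ 2 := by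
  rw [EuclideanSpace.norm_sq_eq, Fin.sum_univ_two, Real.norm_eq_abs, Real.norm_eq_abs, sq_abs,
    sq_abs]

theorem norm_sq_le_gap {z : Plane} (hz : ∀ i, |z i| ≤ 1 / 2) : ‖z‖ ^ 2 ≤ gap z := by
  have h : ∀ x : ℝ, |x| ≤ 1 / 2 → 4 * x ^ 2 ≤ Real.sin (Real.pi * x) ^ 2 := by
    intro x hx
    have hpi := Real.pi_pos
    -- Jordan's inequality `2t/π ≤ sin t` on `[0, π/2]`.
    have h1 := Real.mul_le_sin (x := Real.pi * |x|) (by positivity) (by nlinarith)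
    rw [show 2 / Real.pi * (Real.pi * |x|) = 2 * |x| by field_simp] at h1
    have h2 := pow_le_pow_left₀ (by positivity) h1 2
    rw [mul_pow, sq_abs] at h2
    rcases abs_cases x with ⟨e, _⟩ | ⟨e, _⟩
    · rw [e] at h2; linarith
    · rw [e, mul_neg, Real.sin_neg, neg_sq] at h2; linarith
  rw [norm_sq_eq, gap]
  linarith [h _ (hz 0), h _ (hz 1)]

theorem gap_le (z : Plane) : gap z ≤ 3 * ‖z‖ ^ 2 := by
  have h : ∀ x : ℝ, Real.sin (Real.pi * x) ^ 2 ≤ 12 * x ^ 2 := by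
    intro x
    have h1 := pow_le_pow_left₀ (abs_nonneg _) (Real.abs_sin_le_abs (x := Real.pi * x)) 2
    rw [sq_abs, sq_abs, mul_pow] at h1
    have : Real.pi ^ 2 ≤ 12 := by nlinarith [Real.pi_lt_d2, Real.pi_pos]
    nlinarith [sq_nonneg x]
  rw [norm_sq_eq, gap]
  linarith [h (z 0), h (z 1)]

theorem abs_gapDeriv_le (z v : Plane) : |gapDeriv z v| ≤ 10 * ‖z‖ * ‖v‖ := by
  have h : ∀ i, |Real.sin (2 * Real.pi * z i) * v i| ≤ 2 * Real.pi * (‖z‖ * ‖v‖) := fun i => by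
    rw [abs_mul]
    calc _ ≤ |2 * Real.pi * z i| * |v i| :=
          mul_le_mul_of_nonneg_right Real.abs_sin_le_abs (abs_nonneg _)
      _ = 2 * Real.pi * (|z i| * |v i|) := by
          rw [abs_mul, abs_of_pos Real.two_pi_pos]; ring
      _ ≤ _ := by
          have := Real.pi_pos
          have := abs_apply_le_norm z i
          have := abs_apply_le_norm v i
          gcongr
  have hpi : Real.pi * Real.pi ≤ 10 := by nlinarith [Real.pi_lt_d2, Real.pi_pos]
  rw [gapDeriv, abs_mul, abs_of_pos (by positivity : 0 < Real.pi / 4)]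
  calc _ ≤ Real.pi / 4 * (2 * Real.pi * (‖z‖ * ‖v‖) + 2 * Real.pi * (‖z‖ * ‖v‖)) := by
        gcongr
        exact (abs_add_le _ _).trans (add_le_add (h 0) (h 1))
    _ = Real.pi * Real.pi * (‖z‖ * ‖v‖) := by ring
    _ ≤ 10 * (‖z‖ * ‖v‖) := by gcongr
    _ = _ := by ring

/-- The gradient of `gap` is `(π²/2) z` up to a cubic error coming from `t - sin t`. Isolating the
inner product of `z` and `v` prepares the cancellation for velocities nearly orthogonal to `z`. -/
theorem abs_gapDeriv_le_inner (z v : Plane) :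
    |gapDeriv z v| ≤ 5 * |z 0 * v 0 + z 1 * v 1| + 70 * ‖z‖ ^ 3 * ‖v‖ := by
  set e : Fin 2 → ℝ := fun i => 2 * Real.pi * z i - Real.sin (2 * Real.pi * z i) with he
  have hpi := Real.pi_pos
  have hpi2 : Real.pi * Real.pi ≤ 10 := by nlinarith [Real.pi_lt_d2]
  have h : ∀ i, |e i * v i| ≤ 42 * (‖z‖ ^ 3 * ‖v‖) := fun i => by
    have h1 := Real.abs_sub_sin_le (2 * Real.pi * z i)
    have h2 : |2 * Real.pi * z i| ^ 3 / 6 ≤ 42 * ‖z‖ ^ 3 := by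
      rw [abs_mul, abs_of_pos Real.two_pi_pos, mul_pow]
      have h3 : |z i| ^ 3 ≤ ‖z‖ ^ 3 := pow_le_pow_left₀ (abs_nonneg _) (abs_apply_le_norm z i) 3
      have h4 : (2 * Real.pi) ^ 3 ≤ 252 := by nlinarith [Real.pi_lt_d2]
      have h5 : (2 * Real.pi) ^ 3 * |z i| ^ 3 ≤ 252 * ‖z‖ ^ 3 := by gcongr
      linarith
    rw [abs_mul]
    calc _ ≤ 42 * ‖z‖ ^ 3 * ‖v‖ :=
          mul_le_mul (h1.trans h2) (abs_apply_le_norm v i) (abs_nonneg _) (by positivity)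
      _ = _ := by ring
  have e1 : gapDeriv z v = Real.pi * Real.pi / 2 * (z 0 * v 0 + z 1 * v 1) -
      Real.pi / 4 * (e 0 * v 0 + e 1 * v 1) := by
    simp only [gapDeriv, he]; ring
  have h2 : |Real.pi * Real.pi / 2 * (z 0 * v 0 + z 1 * v 1)| ≤ 5 * |z 0 * v 0 + z 1 * v 1| := by
    rw [abs_mul, abs_of_pos (by positivity)]
    gcongr
    linarith
  have h3 : |Real.pi / 4 * (e 0 * v 0 + e 1 * v 1)| ≤ 70 * ‖z‖ ^ 3 * ‖v‖ := by
    rw [abs_mul, abs_of_pos (by positivity : 0 < Real.pi / 4)]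
    have h4 := (abs_add_le (e 0 * v 0) (e 1 * v 1)).trans (add_le_add (h 0) (h 1))
    have h5 : 0 ≤ ‖z‖ ^ 3 * ‖v‖ := by positivity
    have h6 : Real.pi / 4 ≤ 70 / 84 := by nlinarith [Real.pi_lt_d2]
    calc _ ≤ 70 / 84 * (42 * (‖z‖ ^ 3 * ‖v‖) + 42 * (‖z‖ ^ 3 * ‖v‖)) := by gcongr
      _ = _ := by ring
  rw [e1]
  exact (abs_sub _ _).trans (add_le_add h2 h3)

/-- The singular potential controlling collisions. -/
def logGap (η : ℝ) (z : Plane) : ℝ := -Real.log (gap z + η)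

theorem hasDerivAt_logGap {η : ℝ} (hη : 0 < η) {z : ℝ → Plane} {v : Plane} {t : ℝ}
    (hz : HasDerivAt z v t) :
    HasDerivAt (fun s => logGap η (z s)) (-(gapDeriv (z t) v / (gap (z t) + η))) t := by
  have h1 : ∀ i, HasDerivAt (fun s => z s i) (v i) t := fun i =>
    (EuclideanSpace.proj (𝕜 := ℝ) i).hasFDerivAt.comp_hasDerivAt t hz
  have h2 : ∀ i, HasDerivAt (fun s => Real.sin (Real.pi * z s i) ^ 2)
      (Real.pi * (Real.sin (2 * Real.pi * z t i) * v i)) t := fun i => by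
    have := (((h1 i).const_mul Real.pi).sin).pow 2
    refine this.congr_deriv ?_
    rw [mul_assoc 2, Real.sin_two_mul]
    simp
    ring
  have h3 : HasDerivAt (fun s => gap (z s) + η) (gapDeriv (z t) v) t := by
    have := (((h2 0).add (h2 1)).div_const 4).add_const η
    refine this.congr_deriv ?_
    rw [gapDeriv]; ring
  exact (h3.log (by have := gap_nonneg (z t); positivity)).neg

theorem exists_rep_add_latticePoint (z : Plane) : ∃ (z' : Plane) (l : Fin 2 → ℤ),
    z = z' + latticePoint l ∧ toTorus z = toTorus z' ∧ (∀ i, |z' i| ≤ 1 / 2) ∧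
    ‖z'‖ ≤ 2 * ‖toTorus z'‖ := by
  obtain ⟨z', h1, h2, -, h3⟩ := exists_rep (toTorus z)
  obtain ⟨l, hl⟩ := exists_latticePoint_of_toTorus_eq h1.symm
  exact ⟨z', l, hl, h1.symm, h2, by rwa [h1]⟩

/-- As `gap` dominates `|z|²`, the potential is at most `2 log (1/|z|)`, which is below `2/|z|`. The
bound is uniform in `η`, and any exponent less than `2` would do. -/
theorem ofReal_logGap_le {η : ℝ} (hη : 0 < η) (z : Plane) :
    ENNReal.ofReal (logGap η z) ≤ ENNReal.ofReal 2 * singWeight 1 (toTorus z) := by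
  rcases eq_or_ne (toTorus z) 0 with h0 | h0
  · simp [h0, singWeight]
  obtain ⟨z', l, rfl, he, hz', hn⟩ := exists_rep_add_latticePoint z
  rw [he] at h0 ⊢
  have hz0 : 0 < ‖z'‖ := (norm_pos_iff.2 h0).trans_le (norm_toTorus_le z')
  refine ofReal_le_singWeight zero_le_one h0 (by norm_num) ?_
  rw [logGap, gap_add_latticePoint, Real.rpow_neg_one]
  have h1 : Real.log (‖z'‖ ^ 2) ≤ Real.log (gap z' + η) :=
    Real.log_le_log (by positivity) (by linarith [norm_sq_le_gap hz'])
  have h2 := Real.log_le_sub_one_of_pos (inv_pos.2 hz0)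
  rw [Real.log_pow, Nat.cast_ofNat] at h1
  rw [Real.log_inv] at h2
  linarith

/-- A representative has norm at most `2δ`, so `gap` is at most `3 (2δ)² = 12 δ²`; the choice `η =
δ²` makes it `13 δ²`. -/
theorem neg_log_le_logGap {δ : ℝ} (hδ : 0 < δ) {z : Plane} (hz : ‖toTorus z‖ < δ) :
    -Real.log (13 * δ ^ 2) ≤ logGap (δ ^ 2) z := by
  obtain ⟨z', l, rfl, he, hz', hn⟩ := exists_rep_add_latticePoint z
  rw [he] at hz
  rw [logGap, gap_add_latticePoint]
  refine neg_le_neg (Real.log_le_log (by have := gap_nonneg z'; positivity) ?_)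
  have h1 : ‖z'‖ ^ 2 ≤ (2 * δ) ^ 2 := pow_le_pow_left₀ (norm_nonneg _) (by linarith) 2
  nlinarith [gap_le z']

/-- The bound without cancellation, from `|∇ gap| ≤ 10 |z|` and `gap ≥ |z|²`. It serves for the
velocities induced by third vortices. -/
theorem ofReal_gapDeriv_le {η : ℝ} (hη : 0 < η) (z v : Plane) :
    ENNReal.ofReal |gapDeriv z v / (gap z + η)| ≤
      ENNReal.ofReal 10 * singWeight 1 (toTorus z) * ‖v‖ₑ := by
  obtain ⟨z', l, rfl, he, hz', hn⟩ := exists_rep_add_latticePoint z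
  rw [he, gapDeriv_add_latticePoint, gap_add_latticePoint]
  have hg := gap_nonneg z'
  rcases eq_or_ne (toTorus z') 0 with h0 | h0
  · have : z' = 0 := by rwa [h0, norm_zero, mul_zero, norm_le_zero_iff] at hn
    subst this
    simp [gapDeriv]
  have hz0 : 0 < ‖z'‖ := (norm_pos_iff.2 h0).trans_le (norm_toTorus_le z')
  have h1 : |gapDeriv z' v / (gap z' + η)| ≤ 10 * ‖v‖ * ‖z'‖ ^ (-(1 : ℝ)) := by
    rw [abs_div, abs_of_pos (by positivity : 0 < gap z' + η), Real.rpow_neg_one,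
      div_le_iff₀ (by positivity)]
    have h2 := abs_gapDeriv_le z' v
    have h3 := norm_sq_le_gap hz'
    calc _ ≤ 10 * ‖z'‖ * ‖v‖ := h2
      _ = 10 * ‖v‖ * ‖z'‖⁻¹ * ‖z'‖ ^ 2 := by field_simp
      _ ≤ _ := by gcongr; linarith
  have h2 := ofReal_le_singWeight zero_le_one h0 (by positivity) h1
  rw [ENNReal.ofReal_mul (by norm_num), ofReal_norm] at h2
  exact h2.trans_eq (by ring)

/-- The key cancellation: `cutKernel` is a multiple of `z^⊥`, so the inner product with `z` only
sees the Lipschitz remainder and is `O(|z|²)`, bounded after division by `gap`. The cubic error in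
the gradient times `|z|^{-(2-ε)}`, divided by `|z|²`, is also within the claimed integrable
singularity. -/
theorem exists_ofReal_gapDeriv_torusKernel_le (c : ℝ) {ε : ℝ} (hε₀ : 0 < ε) (hε₁ : ε < 1) :
    ∃ C : NNReal, ∀ δ : ℝ, 0 < δ → δ ≤ 1 / 2 → ∀ η : ℝ, 0 < η → ∀ z,
      ENNReal.ofReal |gapDeriv z (torusKernel c ε δ (toTorus z)) / (gap z + η)| ≤
        C * singWeight (2 - ε) (toTorus z) := by
  obtain ⟨C₁, hC₁, h₁⟩ := exists_norm_regKernel_sub_le c hε₁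
  obtain ⟨C₂, hC₂, h₂⟩ := exists_norm_regKernel_le c hε₀ hε₁
  refine ⟨(5 * C₁ + 70 * C₂).toNNReal, fun δ hδ hδ1 η hη z => ?_⟩
  obtain ⟨z', l, rfl, he, hz', hn⟩ := exists_rep_add_latticePoint z
  rw [he, gapDeriv_add_latticePoint, gap_add_latticePoint,
    torusKernel_toTorus c hε₁ hδ (by linarith)]
  have hg := gap_nonneg z'
  rcases eq_or_ne (toTorus z') 0 with h0 | h0
  · have : z' = 0 := by rwa [h0, norm_zero, mul_zero, norm_le_zero_iff] at hn
    subst this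
    simp [gapDeriv]
  have hz0 : 0 < ‖z'‖ := (norm_pos_iff.2 h0).trans_le (norm_toTorus_le z')
  have hz1 : ‖z'‖ ≤ 1 := by simpa using norm_le_two_mul hz'
  refine ofReal_le_singWeight (by linarith) h0 (by positivity) ?_
  set u := regKernel c ε δ z' with hu
  have e1 : |z' 0 * u 0 + z' 1 * u 1| ≤ C₁ * ‖z'‖ ^ 2 := by
    have h3 : z' 0 * u 0 + z' 1 * u 1 = inner ℝ z' (u - c • cutKernel ε δ z') := by
      rw [PiLp.inner_apply, Fin.sum_univ_two, cutKernel_eq]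
      simp only [PiLp.sub_apply, PiLp.smul_apply, rotL_zero_coord, rotL_one_coord, smul_eq_mul,
        RCLike.inner_apply, conj_trivial]
      ring
    rw [h3]
    calc _ ≤ ‖z'‖ * ‖u - c • cutKernel ε δ z'‖ := abs_real_inner_le_norm _ _
      _ ≤ ‖z'‖ * (C₁ * ‖z'‖) := by gcongr; exact h₁ δ hδ hδ1 z' hz'
      _ = _ := by ring
  have e2 := abs_gapDeriv_le_inner z' u
  have e3 := h₂ δ hδ hδ1 z' hz'
  have e4 := norm_sq_le_gap hz'
  set w := ‖z'‖ ^ (-(2 - ε)) with hw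
  have hw1 : 1 ≤ w := Real.one_le_rpow_of_pos_of_le_one_of_nonpos hz0 hz1 (by linarith)
  rw [abs_div, abs_of_pos (by positivity : 0 < gap z' + η), div_le_iff₀ (by positivity)]
  calc _ ≤ 5 * (C₁ * ‖z'‖ ^ 2) + 70 * ‖z'‖ ^ 3 * (C₂ * w) := by
        refine e2.trans ?_; gcongr
    _ ≤ 5 * (C₁ * ‖z'‖ ^ 2) * w + 70 * ‖z'‖ ^ 2 * (C₂ * w) := by
        refine add_le_add (le_mul_of_one_le_right (by positivity) hw1) ?_
        have : ‖z'‖ ^ 3 ≤ ‖z'‖ ^ 2 := pow_le_pow_of_le_one hz0.le hz1 (by norm_num)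
        gcongr
    _ = (5 * C₁ + 70 * C₂) * w * ‖z'‖ ^ 2 := by ring
    _ ≤ _ := by gcongr; linarith

/-! ### Integrals along the flow -/

theorem ofReal_abs_sub_le_lintegral {f f' : ℝ → ℝ} (hf : ∀ t, HasDerivAt f (f' t) t)
    (hf' : Continuous f') {s t : ℝ} (hst : s ≤ t) :
    ENNReal.ofReal |f t - f s| ≤ ∫⁻ r in Set.Icc s t, ENNReal.ofReal |f' r| := by
  have h1 := intervalIntegral.integral_eq_sub_of_hasDerivAt (fun r _ => hf r)
    (hf'.intervalIntegrable s t)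
  rw [← h1, intervalIntegral.integral_of_le hst, ← integral_Icc_eq_integral_Ioc, ← Real.enorm_eq_ofReal_abs]
  refine (enorm_integral_le_lintegral_enorm _).trans_eq ?_
  simp only [Real.enorm_eq_ofReal_abs]

theorem IsRegularKernel.continuous_vortexFlow_projIcc {k : Torus → Plane}
    {k' : Torus → Plane →L[ℝ] Plane} (h : IsRegularKernel k k') (N : ℕ) {T : ℝ} (hT : 0 ≤ T) :
    Continuous fun q : Param N × ℝ => vortexFlow k (Set.projIcc 0 T hT q.2) q.1 := by
  have h0 : Continuous fun q : Param N × ℝ => (q.1, Set.projIcc 0 T hT q.2) :=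
    continuous_fst.prodMk (continuous_projIcc.comp continuous_snd)
  have h1 := (h.continuous_vortexFlow (N := N) T).comp h0
  simp only [Function.comp_def] at h1
  exact h1

/-- The time integral of `R` along the flow. -/
def timeIntegral {N : ℕ} (k : Torus → Plane) (T : ℝ) (R : Param N → ENNReal) (p : Param N) :
    ENNReal :=
  ∫⁻ t in Set.Icc 0 T, R (p.1, vortexFlow k t p)

section TimeIntegral

variable {k : Torus → Plane} {k' : Torus → Plane →L[ℝ] Plane} {N : ℕ} {T : ℝ}
  {R : Param N → ENNReal}

/-- Joint continuity of the flow is available for times in `[0, T]` only; clamping the time gives an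
integrand that is jointly measurable on all of `Param N × ℝ`. -/
theorem timeIntegral_eq (k : Torus → Plane) (hT : 0 ≤ T) (R : Param N → ENNReal) (p : Param N) :
    timeIntegral k T R p =
      ∫⁻ t in Set.Icc 0 T, R (p.1, vortexFlow k (Set.projIcc 0 T hT t) p) :=
  setLIntegral_congr_fun measurableSet_Icc fun t ht => by
    rw [Set.projIcc_of_mem hT ht]

theorem IsRegularKernel.measurable_comp_vortexFlow (h : IsRegularKernel k k') (hT : 0 ≤ T)
    (hR : Measurable R) :
    Measurable fun q : Param N × ℝ => R (q.1.1, vortexFlow k (Set.projIcc 0 T hT q.2) q.1) :=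
  hR.comp ((measurable_fst.comp measurable_fst).prodMk
    (h.continuous_vortexFlow_projIcc N hT).measurable)

theorem IsRegularKernel.measurable_timeIntegral (h : IsRegularKernel k k') (hT : 0 ≤ T)
    (hR : Measurable R) : Measurable (timeIntegral k T R) := by
  simp only [funext fun p => timeIntegral_eq k hT R p]
  exact (h.measurable_comp_vortexFlow hT hR).lintegral_prod_right'

/-- Tonelli's theorem and invariance of the law: at each time the configuration is distributed as
initially. -/
theorem IsRegularKernel.lintegral_timeIntegral (h : IsRegularKernel k k') (hT : 0 ≤ T)
    (hR : Measurable R) :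
    ∫⁻ p, timeIntegral k T R p ∂paramLaw N = ENNReal.ofReal T * ∫⁻ p, R p ∂paramLaw N := by
  simp only [funext fun p => timeIntegral_eq k hT R p]
  rw [lintegral_lintegral_swap (h.measurable_comp_vortexFlow hT hR).aemeasurable]
  have h1 : ∀ t, ∫⁻ p, R (p.1, vortexFlow k (Set.projIcc 0 T hT t) p) ∂paramLaw N =
      ∫⁻ p, R p ∂paramLaw N := fun t =>
    (h.measurePreserving_vortexFlow N (Set.projIcc 0 T hT t).2.1).lintegral_comp hR
  simp only [h1, lintegral_const, Measure.restrict_apply_univ, Real.volume_Icc, sub_zero]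
  rw [mul_comm]

end TimeIntegral

/-! ### Integrals of pair interactions -/

theorem measurable_config_apply {N : ℕ} (i : Fin N) : Measurable fun x : Config N => x i :=
  measurable_pi_apply i

/-- Translating `x_j` by `u` changes neither `G` nor the volume, and averaging over `u` replaces `f
(x_i - x_j)` by its mean. In other words `x_i - x_j` is uniform and independent of the other
positions. -/
theorem lintegral_pair_mul {N : ℕ} {i j : Fin N} (hij : i ≠ j) {f : Torus → ENNReal}
    (hf : Measurable f) {G : Config N → ENNReal} (hG : Measurable G)
    (hGj : ∀ x u, G (x + Pi.single j u) = G x) :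
    ∫⁻ x : Config N, f (x i - x j) * G x = (∫⁻ u, f u) * ∫⁻ x, G x := by
  have hF : Measurable fun x : Config N => f (x i - x j) * G x :=
    (hf.comp ((measurable_config_apply i).sub (measurable_config_apply j))).mul hG
  have h1 : ∀ u : Torus, ∫⁻ x : Config N, f (x i - x j + u) * G x =
      ∫⁻ x : Config N, f (x i - x j) * G x := fun u => by
    rw [← lintegral_add_right_eq_self (fun x : Config N => f (x i - x j) * G x)
      (Pi.single j (-u))]
    refine lintegral_congr fun x => ?_
    rw [hGj]
    simp only [Pi.add_apply, Pi.single_eq_same, Pi.single_eq_of_ne hij]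
    congr 2
    abel
  have h2 : ∫⁻ u : Torus, ∫⁻ x : Config N, f (x i - x j + u) * G x =
      ∫⁻ x : Config N, f (x i - x j) * G x := by
    simp only [h1, lintegral_const, measure_univ, mul_one]
  rw [← h2, lintegral_lintegral_swap]
  · have h3 : ∀ x : Config N, ∫⁻ u, f (x i - x j + u) * G x = (∫⁻ u, f u) * G x := fun x => by
      have h4 : Measurable fun u => f (x i - x j + u) :=
        hf.comp (measurable_const.add measurable_id)
      rw [lintegral_mul_const _ h4, lintegral_add_left_eq_self f]
    simp only [h3]
    rw [lintegral_const_mul _ hG]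
  · refine Measurable.aemeasurable ?_
    exact (hf.comp ((((measurable_config_apply i).comp measurable_snd).sub
      ((measurable_config_apply j).comp measurable_snd)).add measurable_fst)).mul
      (hG.comp measurable_snd)

theorem lintegral_pair {N : ℕ} {i j : Fin N} (hij : i ≠ j) {f : Torus → ENNReal}
    (hf : Measurable f) : ∫⁻ x : Config N, f (x i - x j) = ∫⁻ u, f u := by
  have := lintegral_pair_mul hij hf (G := fun _ => 1) measurable_const fun _ _ => rfl
  simpa using this

theorem lintegral_enorm_gaussian_lt_top : ∫⁻ x, ‖x‖ₑ ∂gaussianReal 0 1 < ⊤ := by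
  have : Integrable id (gaussianReal 0 1) := by
    simpa using (memLp_id_gaussianReal (μ := 0) (v := 1) 1).integrable (by norm_num)
  exact this.2

theorem lintegral_mul_paramLaw {N : ℕ} {f : (Fin N → ℝ) → ENNReal} (hf : Measurable f)
    {G : Config N → ENNReal} (hG : Measurable G) :
    ∫⁻ p, f p.1 * G p.2 ∂paramLaw N =
      (∫⁻ ξ, f ξ ∂Measure.pi fun _ : Fin N => gaussianReal 0 1) * ∫⁻ x, G x :=
  lintegral_prod_mul hf.aemeasurable hG.aemeasurable

theorem lintegral_enorm_coord_lt_top {N : ℕ} (m : Fin N) :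
    ∫⁻ ξ : Fin N → ℝ, ‖ξ m‖ₑ ∂(Measure.pi fun _ : Fin N => gaussianReal 0 1) < ⊤ := by
  have h := (measurePreserving_eval (fun _ : Fin N => gaussianReal 0 1) m).lintegral_comp
    (f := fun x => ‖x‖ₑ) measurable_enorm
  exact h.trans_lt lintegral_enorm_gaussian_lt_top

/-! ### Collisions are unlikely -/

/-- A bound for the rate of change of the logarithmic gap between the vortices `i` and `j`. -/
def pairRate {N : ℕ} (a : ℝ) (C : NNReal) (i j : Fin N) (p : Param N) : ENNReal :=
  ‖p.1 i‖ₑ * (C * singWeight a (p.2 i - p.2 j)) + (‖p.1 j‖ₑ * (C * singWeight a (p.2 i - p.2 j)) +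
    ∑ m ∈ (Finset.univ.erase i).erase j,
      (‖p.1 m‖ₑ * (singWeight 1 (p.2 i - p.2 j) *
          (ENNReal.ofReal 10 * (C * singWeight a (p.2 i - p.2 m)))) +
        ‖p.1 m‖ₑ * (singWeight 1 (p.2 i - p.2 j) *
          (ENNReal.ofReal 10 * (C * singWeight a (p.2 j - p.2 m))))))

theorem measurable_singWeight_sub {N : ℕ} (a : ℝ) (i j : Fin N) :
    Measurable fun x : Config N => singWeight a (x i - x j) :=
  (measurable_singWeight a).comp ((measurable_config_apply i).sub (measurable_config_apply j))

theorem measurable_singWeight_param {N : ℕ} (a : ℝ) (i j : Fin N) :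
    Measurable fun p : Param N => singWeight a (p.2 i - p.2 j) :=
  (measurable_singWeight_sub a i j).comp measurable_snd

theorem measurable_enorm_coord {N : ℕ} (i : Fin N) : Measurable fun ξ : Fin N → ℝ => ‖ξ i‖ₑ :=
  (measurable_pi_apply i).enorm

theorem measurable_pairRate {N : ℕ} (a : ℝ) (C : NNReal) (i j : Fin N) :
    Measurable (pairRate a C i j) := by
  have h1 := measurable_singWeight_param (N := N)
  have h2 : ∀ i, Measurable fun p : Param N => ‖p.1 i‖ₑ := fun i =>
    (measurable_enorm_coord i).comp measurable_fst
  unfold pairRate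
  refine ((h2 i).mul ((h1 a i j).const_mul _)).add (((h2 j).mul ((h1 a i j).const_mul _)).add ?_)
  refine Finset.measurable_sum _ fun m _ => ?_
  exact ((h2 m).mul ((h1 1 i j).mul (((h1 a i m).const_mul _).const_mul _))).add
    ((h2 m).mul ((h1 1 i j).mul (((h1 a j m).const_mul _).const_mul _)))

/-- In a term with a third vortex `m`, one of `x_i`, `x_j` occurs only in the factor of exponent
`1`; integrating it first separates the two singularities. The second family of such terms follows
by exchanging `i` and `j`. -/
theorem lintegral_pairRate_lt_top {N : ℕ} {a : ℝ} (ha0 : 0 ≤ a) (ha : a < 2) (C : NNReal)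
    {i j : Fin N} (hij : i ≠ j) : ∫⁻ p, pairRate a C i j p ∂paramLaw N < ⊤ := by
  have hS : ∀ {i j : Fin N}, i ≠ j → ∫⁻ x : Config N, singWeight a (x i - x j) < ⊤ := fun h => by
    rw [lintegral_pair h (measurable_singWeight a)]
    exact lintegral_singWeight_lt_top ha0 ha
  have hm := measurable_singWeight_sub (N := N)
  have hA : ∀ m, ∫⁻ p : Param N, ‖p.1 m‖ₑ * (C * singWeight a (p.2 i - p.2 j)) ∂paramLaw N < ⊤ :=
    fun m => by
    rw [lintegral_mul_paramLaw (measurable_enorm_coord m) ((hm a i j).const_mul _),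
      lintegral_const_mul _ (hm a i j)]
    exact ENNReal.mul_lt_top (lintegral_enorm_coord_lt_top m)
      (ENNReal.mul_lt_top ENNReal.coe_lt_top (hS hij))
  have hB : ∀ {i j : Fin N}, i ≠ j → ∀ m, m ≠ i → m ≠ j →
      ∫⁻ p : Param N, ‖p.1 m‖ₑ * (singWeight 1 (p.2 i - p.2 j) *
        (ENNReal.ofReal 10 * (C * singWeight a (p.2 i - p.2 m)))) ∂paramLaw N < ⊤ := by
    intro i j hij m hmi hmj
    have hG : Measurable fun x : Config N =>
        ENNReal.ofReal 10 * (C * singWeight a (x i - x m)) := ((hm a i m).const_mul _).const_mul _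
    rw [lintegral_mul_paramLaw (f := fun ξ => ‖ξ m‖ₑ) (G := fun x => singWeight 1 (x i - x j) *
        (ENNReal.ofReal 10 * (C * singWeight a (x i - x m)))) (measurable_enorm_coord m)
        ((hm 1 i j).mul hG),
      lintegral_pair_mul hij (measurable_singWeight 1) hG, lintegral_const_mul _
        ((hm a i m).const_mul _), lintegral_const_mul _ (hm a i m)]
    · exact ENNReal.mul_lt_top (lintegral_enorm_coord_lt_top m)
        (ENNReal.mul_lt_top (lintegral_singWeight_lt_top zero_le_one one_lt_two)
          (ENNReal.mul_lt_top ENNReal.ofReal_lt_top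
            (ENNReal.mul_lt_top ENNReal.coe_lt_top (hS hmi.symm))))
    · intro x u
      simp only [Pi.add_apply, Pi.single_eq_of_ne hij, Pi.single_eq_of_ne hmj, add_zero]
  have h2 : ∀ i, Measurable fun p : Param N => ‖p.1 i‖ₑ := fun i =>
    (measurable_enorm_coord i).comp measurable_fst
  have h1 := measurable_singWeight_param (N := N)
  have h3 : ∀ m, Measurable fun p : Param N => ‖p.1 m‖ₑ * (C * singWeight a (p.2 i - p.2 j)) :=
    fun m => (h2 m).mul ((h1 a i j).const_mul _)
  have h4 : ∀ l m, Measurable fun p : Param N => ‖p.1 m‖ₑ * (singWeight 1 (p.2 i - p.2 j) *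
      (ENNReal.ofReal 10 * (C * singWeight a (p.2 l - p.2 m)))) := fun l m =>
    (h2 m).mul ((h1 1 i j).mul (((h1 a l m).const_mul _).const_mul _))
  unfold pairRate
  rw [lintegral_add_left (h3 i), lintegral_add_left (h3 j), lintegral_finsetSum]
  · refine ENNReal.add_lt_top.2 ⟨hA i, ENNReal.add_lt_top.2 ⟨hA j, ENNReal.sum_lt_top.2
      fun m hm' => ?_⟩⟩
    obtain ⟨hmj, hmi, -⟩ := by simpa only [Finset.mem_erase] using hm'
    rw [lintegral_add_left (h4 i m)]
    refine ENNReal.add_lt_top.2 ⟨hB hij m hmi hmj, ?_⟩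
    have h5 : ∀ x : Config N, singWeight 1 (x i - x j) = singWeight 1 (x j - x i) := fun x => by
      rw [← neg_sub, singWeight_neg]
    simp only [h5]
    exact hB hij.symm m hmj hmi
  · exact fun m _ => (h4 i m).add (h4 j m)

/-- The linear form `v ↦ gapDeriv z v / (gap z + η)`. -/
def gapForm (η : ℝ) (z : Plane) : Plane →ₗ[ℝ] ℝ where
  toFun v := gapDeriv z v / (gap z + η)
  map_add' u v := by simp only [gapDeriv, PiLp.add_apply]; ring
  map_smul' a v := by
    simp only [gapDeriv, PiLp.smul_apply, smul_eq_mul, RingHom.id_apply]; ring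

/-- In the relative velocity the summands `m = i` and `m = j` both equal `k (x_i - x_j)` by oddness,
and benefit from the cancellation `hC'`. All other summands are treated by the crude bound. -/
theorem ofReal_gapDeriv_drift_le {k : Torus → Plane} {k' : Torus → Plane →L[ℝ] Plane}
    (h : IsRegularKernel k k') {a η : ℝ} (hη : 0 < η) {C : NNReal}
    (hC : ∀ x, ‖k x‖ₑ ≤ C * singWeight a x)
    (hC' : ∀ z, ENNReal.ofReal |gapDeriv z (k (toTorus z)) / (gap z + η)| ≤
      C * singWeight a (toTorus z)) {N : ℕ} (ξ : Fin N → ℝ) (y : LiftConfig N) {i j : Fin N}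
    (hij : i ≠ j) :
    ENNReal.ofReal |gapDeriv (y i - y j) (drift k ξ (toConfig N y) i - drift k ξ (toConfig N y) j) /
      (gap (y i - y j) + η)| ≤ pairRate a C i j (ξ, toConfig N y) := by
  set z := y i - y j with hz
  set x := toConfig N y with hx
  have hzx : toTorus z = x i - x j := by rw [hz, toTorus_sub]; rfl
  set u : Fin N → Plane := fun m => k (x i - x m) - k (x j - x m) with hu
  have hN : ‖(√(N : ℝ))⁻¹‖ₑ ≤ 1 := by
    rw [← ofReal_norm, Real.norm_of_nonneg (by positivity)]
    refine ENNReal.ofReal_le_one.2 ?_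
    exact inv_le_one_of_one_le₀ (Real.one_le_sqrt.2 (by exact_mod_cast i.pos))
  have e1 : drift k ξ x i - drift k ξ x j = (√(N : ℝ))⁻¹ • ∑ m, ξ m • u m := by
    simp only [drift, hu, ← smul_sub, ← Finset.sum_sub_distrib]
  have hself : ‖gapForm η z (k (x i - x j))‖ₑ ≤ C * singWeight a (x i - x j) := by
    rw [Real.enorm_eq_ofReal_abs, ← hzx]
    exact hC' z
  have hi : u i = k (x i - x j) := by
    rw [hu]; dsimp only
    rw [sub_self, h.zero, ← neg_sub (x i) (x j), h.odd, zero_sub, neg_neg]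
  have hj : u j = k (x i - x j) := by
    rw [hu]; dsimp only
    rw [sub_self, h.zero, sub_zero]
  rw [← Real.enorm_eq_ofReal_abs]
  change ‖gapForm η z (drift k ξ x i - drift k ξ x j)‖ₑ ≤ _
  rw [e1, map_smul, map_sum, smul_eq_mul, enorm_mul]
  calc _ ≤ 1 * ∑ m, ‖gapForm η z (ξ m • u m)‖ₑ := mul_le_mul' hN (enorm_sum_le _ _)
    _ = ∑ m, ‖ξ m‖ₑ * ‖gapForm η z (u m)‖ₑ := by
        simp only [one_mul, map_smul, smul_eq_mul, enorm_mul]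
    _ = ‖ξ i‖ₑ * ‖gapForm η z (u i)‖ₑ + (‖ξ j‖ₑ * ‖gapForm η z (u j)‖ₑ +
          ∑ m ∈ (Finset.univ.erase i).erase j, ‖ξ m‖ₑ * ‖gapForm η z (u m)‖ₑ) := by
        rw [Finset.add_sum_erase _ (fun m => ‖ξ m‖ₑ * ‖gapForm η z (u m)‖ₑ)
          (Finset.mem_erase.2 ⟨hij.symm, Finset.mem_univ j⟩),
          Finset.add_sum_erase _ (fun m => ‖ξ m‖ₑ * ‖gapForm η z (u m)‖ₑ) (Finset.mem_univ i)]
    _ ≤ _ := by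
        rw [hi, hj]
        refine add_le_add (mul_le_mul' le_rfl hself) (add_le_add (mul_le_mul' le_rfl hself)
          (Finset.sum_le_sum fun m _ => ?_))
        rw [← mul_add, ← mul_add, ← mul_add]
        refine mul_le_mul' le_rfl ?_
        rw [Real.enorm_eq_ofReal_abs]
        refine (ofReal_gapDeriv_le hη z (u m)).trans ?_
        rw [hzx, mul_comm (ENNReal.ofReal 10), mul_assoc]
        refine mul_le_mul' le_rfl (mul_le_mul' le_rfl ?_)
        exact (enorm_sub_le).trans (add_le_add (hC _) (hC _))

theorem ofReal_logGap_liftFlow_le {k : Torus → Plane} {k' : Torus → Plane →L[ℝ] Plane}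
    (h : IsRegularKernel k k') {a η : ℝ} (hη : 0 < η) {C : NNReal}
    (hC : ∀ x, ‖k x‖ₑ ≤ C * singWeight a x)
    (hC' : ∀ z, ENNReal.ofReal |gapDeriv z (k (toTorus z)) / (gap z + η)| ≤
      C * singWeight a (toTorus z)) {N : ℕ} (ξ : Fin N → ℝ) (y : LiftConfig N) {i j : Fin N}
    (hij : i ≠ j) {t T : ℝ} (ht : t ∈ Set.Icc 0 T) :
    ENNReal.ofReal (logGap η (liftFlow k ξ y t i - liftFlow k ξ y t j)) ≤
      ENNReal.ofReal 2 * singWeight 1 (toConfig N y i - toConfig N y j) +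
        timeIntegral k T (pairRate a C i j) (ξ, toConfig N y) := by
  set Y := liftFlow k ξ y with hY
  have hd := h.hasDerivAt_liftFlow ξ y
  have hYc : Continuous Y := continuous_iff_continuousAt.2 fun r => (hd r).continuousAt
  have hkc := h.continuous
  have hqc := (isOpenQuotientMap_toConfig N).continuous
  have hdc : Continuous fun r => drift k ξ (toConfig N (Y r)) := by unfold drift; fun_prop
  have hf : ∀ r, HasDerivAt (fun r => logGap η (Y r i - Y r j))
      (-(gapDeriv (Y r i - Y r j)
        (drift k ξ (toConfig N (Y r)) i - drift k ξ (toConfig N (Y r)) j) /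
          (gap (Y r i - Y r j) + η))) r := fun r =>
    hasDerivAt_logGap hη ((hasDerivAt_pi.1 (hd r) i).sub (hasDerivAt_pi.1 (hd r) j))
  have hfc : Continuous fun r => -(gapDeriv (Y r i - Y r j)
        (drift k ξ (toConfig N (Y r)) i - drift k ξ (toConfig N (Y r)) j) /
          (gap (Y r i - Y r j) + η)) := by
    have h1 : ∀ r, gap (Y r i - Y r j) + η ≠ 0 := fun r =>
      (add_pos_of_nonneg_of_pos (gap_nonneg _) hη).ne'
    refine (Continuous.div ?_ ?_ h1).neg
    · unfold gapDeriv; fun_prop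
    · unfold gap; fun_prop
  have h1 := ofReal_abs_sub_le_lintegral hf hfc ht.1
  have h2 : ∫⁻ r in Set.Icc 0 t, ENNReal.ofReal |-(gapDeriv (Y r i - Y r j)
        (drift k ξ (toConfig N (Y r)) i - drift k ξ (toConfig N (Y r)) j) /
          (gap (Y r i - Y r j) + η))| ≤ timeIntegral k T (pairRate a C i j) (ξ, toConfig N y) := by
    refine (lintegral_mono_set (Set.Icc_subset_Icc le_rfl ht.2)).trans ?_
    refine setLIntegral_mono_ae' measurableSet_Icc (Eventually.of_forall fun r hr => ?_)
    rw [abs_neg, h.vortexFlow_toConfig ξ y hr.1]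
    exact ofReal_gapDeriv_drift_le h hη hC hC' ξ (Y r) hij
  have h3 := ofReal_logGap_le hη (Y 0 i - Y 0 j)
  rw [toTorus_sub, hY, h.liftFlow_zero] at h3
  calc _ ≤ ENNReal.ofReal (logGap η (Y 0 i - Y 0 j) +
        |logGap η (Y t i - Y t j) - logGap η (Y 0 i - Y 0 j)|) :=
        ENNReal.ofReal_le_ofReal (by
          linarith [le_abs_self (logGap η (Y t i - Y t j) - logGap η (Y 0 i - Y 0 j))])
    _ ≤ _ := ENNReal.ofReal_add_le
    _ ≤ _ := by
        refine add_le_add ?_ (h1.trans h2)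
        rw [hY, h.liftFlow_zero]
        exact h3

/-- The set of initial data for which two vortices come closer than `δ` before time `T`. -/
def nearCollision {N : ℕ} (k : Torus → Plane) (δ T : ℝ) : Set (Param N) :=
  {p | ∃ t ∈ Set.Icc 0 T, ∃ i j, i ≠ j ∧ ‖vortexFlow k t p i - vortexFlow k t p j‖ < δ}

/-- With `η = δ²`, a near collision lifts the potential above `-log (13 δ²)` at some time. The
potential is dominated on all of `[0, T]` by a functional of the initial data whose expectation does
not depend on `δ`; Markov's inequality and a union over pairs conclude. -/
theorem exists_measure_nearCollision_le (c : ℝ) {ε : ℝ} (hε₀ : 0 < ε) (hε₁ : ε < 1) (N : ℕ)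
    {T : ℝ} (hT : 0 ≤ T) : ∃ M : ENNReal, M < ⊤ ∧ ∀ δ : ℝ, 0 < δ → δ < 1 / 4 →
      paramLaw N (nearCollision (torusKernel c ε δ) δ T) ≤
        M / ENNReal.ofReal (-Real.log (13 * δ ^ 2)) := by
  obtain ⟨C₁, h₁⟩ := exists_enorm_torusKernel_le c hε₀ hε₁
  obtain ⟨C₂, h₂⟩ := exists_ofReal_gapDeriv_torusKernel_le c hε₀ hε₁
  set C := max C₁ C₂ with hC
  set W : Fin N → Fin N → ENNReal := fun i j => if i = j then 0 else
    ENNReal.ofReal 2 * (∫⁻ u, singWeight 1 u) +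
      ENNReal.ofReal T * ∫⁻ p, pairRate (2 - ε) C i j p ∂paramLaw N with hW
  refine ⟨∑ q : Fin N × Fin N, W q.1 q.2, ENNReal.sum_lt_top.2 fun q _ => ?_, fun δ hδ hδ1 => ?_⟩
  · by_cases hq : q.1 = q.2
    · simp [hW, hq]
    · simp only [hW, if_neg hq]
      exact ENNReal.add_lt_top.2 ⟨ENNReal.mul_lt_top ENNReal.ofReal_lt_top
        (lintegral_singWeight_lt_top zero_le_one one_lt_two),
        ENNReal.mul_lt_top ENNReal.ofReal_lt_top
          (lintegral_pairRate_lt_top (by linarith) (by linarith) C hq)⟩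
  have hreg := isRegularKernel_torusKernel c hε₁ hδ (by linarith)
  set k := torusKernel c ε δ with hk
  have hC1 : ∀ x, ‖k x‖ₑ ≤ C * singWeight (2 - ε) x := fun x =>
    (h₁ δ hδ (by linarith) x).trans
      (mul_le_mul' (ENNReal.coe_le_coe.2 (le_max_left _ _)) le_rfl)
  have hC2 : ∀ z, ENNReal.ofReal |gapDeriv z (k (toTorus z)) / (gap z + δ ^ 2)| ≤
      C * singWeight (2 - ε) (toTorus z) := fun z =>
    (h₂ δ hδ (by linarith) _ (by positivity) z).trans
      (mul_le_mul' (ENNReal.coe_le_coe.2 (le_max_right _ _)) le_rfl)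
  set R := -Real.log (13 * δ ^ 2) with hR
  -- For `δ < 1/4` one has `13 δ² < 1`.
  have hR0 : 0 < R := by
    rw [hR, neg_pos]
    exact Real.log_neg (by positivity) (by nlinarith)
  set F : Fin N → Fin N → Param N → ENNReal := fun i j p =>
    ENNReal.ofReal 2 * singWeight 1 (p.2 i - p.2 j) +
      timeIntegral k T (pairRate (2 - ε) C i j) p with hF
  have hFm : ∀ i j, Measurable (F i j) := fun i j =>
    ((measurable_singWeight_param 1 i j).const_mul _).add
      (hreg.measurable_timeIntegral hT (measurable_pairRate _ _ i j))
  have hFi : ∀ i j, i ≠ j → ∫⁻ p, F i j p ∂paramLaw N = W i j := fun i j hij => by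
    simp only [hF, hW, if_neg hij]
    rw [lintegral_add_left ((measurable_singWeight_param 1 i j).const_mul _),
      lintegral_const_mul _ (measurable_singWeight_param 1 i j),
      hreg.lintegral_timeIntegral hT (measurable_pairRate _ _ i j)]
    congr 2
    have := lintegral_mul_paramLaw (N := N) (f := fun _ => 1) measurable_const
      (measurable_singWeight_sub 1 i j)
    simp only [one_mul, lintegral_const, measure_univ] at this
    rw [this, lintegral_pair hij (measurable_singWeight 1)]
  have hsub : nearCollision k δ T ⊆ ⋃ q : Fin N × Fin N,
      {p | q.1 ≠ q.2 ∧ ENNReal.ofReal R ≤ F q.1 q.2 p} := by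
    rintro ⟨ξ, x⟩ ⟨t, ht, i, j, hij, hlt⟩
    obtain ⟨y, rfl⟩ := (isOpenQuotientMap_toConfig N).surjective x
    refine Set.mem_iUnion.2 ⟨(i, j), hij, ?_⟩
    rw [hreg.vortexFlow_toConfig ξ y ht.1, toConfig_apply, toConfig_apply, ← toTorus_sub] at hlt
    exact (ENNReal.ofReal_le_ofReal (neg_log_le_logGap hδ hlt)).trans
      (ofReal_logGap_liftFlow_le hreg (by positivity) hC1 hC2 ξ y hij ht)
  refine (measure_mono hsub).trans ((measure_iUnion_fintype_le _ _).trans ?_)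
  rw [div_eq_mul_inv, Finset.sum_mul]
  refine Finset.sum_le_sum fun q _ => ?_
  by_cases hq : q.1 = q.2
  · simp [hq]
  · simp only [ne_eq, hq, not_false_eq_true, true_and]
    rw [← div_eq_mul_inv, ← hFi _ _ hq]
    exact meas_ge_le_lintegral_div (hFm _ _).aemeasurable (by simpa using hR0) ENNReal.ofReal_ne_top

/-! ### Existence and uniqueness of the point vortex dynamics -/

section Dynamics

variable {c ε : ℝ} {N : ℕ}

theorem drift_torusKernel_eq (c : ℝ) (hε₁ : ε < 1) {δ : ℝ} (hδ : 0 < δ) (hδ1 : δ ≤ 1)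
    (ξ : Fin N → ℝ) {y : LiftConfig N}
    (hy : ∀ i j, i ≠ j → δ ≤ ‖toConfig N y i - toConfig N y j‖) (i : Fin N) :
    drift (torusKernel c ε δ) ξ (toConfig N y) i =
      (√(N : ℝ))⁻¹ • ∑ j, ξ j • kernel c ε (y i - y j) := by
  rw [drift]
  congr 1
  refine Finset.sum_congr rfl fun j _ => ?_
  congr 1
  rcases eq_or_ne i j with rfl | hij
  · rw [sub_self, sub_self, torusKernel_zero c hε₁ hδ hδ1, kernel_zero]
  · have h := hy i j hij
    simp only [toConfig_apply, ← toTorus_sub] at h ⊢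
    exact torusKernel_eq_kernel c hε₁ hδ hδ1 h

theorem le_norm_sub_of_notMem_nearCollision {k : Torus → Plane} {k' : Torus → Plane →L[ℝ] Plane}
    (h : IsRegularKernel k k') {δ T : ℝ} {ξ : Fin N → ℝ} {y : LiftConfig N}
    (hp : (ξ, toConfig N y) ∉ nearCollision k δ T) {t : ℝ} (ht : t ∈ Set.Icc 0 T) (i j : Fin N)
    (hij : i ≠ j) :
    δ ≤ ‖toConfig N (liftFlow k ξ y t) i - toConfig N (liftFlow k ξ y t) j‖ := by
  by_contra hlt
  refine hp ⟨t, ht, i, j, hij, ?_⟩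
  rw [h.vortexFlow_toConfig ξ y ht.1]
  exact not_le.1 hlt

/-- A flow that keeps its vortices `δ` apart never enters the region where the kernels cut at `δ`
and at `δ' ≤ δ` differ, so it also solves the system with cut-off `δ'`. -/
theorem liftFlow_eq_of_notMem_nearCollision (hε₁ : ε < 1) {δ δ' : ℝ} (hδ' : 0 < δ')
    (hle : δ' ≤ δ) (hδ1 : δ ≤ 1) {T : ℝ} {ξ : Fin N → ℝ} {y : LiftConfig N}
    (hp : (ξ, toConfig N y) ∉ nearCollision (torusKernel c ε δ) δ T) {t : ℝ}
    (ht : t ∈ Set.Icc 0 T) :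
    liftFlow (torusKernel c ε δ) ξ y t = liftFlow (torusKernel c ε δ') ξ y t := by
  have h := isRegularKernel_torusKernel c hε₁ (hδ'.trans_le hle) hδ1
  have h' := isRegularKernel_torusKernel c hε₁ hδ' (hle.trans hδ1)
  have hd := h.hasDerivAt_liftFlow ξ y
  have key := h'.eqOn_liftFlow ξ (T := T) (α := liftFlow (torusKernel c ε δ) ξ y)
    (fun r _ => (hd r).continuousAt.continuousWithinAt) (fun r hr => by
      have hsep := le_norm_sub_of_notMem_nearCollision h hp (Set.Ico_subset_Icc_self hr)
      have e : drift (torusKernel c ε δ) ξ (toConfig N (liftFlow (torusKernel c ε δ) ξ y r)) =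
          drift (torusKernel c ε δ') ξ (toConfig N (liftFlow (torusKernel c ε δ) ξ y r)) := by
        funext i
        rw [drift_torusKernel_eq c hε₁ (hδ'.trans_le hle) hδ1 ξ hsep,
          drift_torusKernel_eq c hε₁ hδ' (hle.trans hδ1) ξ fun i j hij => hle.trans (hsep i j hij)]
      rw [← e]
      exact (hd r).hasDerivWithinAt)
  rw [key ht, h.liftFlow_zero]

/-- The solution on `[0, n]` is the truncated flow that stays separated up to time `n`. Different
horizons use different cut-offs, but the flows agree on common intervals. -/
theorem exists_isVortexSolution (hε₁ : ε < 1) {v : Fin N → ℝ × Torus}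
    (hv : ∀ n : ℕ, ∃ δ : ℝ, 0 < δ ∧ δ ≤ 1 ∧
      splitParam v ∉ nearCollision (torusKernel c ε δ) δ n) :
    ∃ X : ℝ → Fin N → Torus, IsVortexSolution c ε v X := by
  choose δ hδ hδ1 hv using hv
  obtain ⟨y, hy⟩ := (isOpenQuotientMap_toConfig N).surjective (splitParam v).2
  set ξ : Fin N → ℝ := fun i => (v i).1 with hξ
  have hp : ∀ n : ℕ, (ξ, toConfig N y) ∉ nearCollision (torusKernel c ε (δ n)) (δ n) n := fun n => by
    rw [hy]; exact hv n
  have hreg := fun n => isRegularKernel_torusKernel c hε₁ (hδ n) (hδ1 n)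
  have hagree : ∀ (m n : ℕ) (s : ℝ), 0 ≤ s → s ≤ m → s ≤ n →
      liftFlow (torusKernel c ε (δ m)) ξ y s = liftFlow (torusKernel c ε (δ n)) ξ y s := by
    intro m n s hs hm hn
    rcases le_total (δ m) (δ n) with h | h
    · exact (liftFlow_eq_of_notMem_nearCollision hε₁ (hδ m) h (hδ1 n) (hp n) ⟨hs, hn⟩).symm
    · exact liftFlow_eq_of_notMem_nearCollision hε₁ (hδ n) h (hδ1 m) (hp m) ⟨hs, hm⟩
  set Y : ℝ → LiftConfig N := fun t => liftFlow (torusKernel c ε (δ ⌈t⌉₊)) ξ y t with hY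
  have hYn : ∀ (n : ℕ) (s : ℝ), 0 ≤ s → s ≤ n → Y s = liftFlow (torusKernel c ε (δ n)) ξ y s :=
    fun n s hs hn => hagree _ n s hs (Nat.le_ceil s) hn
  have hsep : ∀ t, 0 ≤ t → ∀ i j, i ≠ j → δ ⌈t⌉₊ ≤ ‖toConfig N (Y t) i - toConfig N (Y t) j‖ :=
    fun t ht => le_norm_sub_of_notMem_nearCollision (hreg _) (hp _) ⟨ht, Nat.le_ceil t⟩
  refine ⟨fun t => toConfig N (Y t), fun i => ?_, fun t ht => ?_, Y, fun t _ i => rfl,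
    fun t ht i => ?_⟩
  · simp only [hY]
    rw [(hreg _).liftFlow_zero, hy]
    rfl
  · rintro ⟨i, j, hij, he⟩
    have := hsep t ht i j hij
    rw [he, sub_self, norm_zero] at this
    exact absurd this (not_le.2 (hδ _))
  -- One more than the ceiling: `t` is then strictly below `n`, and the glued curve is a single
  -- truncated flow near `t`.
  · set n := ⌈t⌉₊ + 1 with hn
    have htn : t < n := by
      rw [hn]; push_cast; linarith [Nat.le_ceil t]
    have h1 := hasDerivAt_pi.1 ((hreg n).hasDerivAt_liftFlow ξ y t) i
    rw [← hYn n t ht htn.le, drift_torusKernel_eq c hε₁ (hδ n) (hδ1 n)] at h1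
    · refine h1.hasDerivWithinAt.congr_of_eventuallyEq ?_ (by rw [hYn n t ht htn.le])
      have h2 : ∀ᶠ s in 𝓝[Set.Ici 0] t, s < (n : ℝ) := nhdsWithin_le_nhds (Iio_mem_nhds htn)
      filter_upwards [h2, self_mem_nhdsWithin] with s hs hs0
      rw [hYn n s hs0 hs.le]
    · rw [hYn n t ht htn.le]
      exact le_norm_sub_of_notMem_nearCollision (hreg n) (hp n) ⟨ht, htn.le⟩

/-- By compactness of `[0, T]` a collision free path has a positive minimal distance. For `δ` below
it the path solves the truncated system, whose solutions are unique. Uniqueness for the original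
system and measurability of `theta` both follow from this. -/
theorem IsVortexSolution.eventually_eq (hε₁ : ε < 1) {v : Fin N → ℝ × Torus}
    {X : ℝ → Fin N → Torus} (h : IsVortexSolution c ε v X) {T : ℝ} (hT : 0 ≤ T) :
    ∀ᶠ δ in 𝓝[>] (0 : ℝ), ∀ t ∈ Set.Icc 0 T,
      X t = vortexFlow (torusKernel c ε δ) t (splitParam v) := by
  obtain ⟨Y, hYX, hY⟩ := h.ode
  have hX : ∀ t, 0 ≤ t → toConfig N (Y t) = X t := fun t ht => funext fun i => hYX t ht i
  have hYc : ContinuousOn Y (Set.Ici 0) := continuousOn_pi.2 fun i t ht =>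
    (hY t ht i).continuousWithinAt
  have hqc := (isOpenQuotientMap_toConfig N).continuous
  have hsep : ∀ i j, i ≠ j → ∀ᶠ δ in 𝓝[>] (0 : ℝ), ∀ t ∈ Set.Icc 0 T,
      δ ≤ ‖toConfig N (Y t) i - toConfig N (Y t) j‖ := by
    intro i j hij
    have hc : ContinuousOn (fun t => ‖toConfig N (Y t) i - toConfig N (Y t) j‖) (Set.Icc 0 T) := by
      have h1 : Continuous fun y : LiftConfig N => ‖toConfig N y i - toConfig N y j‖ := by fun_prop
      exact h1.comp_continuousOn (hYc.mono Set.Icc_subset_Ici_self)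
    obtain ⟨t₀, ht₀, hmin⟩ := isCompact_Icc.exists_isMinOn (Set.nonempty_Icc.2 hT) hc
    have hpos : 0 < ‖toConfig N (Y t₀) i - toConfig N (Y t₀) j‖ := by
      rw [norm_pos_iff, sub_ne_zero, hX t₀ ht₀.1]
      exact fun he => h.no_collision t₀ ht₀.1 ⟨i, j, hij, he⟩
    filter_upwards [Ioo_mem_nhdsGT hpos] with δ hδ t ht
    exact hδ.2.le.trans (hmin ht)
  have hall : ∀ᶠ δ in 𝓝[>] (0 : ℝ), ∀ i j, i ≠ j → ∀ t ∈ Set.Icc 0 T,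
      δ ≤ ‖toConfig N (Y t) i - toConfig N (Y t) j‖ := by
    simp only [eventually_all]
    exact hsep
  filter_upwards [hall, Ioo_mem_nhdsGT zero_lt_one] with δ hδ hδ1 t ht
  have hreg := isRegularKernel_torusKernel c hε₁ hδ1.1 hδ1.2.le
  have key := hreg.eqOn_liftFlow (fun i => (v i).1) (T := T) (α := Y)
    (hYc.mono Set.Icc_subset_Ici_self) (fun r hr => by
      refine hasDerivWithinAt_pi.2 fun i => ?_
      rw [drift_torusKernel_eq c hε₁ hδ1.1 hδ1.2.le _
        fun i j hij => hδ i j hij r (Set.Ico_subset_Icc_self hr)]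
      exact (hY r hr.1 i).mono (Set.Ici_subset_Ici.2 hr.1))
  have h0 : splitParam v = (fun i => (v i).1, toConfig N (Y 0)) := by
    rw [hX 0 le_rfl]
    exact Prod.ext rfl (funext fun i => (h.initial i).symm)
  rw [h0, hreg.vortexFlow_toConfig _ _ ht.1, ← key ht, hX t ht.1]

theorem IsVortexSolution.unique (hε₁ : ε < 1) {v : Fin N → ℝ × Torus}
    {X X' : ℝ → Fin N → Torus} (h : IsVortexSolution c ε v X) (h' : IsVortexSolution c ε v X')
    {t : ℝ} (ht : 0 ≤ t) : X' t = X t := by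
  obtain ⟨δ, h1, h2⟩ := ((h.eventually_eq hε₁ ht).and (h'.eventually_eq hε₁ ht)).exists
  rw [h1 t ⟨ht, le_rfl⟩, h2 t ⟨ht, le_rfl⟩]

theorem IsVortexSolution.exists_isVortexFieldPath (hε₁ : ε < 1) {v : Fin N → ℝ × Torus}
    {X : ℝ → Fin N → Torus} (h : IsVortexSolution c ε v X) {T : ℝ} (hT : 0 ≤ T) :
    ∃ u : PathSpace T, IsVortexFieldPath c ε T v u := by
  obtain ⟨δ, h1, h2⟩ := ((h.eventually_eq hε₁ hT).and (Ioo_mem_nhdsGT zero_lt_one)).exists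
  have hreg := isRegularKernel_torusKernel c hε₁ h2.1 h2.2.le
  refine ⟨hreg.path T N (splitParam v), X, h, fun t => ?_⟩
  rw [hreg.path_apply, h1 t t.2]
  rfl

theorem IsVortexSolution.theta_apply (hε₁ : ε < 1) {v : Fin N → ℝ × Torus}
    {X : ℝ → Fin N → Torus} (h : IsVortexSolution c ε v X) {T : ℝ} (hT : 0 ≤ T)
    (t : Set.Icc (0 : ℝ) T) : (theta c ε T N v t).toDistribution = vortexField v (X t) := by
  have hu := h.exists_isVortexFieldPath hε₁ hT
  rw [theta, dif_pos hu]
  obtain ⟨X', hX', he⟩ := hu.choose_spec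
  rw [he t, h.unique hε₁ hX' t.2.1]

theorem IsVortexSolution.eventually_theta_eq (hε₁ : ε < 1) {v : Fin N → ℝ × Torus}
    {X : ℝ → Fin N → Torus} (h : IsVortexSolution c ε v X) {T : ℝ} (hT : 0 ≤ T) :
    ∀ᶠ δ in 𝓝[>] (0 : ℝ), ∀ hreg : IsRegularKernel (torusKernel c ε δ) (torusKernelDeriv c ε δ),
      theta c ε T N v = hreg.path T N (splitParam v) := by
  filter_upwards [h.eventually_eq hε₁ hT] with δ hδ hreg
  refine ContinuousMap.ext fun t => Subtype.ext ?_
  change (theta c ε T N v t).toDistribution = (hreg.path T N (splitParam v) t).toDistribution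
  rw [h.theta_apply hε₁ hT, hreg.path_apply, hδ t t.2]
  rfl

end Dynamics

/-! ### Almost sure statements along a sequence of cut-offs. -/

/-- A sequence of cut-off parameters. -/
def cutoff (n : ℕ) : ℝ := (1 / 2) ^ (n + 3)

theorem cutoff_pos (n : ℕ) : 0 < cutoff n := by unfold cutoff; positivity

theorem cutoff_lt (n : ℕ) : cutoff n < 1 / 4 := by
  have h : ((1 : ℝ) / 2) ^ n ≤ 1 := pow_le_one₀ (by norm_num) (by norm_num)
  rw [cutoff, pow_add]
  linarith

theorem tendsto_cutoff : Tendsto cutoff atTop (𝓝[>] 0) := by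
  refine tendsto_nhdsWithin_iff.2 ⟨?_, Eventually.of_forall cutoff_pos⟩
  exact (tendsto_pow_atTop_nhds_zero_of_lt_one (by norm_num) (by norm_num)).comp
    (tendsto_add_atTop_nat 3)

theorem isRegularKernel_cutoff (c : ℝ) {ε : ℝ} (hε₁ : ε < 1) (n : ℕ) :
    IsRegularKernel (torusKernel c ε (cutoff n)) (torusKernelDeriv c ε (cutoff n)) :=
  isRegularKernel_torusKernel c hε₁ (cutoff_pos n) (by linarith [cutoff_lt n])

theorem tendsto_measure_nearCollision (c : ℝ) {ε : ℝ} (hε₀ : 0 < ε) (hε₁ : ε < 1) (N : ℕ) {T : ℝ}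
    (hT : 0 ≤ T) : Tendsto (fun n => paramLaw N (nearCollision (torusKernel c ε (cutoff n))
      (cutoff n) T)) atTop (𝓝 0) := by
  obtain ⟨M, hM, h⟩ := exists_measure_nearCollision_le c hε₀ hε₁ N hT
  have h1 : Tendsto (fun δ : ℝ => -Real.log (13 * δ ^ 2)) (𝓝[>] 0) atTop := by
    refine tendsto_neg_atBot_atTop.comp (Real.tendsto_log_nhdsGT_zero.comp ?_)
    refine tendsto_nhdsWithin_iff.2 ⟨?_, ?_⟩
    · have : Continuous fun δ : ℝ => 13 * δ ^ 2 := by fun_prop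
      have h2 := this.tendsto 0
      simp only [ne_eq, OfNat.ofNat_ne_zero, not_false_eq_true, zero_pow, mul_zero] at h2
      exact h2.mono_left nhdsWithin_le_nhds
    · filter_upwards [self_mem_nhdsWithin] with δ hδ
      have : (0 : ℝ) < δ := hδ
      exact (by positivity : 0 < 13 * δ ^ 2)
  have h2 := ENNReal.Tendsto.const_div
    (ENNReal.tendsto_ofReal_atTop.comp (h1.comp tendsto_cutoff)) (Or.inr hM.ne)
  rw [ENNReal.div_top] at h2
  exact tendsto_of_tendsto_of_tendsto_of_le_of_le tendsto_const_nhds h2 (fun _ => bot_le)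
    fun n => h _ (cutoff_pos n) (cutoff_lt n)

theorem ae_exists_isVortexSolution (c : ℝ) {ε : ℝ} (hε₀ : 0 < ε) (hε₁ : ε < 1) (N : ℕ) :
    ∀ᵐ v ∂initialLaw N, ∃ X : ℝ → Fin N → Torus, IsVortexSolution c ε v X := by
  have h1 : ∀ᵐ p ∂paramLaw N, ∀ n : ℕ, ∃ m : ℕ,
      p ∉ nearCollision (torusKernel c ε (cutoff m)) (cutoff m) n := by
    rw [ae_all_iff]
    intro n
    rw [ae_iff]
    -- The exceptional event for the horizon `n` lies in the near-collision event of every cut-off,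
    -- and these probabilities tend to zero.
    refine le_antisymm (ge_of_tendsto' (tendsto_measure_nearCollision c hε₀ hε₁ N
      (Nat.cast_nonneg n)) fun m => measure_mono fun p hp => ?_) bot_le
    simp only [not_exists, not_not] at hp
    exact hp m
  filter_upwards [(measurePreserving_splitParam N).quasiMeasurePreserving.ae h1] with v hv
  refine exists_isVortexSolution hε₁ fun n => ?_
  obtain ⟨m, hm⟩ := hv n
  exact ⟨cutoff m, cutoff_pos m, by linarith [cutoff_lt m], hm⟩

theorem ae_eventually_theta_eq (c : ℝ) {ε : ℝ} (hε₀ : 0 < ε) (hε₁ : ε < 1) (N : ℕ) {T : ℝ}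
    (hT : 0 ≤ T) : ∀ᵐ v ∂initialLaw N, ∀ᶠ n in atTop,
      theta c ε T N v = (isRegularKernel_cutoff c hε₁ n).path T N (splitParam v) := by
  filter_upwards [ae_exists_isVortexSolution c hε₀ hε₁ N] with v ⟨X, hX⟩
  filter_upwards [tendsto_cutoff.eventually (hX.eventually_theta_eq hε₁ hT)] with n hn
  exact hn _

/-- The definition of `theta` by choice shows no measurability, but almost surely `theta` is the
limit of the paths of the truncated systems, which are continuous functions of the data. -/
theorem aemeasurable_theta (c : ℝ) {ε : ℝ} (hε₀ : 0 < ε) (hε₁ : ε < 1) (N : ℕ) {T : ℝ}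
    (hT : 0 ≤ T) : AEMeasurable (theta c ε T N) (initialLaw N) := by
  refine aemeasurable_of_tendsto_metrizable_ae atTop
    (f := fun n v => (isRegularKernel_cutoff c hε₁ n).path T N (splitParam v)) (fun n => ?_) ?_
  · exact ((isRegularKernel_cutoff c hε₁ n).path T N).continuous.measurable.comp_aemeasurable
      (measurePreserving_splitParam N).measurable.aemeasurable
  · filter_upwards [ae_eventually_theta_eq c hε₀ hε₁ N hT] with v hv
    exact tendsto_const_nhds.congr' hv

/-! ### Gaussian moments -/

/-- The law of the intensities. -/
def intensityLaw (N : ℕ) : Measure (Fin N → ℝ) := Measure.pi fun _ => gaussianReal 0 1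

instance (N : ℕ) : IsProbabilityMeasure (intensityLaw N) :=
  inferInstanceAs (IsProbabilityMeasure (Measure.pi fun _ : Fin N => gaussianReal 0 1))

theorem lintegral_exp_sum_intensityLaw {N : ℕ} (a : Fin N → ℝ) :
    ∫⁻ ξ, ENNReal.ofReal (Real.exp (∑ i, a i * ξ i)) ∂intensityLaw N =
      ENNReal.ofReal (Real.exp (∑ i, a i ^ 2 / 2)) := by
  have h1 : ∀ ξ : Fin N → ℝ, Real.exp (∑ i, a i * ξ i) = ∏ i, Real.exp (a i * ξ i) := fun ξ =>
    Real.exp_sum _ _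
  have h2 : Integrable (fun ξ : Fin N → ℝ => ∏ i, Real.exp (a i * ξ i)) (intensityLaw N) :=
    Integrable.fintype_prod (f := fun i x => Real.exp (a i * x)) fun i =>
      integrable_exp_mul_gaussianReal (a i)
  simp only [h1]
  rw [← ofReal_integral_eq_lintegral_ofReal h2
    (Eventually.of_forall fun ξ => Finset.prod_nonneg fun i _ => (Real.exp_pos _).le),
    intensityLaw, integral_fintype_prod_eq_prod (fun i x => Real.exp (a i * x)), Real.exp_sum]
  congr 1
  refine Finset.prod_congr rfl fun i _ => ?_
  have := congrFun (mgf_id_gaussianReal (μ := 0) (v := 1)) (a i)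
  simpa [mgf] using this

theorem integrable_pow_four_gaussian : Integrable (fun x : ℝ => x ^ 4) (gaussianReal 0 1) := by
  have := (memLp_id_gaussianReal (μ := 0) (v := 1) 4).integrable_norm_pow (by norm_num)
  refine this.congr (Eventually.of_forall fun x => ?_)
  simp only [id, Real.norm_eq_abs]
  exact Even.pow_abs (by decide) x

theorem integrable_coord_pow_four {N : ℕ} (i : Fin N) :
    Integrable (fun ξ : Fin N → ℝ => ξ i ^ 4) (intensityLaw N) :=
  (measurePreserving_eval (fun _ : Fin N => gaussianReal 0 1) i).integrable_comp_of_integrable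
    integrable_pow_four_gaussian

theorem integral_coord_pow_four {N : ℕ} (i : Fin N) :
    ∫ ξ, ξ i ^ 4 ∂intensityLaw N = ∫ x, x ^ 4 ∂gaussianReal 0 1 := by
  have h := measurePreserving_eval (fun _ : Fin N => gaussianReal 0 1) i
  rw [← h.map_eq, integral_map h.measurable.aemeasurable
    (by fun_prop : Continuous fun x : ℝ => x ^ 4).aestronglyMeasurable]
  rfl

theorem abs_mul_four_le (a b c d : ℝ) :
    |a * b * (c * d)| ≤ (a ^ 4 + b ^ 4 + c ^ 4 + d ^ 4) / 4 := by
  rw [abs_le]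
  constructor <;>
  nlinarith [sq_nonneg (a * b + c * d), sq_nonneg (a * b - c * d), sq_nonneg (a ^ 2 - b ^ 2),
    sq_nonneg (c ^ 2 - d ^ 2)]

theorem integrable_coord_mul_four {N : ℕ} (i j k l : Fin N) :
    Integrable (fun ξ : Fin N → ℝ => ξ i * ξ j * (ξ k * ξ l)) (intensityLaw N) := by
  refine Integrable.mono' ((((integrable_coord_pow_four i).add (integrable_coord_pow_four j)).add
    (integrable_coord_pow_four k)).add (integrable_coord_pow_four l)|>.div_const 4)
    (by fun_prop : Continuous fun ξ : Fin N → ℝ => ξ i * ξ j * (ξ k * ξ l)).aestronglyMeasurable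
    (Eventually.of_forall fun ξ => ?_)
  exact abs_mul_four_le _ _ _ _

theorem abs_integral_coord_mul_four_le {N : ℕ} (i j k l : Fin N) :
    |∫ ξ, ξ i * ξ j * (ξ k * ξ l) ∂intensityLaw N| ≤ ∫ x, x ^ 4 ∂gaussianReal 0 1 := by
  have hi := fun m => integrable_coord_pow_four (N := N) m
  calc _ ≤ ∫ ξ, |ξ i * ξ j * (ξ k * ξ l)| ∂intensityLaw N := abs_integral_le_integral_abs
    _ ≤ ∫ ξ, (ξ i ^ 4 + ξ j ^ 4 + ξ k ^ 4 + ξ l ^ 4) / 4 ∂intensityLaw N :=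
        integral_mono (integrable_coord_mul_four i j k l).abs
          ((((hi i).add (hi j)).add (hi k)).add (hi l)|>.div_const 4)
          fun ξ => abs_mul_four_le _ _ _ _
    _ = _ := by
        have h2 : Integrable (fun ξ : Fin N → ℝ => ξ i ^ 4 + ξ j ^ 4) (intensityLaw N) :=
          (hi i).add (hi j)
        have h3 : Integrable (fun ξ : Fin N → ℝ => ξ i ^ 4 + ξ j ^ 4 + ξ k ^ 4)
          (intensityLaw N) := h2.add (hi k)
        rw [integral_div, integral_add h3 (hi l), integral_add h2 (hi k),
          integral_add (hi i) (hi j)]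
        simp only [integral_coord_pow_four]
        ring

/-- Changing the sign of the coordinate `i` preserves the Gaussian law and reverses the sign of the
integrand. -/
theorem integral_coord_mul_eq_zero {N : ℕ} (i : Fin N) {R : (Fin N → ℝ) → ℝ}
    (hR : ∀ ξ ξ' : Fin N → ℝ, (∀ m, m ≠ i → ξ m = ξ' m) → R ξ = R ξ') :
    ∫ ξ, ξ i * R ξ ∂intensityLaw N = 0 := by
  have hneg : MeasurePreserving (fun x : ℝ => -x) (gaussianReal 0 1) (gaussianReal 0 1) :=
    ⟨measurable_neg, by rw [gaussianReal_map_neg, neg_zero]⟩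
  let e : (Fin N → ℝ) ≃ᵐ (Fin N → ℝ) := MeasurableEquiv.piCongrRight fun m =>
    if m = i then MeasurableEquiv.neg ℝ else MeasurableEquiv.refl ℝ
  have he : ∀ ξ m, e ξ m = if m = i then -ξ m else ξ m := fun ξ m => by
    change (if m = i then MeasurableEquiv.neg ℝ else MeasurableEquiv.refl ℝ) (ξ m) = _
    split_ifs <;> rfl
  have hpres : MeasurePreserving e (intensityLaw N) (intensityLaw N) :=
    measurePreserving_pi (fun _ : Fin N => gaussianReal 0 1) (fun _ => gaussianReal 0 1)
      (f := fun m => (if m = i then MeasurableEquiv.neg ℝ else MeasurableEquiv.refl ℝ : ℝ ≃ᵐ ℝ))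
      fun m => by
        split_ifs
        · exact hneg
        · exact MeasurePreserving.id _
  have h1 := hpres.integral_comp e.measurableEmbedding fun ξ => ξ i * R ξ
  have h2 : ∀ ξ, e ξ i * R (e ξ) = -(ξ i * R ξ) := fun ξ => by
    rw [hR (e ξ) ξ fun m hm => by rw [he, if_neg hm], he, if_pos rfl, neg_mul]
  simp only [h2, integral_neg] at h1
  linarith

/-- Unless `{k, l} = {i, j}`, one of `i` and `j` occurs only once among the four indices, and the
sign change in that coordinate applies. -/
theorem integral_coord_mul_four_eq_zero {N : ℕ} {i j k l : Fin N} (hij : i ≠ j) (hkl : k ≠ l)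
    (h1 : ¬(k = i ∧ l = j)) (h2 : ¬(k = j ∧ l = i)) :
    ∫ ξ, ξ i * ξ j * (ξ k * ξ l) ∂intensityLaw N = 0 := by
  by_cases hi : i ≠ k ∧ i ≠ l
  · have := integral_coord_mul_eq_zero i (R := fun ξ => ξ j * (ξ k * ξ l)) fun ξ ξ' h => by
      simp only [h j hij.symm, h k hi.1.symm, h l hi.2.symm]
    simpa only [mul_assoc] using this
  · have hj : j ≠ k ∧ j ≠ l := by
      constructor
      · rintro rfl
        rcases not_and_or.1 hi with h | h
        · exact hij (not_not.1 h)
        · exact h2 ⟨rfl, (not_not.1 h).symm⟩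
      · rintro rfl
        rcases not_and_or.1 hi with h | h
        · exact h1 ⟨(not_not.1 h).symm, rfl⟩
        · exact hij (not_not.1 h)
    have := integral_coord_mul_eq_zero j (R := fun ξ => ξ i * (ξ k * ξ l)) fun ξ ξ' h => by
      simp only [h i hij, h k hj.1.symm, h l hj.2.symm]
    simpa only [mul_assoc, mul_left_comm] using this

/-- Expand the square. As there is no diagonal, only the pairings `(k, l) = (i, j)` and `(k, l) =
(j, i)` survive, whence the factor `2`; each contributes at most the fourth moment times `h i j ^
2`. -/
theorem lintegral_quadratic_sq_le {N : ℕ} {h : Fin N → Fin N → ℝ} (hsymm : ∀ i j, h i j = h j i)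
    (hdiag : ∀ i, h i i = 0) :
    ∫⁻ ξ, ENNReal.ofReal ((∑ i, ∑ j, ξ i * ξ j * h i j) ^ 2) ∂intensityLaw N ≤
      ENNReal.ofReal (2 * (∫ x, x ^ 4 ∂gaussianReal 0 1) * ∑ i, ∑ j, h i j ^ 2) := by
  set m4 := ∫ x, x ^ 4 ∂gaussianReal 0 1 with hm4
  have hm0 : 0 ≤ m4 := integral_nonneg fun x => by positivity
  have e1 : ∀ ξ : Fin N → ℝ, (∑ i, ∑ j, ξ i * ξ j * h i j) ^ 2 =
      ∑ i, ∑ j, ∑ k, ∑ l, h i j * h k l * (ξ i * ξ j * (ξ k * ξ l)) := fun ξ => by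
    rw [sq, Finset.sum_mul]
    refine Finset.sum_congr rfl fun i _ => ?_
    rw [Finset.sum_mul]
    refine Finset.sum_congr rfl fun j _ => ?_
    rw [Finset.mul_sum]
    refine Finset.sum_congr rfl fun k _ => ?_
    rw [Finset.mul_sum]
    refine Finset.sum_congr rfl fun l _ => ?_
    ring
  have hint : ∀ i j k l, Integrable (fun ξ : Fin N → ℝ =>
      h i j * h k l * (ξ i * ξ j * (ξ k * ξ l))) (intensityLaw N) := fun i j k l =>
    (integrable_coord_mul_four i j k l).const_mul _
  have hint2 : ∀ i j k, Integrable (fun ξ : Fin N → ℝ =>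
      ∑ l, h i j * h k l * (ξ i * ξ j * (ξ k * ξ l))) (intensityLaw N) := fun i j k =>
    integrable_finsetSum _ fun l _ => hint i j k l
  have hint3 : ∀ i j, Integrable (fun ξ : Fin N → ℝ =>
      ∑ k, ∑ l, h i j * h k l * (ξ i * ξ j * (ξ k * ξ l))) (intensityLaw N) := fun i j =>
    integrable_finsetSum _ fun k _ => hint2 i j k
  have hint4 : ∀ i, Integrable (fun ξ : Fin N → ℝ =>
      ∑ j, ∑ k, ∑ l, h i j * h k l * (ξ i * ξ j * (ξ k * ξ l))) (intensityLaw N) := fun i =>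
    integrable_finsetSum _ fun j _ => hint3 i j
  have hint5 : Integrable (fun ξ : Fin N → ℝ =>
      ∑ i, ∑ j, ∑ k, ∑ l, h i j * h k l * (ξ i * ξ j * (ξ k * ξ l))) (intensityLaw N) :=
    integrable_finsetSum _ fun i _ => hint4 i
  have hterm : ∀ i j k l, h i j * h k l * ∫ ξ, ξ i * ξ j * (ξ k * ξ l) ∂intensityLaw N ≤
      m4 * h i j ^ 2 * ((if k = i then (if l = j then 1 else 0) else 0) +
        (if k = j then (if l = i then 1 else 0) else 0)) := by
    intro i j k l
    have hb := (abs_le.1 (abs_integral_coord_mul_four_le i j k l)).2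
    have hnn : 0 ≤ m4 * h i j ^ 2 * ((if k = i then (if l = j then (1 : ℝ) else 0) else 0) +
        (if k = j then (if l = i then 1 else 0) else 0)) := by
      refine mul_nonneg (by positivity) (add_nonneg ?_ ?_) <;> split_ifs <;> norm_num
    rcases eq_or_ne i j with rfl | hij
    · simp [hdiag]
    rcases eq_or_ne k l with rfl | hkl
    · rw [hdiag k, mul_zero, zero_mul]; exact hnn
    by_cases h1 : k = i ∧ l = j
    · obtain ⟨rfl, rfl⟩ := h1
      rw [if_pos rfl, if_pos rfl, if_neg hij]
      nlinarith [mul_le_mul_of_nonneg_left hb (sq_nonneg (h k l))]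
    by_cases h2 : k = j ∧ l = i
    · obtain ⟨rfl, rfl⟩ := h2
      rw [if_neg hkl, if_pos rfl, if_pos rfl, hsymm k l]
      nlinarith [mul_le_mul_of_nonneg_left hb (sq_nonneg (h l k))]
    rw [integral_coord_mul_four_eq_zero hij hkl h1 h2, mul_zero]
    exact hnn
  simp only [e1]
  rw [← ofReal_integral_eq_lintegral_ofReal hint5
    (Eventually.of_forall fun ξ => by dsimp only; rw [← e1]; positivity)]
  refine ENNReal.ofReal_le_ofReal ?_
  rw [integral_finsetSum _ fun i _ => hint4 i]
  simp only [integral_finsetSum _ fun j _ => hint3 _ j, integral_finsetSum _ fun k _ => hint2 _ _ k,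
    integral_finsetSum _ fun l _ => hint _ _ _ l, integral_const_mul]
  calc _ ≤ ∑ i, ∑ j, ∑ k, ∑ l, m4 * h i j ^ 2 * ((if k = i then (if l = j then (1 : ℝ) else 0) else 0) +
        (if k = j then (if l = i then 1 else 0) else 0)) :=
        Finset.sum_le_sum fun i _ => Finset.sum_le_sum fun j _ => Finset.sum_le_sum fun k _ =>
          Finset.sum_le_sum fun l _ => hterm i j k l
    _ = ∑ i, ∑ j, m4 * h i j ^ 2 * 2 := by
        refine Finset.sum_congr rfl fun i _ => Finset.sum_congr rfl fun j _ => ?_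
        simp only [← Finset.mul_sum]
        congr 1
        have : ∀ a b : Fin N, ∑ k : Fin N, ∑ l : Fin N,
            (if k = a then (if l = b then (1 : ℝ) else 0) else 0) = 1 := fun a b => by
          rw [Finset.sum_eq_single a (fun k _ hk => by simp [hk]) (by simp)]
          simp
        simp only [Finset.sum_add_distrib, this]
        norm_num
    _ = _ := by
        simp only [← Finset.sum_mul, ← Finset.mul_sum]
        ring

/-! ### The dynamics of the Fourier modes -/

/-- The linear form `v ↦ n · v`. -/
def waveDot (n : Fin 2 → ℤ) : Plane →L[ℝ] ℝ := ∑ a, (n a : ℝ) • EuclideanSpace.proj a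

theorem waveDot_apply (n : Fin 2 → ℤ) (v : Plane) : waveDot n v = ∑ a, (n a : ℝ) * v a := by
  simp [waveDot]

theorem abs_waveDot_le (n : Fin 2 → ℤ) (v : Plane) :
    |waveDot n v| ≤ √(2 * bracketSq n) * ‖v‖ := by
  have h1 : |(n 0 : ℝ)| + |(n 1 : ℝ)| ≤ √(2 * bracketSq n) := by
    refine Real.le_sqrt_of_sq_le ?_
    have : bracketSq n = 1 + ((n 0 : ℝ) ^ 2 + (n 1 : ℝ) ^ 2) := by
      simp [bracketSq, Fin.sum_univ_two]
    rw [this, ← sq_abs (n 0 : ℝ), ← sq_abs (n 1 : ℝ)]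
    nlinarith [sq_nonneg (|(n 0 : ℝ)| - |(n 1 : ℝ)|)]
  rw [waveDot_apply, Fin.sum_univ_two]
  calc |(n 0 : ℝ) * v 0 + n 1 * v 1| ≤ |(n 0 : ℝ)| * |v 0| + |(n 1 : ℝ)| * |v 1| := by
        rw [← abs_mul, ← abs_mul]; exact abs_add_le _ _
    _ ≤ |(n 0 : ℝ)| * ‖v‖ + |(n 1 : ℝ)| * ‖v‖ := by
        gcongr <;> exact abs_apply_le_norm _ _
    _ = (|(n 0 : ℝ)| + |(n 1 : ℝ)|) * ‖v‖ := by ring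
    _ ≤ _ := by gcongr

theorem mFourier_toTorus (n : Fin 2 → ℤ) (z : Plane) :
    UnitAddTorus.mFourier n (toTorus z) =
      Complex.exp (Complex.I * ((2 * Real.pi * waveDot n z : ℝ) : ℂ)) := by
  simp only [UnitAddTorus.mFourier, toTorus, ContinuousMap.coe_mk, fourier_coe_apply,
    waveDot_apply, ← Complex.exp_sum, Fin.sum_univ_two]
  congr 1
  push_cast
  ring

theorem norm_mFourier_sub_le (n : Fin 2 → ℤ) (x y : Torus) :
    ‖UnitAddTorus.mFourier n x - UnitAddTorus.mFourier n y‖ ≤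
      4 * Real.pi * √(2 * bracketSq n) * ‖x - y‖ := by
  obtain ⟨z, hz, -, -, hzn⟩ := exists_rep (x - y)
  have h1 : UnitAddTorus.mFourier n x - UnitAddTorus.mFourier n y =
      UnitAddTorus.mFourier n y * (UnitAddTorus.mFourier n (toTorus z) - 1) := by
    rw [mul_sub, mul_one, ← mFourier_add_apply, hz, add_sub_cancel]
  rw [h1, norm_mul, norm_mFourier_apply, one_mul, mFourier_toTorus]
  refine (Real.norm_exp_I_mul_ofReal_sub_one_le).trans ?_
  rw [Real.norm_eq_abs, abs_mul, abs_of_pos Real.two_pi_pos]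
  have h2 := abs_waveDot_le n z
  calc 2 * Real.pi * |waveDot n z| ≤ 2 * Real.pi * (√(2 * bracketSq n) * (2 * ‖x - y‖)) := by
        gcongr
        exact h2.trans (by gcongr)
    _ = _ := by ring

/-- The real part of `u e_n(x)`. -/
def wave (u : ℂ) (n : Fin 2 → ℤ) (x : Torus) : ℝ := (u * UnitAddTorus.mFourier n x).re

/-- The derivative of `wave` in terms of `n · v`. -/
def waveSlope (u : ℂ) (n : Fin 2 → ℤ) (x : Torus) : ℝ :=
  2 * Real.pi * (u * Complex.I * UnitAddTorus.mFourier n x).re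

theorem continuous_wave (u : ℂ) (n : Fin 2 → ℤ) : Continuous (wave u n) := by
  unfold wave
  fun_prop

theorem continuous_waveSlope (u : ℂ) (n : Fin 2 → ℤ) : Continuous (waveSlope u n) := by
  unfold waveSlope
  fun_prop

theorem abs_wave_le {u : ℂ} (hu : ‖u‖ ≤ 1) (n : Fin 2 → ℤ) (x : Torus) : |wave u n x| ≤ 1 := by
  refine (Complex.abs_re_le_norm _).trans ?_
  rwa [norm_mul, norm_mFourier_apply, mul_one]

theorem abs_waveSlope_sub_le {u : ℂ} (hu : ‖u‖ ≤ 1) (n : Fin 2 → ℤ) (x y : Torus) :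
    |waveSlope u n x - waveSlope u n y| ≤
      8 * Real.pi ^ 2 * √(2 * bracketSq n) * ‖x - y‖ := by
  unfold waveSlope
  rw [← mul_sub, ← Complex.sub_re, ← mul_sub, abs_mul, abs_of_pos Real.two_pi_pos]
  have h1 : |(u * Complex.I * (UnitAddTorus.mFourier n x - UnitAddTorus.mFourier n y)).re| ≤
      1 * (4 * Real.pi * √(2 * bracketSq n) * ‖x - y‖) := by
    refine (Complex.abs_re_le_norm _).trans ?_
    rw [norm_mul, norm_mul, Complex.norm_I, mul_one]
    exact mul_le_mul hu (norm_mFourier_sub_le n x y) (norm_nonneg _) zero_le_one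
  calc _ ≤ 2 * Real.pi * (1 * (4 * Real.pi * √(2 * bracketSq n) * ‖x - y‖)) := by gcongr
    _ = _ := by ring

theorem hasDerivAt_wave (u : ℂ) (n : Fin 2 → ℤ) {z : ℝ → Plane} {v : Plane} {t : ℝ}
    (hz : HasDerivAt z v t) : HasDerivAt (fun s => wave u n (toTorus (z s)))
      (waveDot n v * waveSlope u n (toTorus (z t))) t := by
  simp only [wave, waveSlope, mFourier_toTorus]
  have h1 : HasDerivAt (fun s => ((2 * Real.pi * waveDot n (z s) : ℝ) : ℂ))
      ((2 * Real.pi * waveDot n v : ℝ) : ℂ) t :=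
    (((waveDot n).hasFDerivAt.comp_hasDerivAt t hz).const_mul (2 * Real.pi)).ofReal_comp
  have h2 := ((h1.const_mul Complex.I).cexp.const_mul u)
  have h3 := Complex.reCLM.hasFDerivAt.comp_hasDerivAt t h2
  refine h3.congr_deriv ?_
  have e : u * (Complex.exp (Complex.I * ((2 * Real.pi * waveDot n (z t) : ℝ) : ℂ)) *
      (Complex.I * ((2 * Real.pi * waveDot n v : ℝ) : ℂ))) =
      ((2 * Real.pi * waveDot n v : ℝ) : ℂ) * (u * Complex.I *
        Complex.exp (Complex.I * ((2 * Real.pi * waveDot n (z t) : ℝ) : ℂ))) := by ring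
  rw [Complex.reCLM_apply, e, Complex.re_ofReal_mul]
  ring

/-- The real part of `u` times the mode `n` of the point vortex field. -/
def modeTest {N : ℕ} (u : ℂ) (n : Fin 2 → ℤ) (p : Param N) : ℝ :=
  (√(N : ℝ))⁻¹ * ∑ i, p.1 i * wave u n (p.2 i)

theorem modeTest_eq {N : ℕ} (u : ℂ) (n : Fin 2 → ℤ) (p : Param N) :
    modeTest u n p = (u * modeSum n p).re := by
  have : u * modeSum n p = (((√(N : ℝ))⁻¹ : ℝ) : ℂ) *
      ∑ i, ((p.1 i : ℝ) : ℂ) * (u * UnitAddTorus.mFourier n (p.2 i)) := by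
    rw [modeSum, mul_left_comm, Finset.mul_sum]
    congr 1
    exact Finset.sum_congr rfl fun i _ => by ring
  rw [this, Complex.re_ofReal_mul, Complex.re_sum, modeTest]
  simp only [Complex.re_ofReal_mul, wave]

theorem continuous_modeTest {N : ℕ} (u : ℂ) (n : Fin 2 → ℤ) :
    Continuous (modeTest (N := N) u n) := by
  unfold modeTest
  have : ∀ i : Fin N, Continuous fun p : Param N => wave u n (p.2 i) := fun i =>
    (continuous_wave u n).comp ((continuous_apply i).comp continuous_snd)
  fun_prop

/-- The pair interaction in the equation of a Fourier mode. -/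
def modeKernel (k : Torus → Plane) (u : ℂ) (n : Fin 2 → ℤ) (x y : Torus) : ℝ :=
  waveDot n (k (x - y)) * (waveSlope u n x - waveSlope u n y) / 2

/-- The time derivative of `modeTest`. -/
def modeDrift {N : ℕ} (k : Torus → Plane) (u : ℂ) (n : Fin 2 → ℤ) (p : Param N) : ℝ :=
  ∑ i, ∑ j, p.1 i * p.1 j * ((N : ℝ)⁻¹ * modeKernel k u n (p.2 i) (p.2 j))

section ModeDynamics

variable {k : Torus → Plane} {k' : Torus → Plane →L[ℝ] Plane} {N : ℕ}

theorem IsRegularKernel.modeKernel_symm (h : IsRegularKernel k k') (u : ℂ) (n : Fin 2 → ℤ)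
    (x y : Torus) : modeKernel k u n x y = modeKernel k u n y x := by
  unfold modeKernel
  rw [← neg_sub y x, h.odd, map_neg]
  ring

theorem modeKernel_self (k : Torus → Plane) (u : ℂ) (n : Fin 2 → ℤ) (x : Torus) :
    modeKernel k u n x x = 0 := by
  simp [modeKernel]

theorem IsRegularKernel.continuous_modeDrift (h : IsRegularKernel k k') (u : ℂ) (n : Fin 2 → ℤ) :
    Continuous (modeDrift (N := N) k u n) := by
  unfold modeDrift modeKernel
  have h1 : ∀ i : Fin N, Continuous fun p : Param N => waveSlope u n (p.2 i) := fun i =>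
    (continuous_waveSlope u n).comp ((continuous_apply i).comp continuous_snd)
  have h2 : ∀ i j : Fin N, Continuous fun p : Param N => waveDot n (k (p.2 i - p.2 j)) :=
    fun i j => (waveDot n).continuous.comp (h.continuous.comp
      (((continuous_apply i).comp continuous_snd).sub ((continuous_apply j).comp continuous_snd)))
  fun_prop

/-- Exchanging `i` and `j` reverses the sign of the odd kernel, so the double sum equals its
symmetrised half-sum. There the singularity of `k` is multiplied by a difference of slopes. -/
theorem IsRegularKernel.hasDerivAt_modeTest (h : IsRegularKernel k k') (u : ℂ) (n : Fin 2 → ℤ)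
    (ξ : Fin N → ℝ) (y : LiftConfig N) (t : ℝ) :
    HasDerivAt (fun s => modeTest u n (ξ, toConfig N (liftFlow k ξ y s)))
      (modeDrift k u n (ξ, toConfig N (liftFlow k ξ y t))) t := by
  set x := toConfig N (liftFlow k ξ y t) with hx
  have h1 : ∀ i, HasDerivAt (fun s => wave u n (toTorus (liftFlow k ξ y s i)))
      (waveDot n (drift k ξ x i) * waveSlope u n (x i)) t := fun i =>
    hasDerivAt_wave u n (hasDerivAt_pi.1 (h.hasDerivAt_liftFlow ξ y t) i)
  have h2 := (HasDerivAt.fun_sum (u := Finset.univ) fun i _ => (h1 i).const_mul (ξ i)).const_mul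
    (√(N : ℝ))⁻¹
  refine h2.congr_deriv ?_
  have hN : (√(N : ℝ))⁻¹ * (√(N : ℝ))⁻¹ = (N : ℝ)⁻¹ := by
    rw [← mul_inv, Real.mul_self_sqrt (Nat.cast_nonneg _)]
  have h3 : (√(N : ℝ))⁻¹ * ∑ i, ξ i * (waveDot n (drift k ξ x i) * waveSlope u n (x i)) =
      ∑ i, ∑ j, ξ i * ξ j * ((N : ℝ)⁻¹ * (waveDot n (k (x i - x j)) * waveSlope u n (x i))) := by
    rw [Finset.mul_sum, ← hN]
    refine Finset.sum_congr rfl fun i _ => ?_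
    simp only [drift, map_smul, map_sum, smul_eq_mul, Finset.mul_sum, Finset.sum_mul]
    exact Finset.sum_congr rfl fun j _ => by ring
  have h4 : ∑ i, ∑ j, ξ i * ξ j * ((N : ℝ)⁻¹ * (waveDot n (k (x i - x j)) * waveSlope u n (x i))) =
      ∑ i, ∑ j, ξ i * ξ j *
        ((N : ℝ)⁻¹ * (-waveDot n (k (x i - x j)) * waveSlope u n (x j))) := by
    rw [Finset.sum_comm]
    refine Finset.sum_congr rfl fun i _ => Finset.sum_congr rfl fun j _ => ?_
    rw [← neg_sub (x i) (x j), h.odd, map_neg]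
    ring
  have h5 : modeDrift k u n (ξ, x) = (∑ i, ∑ j, ξ i * ξ j *
      ((N : ℝ)⁻¹ * (waveDot n (k (x i - x j)) * waveSlope u n (x i))) + ∑ i, ∑ j, ξ i * ξ j *
        ((N : ℝ)⁻¹ * (-waveDot n (k (x i - x j)) * waveSlope u n (x j)))) / 2 := by
    simp only [modeDrift, modeKernel, ← Finset.sum_add_distrib, Finset.sum_div]
    exact Finset.sum_congr rfl fun i _ => Finset.sum_congr rfl fun j _ => by ring
  rw [h3, h5, ← h4]
  ring

end ModeDynamics

/-! ### Moments of the Fourier modes -/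

theorem abs_modeKernel_le (k : Torus → Plane) {u : ℂ} (hu : ‖u‖ ≤ 1) (n : Fin 2 → ℤ)
    (x y : Torus) :
    |modeKernel k u n x y| ≤ 8 * Real.pi ^ 2 * bracketSq n * (‖k (x - y)‖ * ‖x - y‖) := by
  have hb := bracketSq_pos n
  have hs : √(2 * bracketSq n) * √(2 * bracketSq n) = 2 * bracketSq n :=
    Real.mul_self_sqrt (by positivity)
  rw [modeKernel, abs_div, abs_mul, abs_two, div_le_iff₀ two_pos]
  calc |waveDot n (k (x - y))| * |waveSlope u n x - waveSlope u n y|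
      ≤ (√(2 * bracketSq n) * ‖k (x - y)‖) *
        (8 * Real.pi ^ 2 * √(2 * bracketSq n) * ‖x - y‖) :=
        mul_le_mul (abs_waveDot_le _ _) (abs_waveSlope_sub_le hu n x y) (abs_nonneg _)
          (by positivity)
    _ = (√(2 * bracketSq n) * √(2 * bracketSq n)) *
        (8 * Real.pi ^ 2 * (‖k (x - y)‖ * ‖x - y‖)) := by ring
    _ = _ := by rw [hs]; ring

/-- The difference of slopes vanishes linearly on the diagonal and lowers the singularity from `2 -
ε` to `1 - ε`. The square has exponent `2 - 2ε`, integrable on the torus precisely because `ε > 0`.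
-/
theorem ofReal_modeKernel_sq_le {k : Torus → Plane} {C : NNReal} {ε : ℝ}
    (hk : ∀ x, ‖k x‖ₑ ≤ C * singWeight (2 - ε) x) {u : ℂ} (hu : ‖u‖ ≤ 1) (n : Fin 2 → ℤ)
    (x y : Torus) : ENNReal.ofReal (modeKernel k u n x y ^ 2) ≤
      ENNReal.ofReal (bracketSq n ^ 2) * ((ENNReal.ofReal (8 * Real.pi ^ 2) * C) ^ 2 *
        singWeight (2 - 2 * ε) (x - y)) := by
  rcases eq_or_ne x y with rfl | hxy
  · simp [modeKernel_self]
  have hv : ‖x - y‖ₑ ≠ 0 := enorm_ne_zero.2 (sub_ne_zero.2 hxy)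
  have h1 : ‖k (x - y)‖ₑ * ‖x - y‖ₑ ≤ C * ‖x - y‖ₑ ^ (-(1 - ε)) := by
    have e : ‖x - y‖ₑ ^ (-(1 - ε)) = singWeight (2 - ε) (x - y) * ‖x - y‖ₑ := by
      have h := ENNReal.rpow_add (-(2 - ε)) 1 hv enorm_ne_top
      rw [ENNReal.rpow_one] at h
      rw [singWeight, ← h]
      congr 1
      ring
    rw [e, ← mul_assoc]
    gcongr
    exact hk _
  have h2 : ENNReal.ofReal |modeKernel k u n x y| ≤
      ENNReal.ofReal (bracketSq n) * (ENNReal.ofReal (8 * Real.pi ^ 2) * C *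
        ‖x - y‖ₑ ^ (-(1 - ε))) := by
    refine (ENNReal.ofReal_le_ofReal (abs_modeKernel_le k hu n x y)).trans ?_
    have hb := bracketSq_pos n
    rw [ENNReal.ofReal_mul (by positivity), ENNReal.ofReal_mul (by positivity),
      ENNReal.ofReal_mul (norm_nonneg _), ofReal_norm, ofReal_norm,
      mul_comm (ENNReal.ofReal (8 * _)), mul_assoc, mul_assoc]
    gcongr
  rw [← sq_abs, ENNReal.ofReal_pow (abs_nonneg _)]
  refine (pow_le_pow_left' h2 2).trans_eq ?_
  have e : (‖x - y‖ₑ ^ (-(1 - ε))) ^ 2 = singWeight (2 - 2 * ε) (x - y) := by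
    rw [← ENNReal.rpow_natCast, ← ENNReal.rpow_mul, singWeight]
    congr 1
    push_cast
    ring
  rw [mul_pow, mul_pow, e, ENNReal.ofReal_pow (bracketSq_pos n).le]

/-- Controls the size of a Fourier mode and of its time derivative. -/
def modeRate {N : ℕ} (k : Torus → Plane) (u : ℂ) (n : Fin 2 → ℤ) (p : Param N) : ENNReal :=
  (ENNReal.ofReal (2 * Real.exp (4 * modeTest u n p)) +
    ENNReal.ofReal (2 * Real.exp (-(4 * modeTest u n p)))) +
    ENNReal.ofReal (modeDrift k u n p ^ 2)

theorem measurable_ofReal_exp_modeTest {N : ℕ} (u : ℂ) (n : Fin 2 → ℤ) (a : ℝ) :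
    Measurable fun p : Param N => ENNReal.ofReal (2 * Real.exp (a * modeTest u n p)) := by
  have := continuous_modeTest (N := N) u n
  exact (by fun_prop : Continuous fun p : Param N => 2 * Real.exp (a * modeTest u n p)).measurable.ennreal_ofReal

/-- For frozen positions `modeTest` is a centred Gaussian variable, a sum of `N` independent terms
of variance at most `1/N`. -/
theorem lintegral_exp_modeTest_le {N : ℕ} {u : ℂ} (hu : ‖u‖ ≤ 1) (n : Fin 2 → ℤ) (a : ℝ) :
    ∫⁻ p : Param N, ENNReal.ofReal (2 * Real.exp (a * modeTest u n p)) ∂paramLaw N ≤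
      ENNReal.ofReal (2 * Real.exp (a ^ 2 / 2)) := by
  have h0 : paramLaw N = (intensityLaw N).prod volume := rfl
  have h1 : ∀ x : Config N, ∫⁻ ξ : Fin N → ℝ,
      ENNReal.ofReal (2 * Real.exp (a * modeTest u n (ξ, x))) ∂intensityLaw N ≤
        ENNReal.ofReal (2 * Real.exp (a ^ 2 / 2)) := fun x => by
    have e : ∀ ξ : Fin N → ℝ, ENNReal.ofReal (2 * Real.exp (a * modeTest u n (ξ, x))) =
        ENNReal.ofReal 2 * ENNReal.ofReal (Real.exp
          (∑ i, (a * (√(N : ℝ))⁻¹ * wave u n (x i)) * ξ i)) := fun ξ => by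
      rw [← ENNReal.ofReal_mul two_pos.le, modeTest, ← mul_assoc, Finset.mul_sum]
      congr 3
      exact Finset.sum_congr rfl fun i _ => by ring
    simp only [e]
    rw [lintegral_const_mul' _ _ ENNReal.ofReal_ne_top, lintegral_exp_sum_intensityLaw,
      ← ENNReal.ofReal_mul two_pos.le]
    refine ENNReal.ofReal_le_ofReal (mul_le_mul_of_nonneg_left (Real.exp_le_exp.2 ?_) two_pos.le)
    have h2 : ∀ i, (a * (√(N : ℝ))⁻¹ * wave u n (x i)) ^ 2 / 2 ≤ (N : ℝ)⁻¹ * (a ^ 2 / 2) :=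
      fun i => by
        have hw : wave u n (x i) ^ 2 ≤ 1 := by
          rw [← sq_abs]
          exact pow_le_one₀ (abs_nonneg _) (abs_wave_le hu n _)
        rw [mul_pow, mul_pow, inv_pow, Real.sq_sqrt (Nat.cast_nonneg _)]
        calc a ^ 2 * (N : ℝ)⁻¹ * wave u n (x i) ^ 2 / 2 ≤ a ^ 2 * (N : ℝ)⁻¹ * 1 / 2 := by gcongr
          _ = _ := by ring
    refine (Finset.sum_le_sum fun i _ => h2 i).trans ?_
    rw [Finset.sum_const, Finset.card_univ, Fintype.card_fin, nsmul_eq_mul, ← mul_assoc]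
    exact mul_le_of_le_one_left (by positivity) mul_inv_le_one
  rw [h0, lintegral_prod_symm _ (measurable_ofReal_exp_modeTest u n a).aemeasurable]
  refine (lintegral_mono h1).trans ?_
  rw [lintegral_const, measure_univ, mul_one]

section ModeMoments

variable {k : Torus → Plane} {k' : Torus → Plane →L[ℝ] Plane} {N : ℕ}

theorem IsRegularKernel.measurable_modeDrift_sq (h : IsRegularKernel k k') (u : ℂ)
    (n : Fin 2 → ℤ) :
    Measurable fun p : Param N => ENNReal.ofReal (modeDrift k u n p ^ 2) :=
  ((h.continuous_modeDrift u n).pow 2).measurable.ennreal_ofReal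

theorem IsRegularKernel.measurable_modeRate (h : IsRegularKernel k k') (u : ℂ)
    (n : Fin 2 → ℤ) : Measurable (modeRate (N := N) k u n) := by
  have h1 := measurable_ofReal_exp_modeTest (N := N) u n 4
  have h2 := measurable_ofReal_exp_modeTest (N := N) u n (-4)
  simp only [neg_mul] at h2
  exact (h1.add h2).add (h.measurable_modeDrift_sq u n)

theorem IsRegularKernel.lintegral_modeDrift_sq_intensityLaw_le (h : IsRegularKernel k k') (u : ℂ)
    (n : Fin 2 → ℤ) (x : Config N) :
    ∫⁻ ξ : Fin N → ℝ, ENNReal.ofReal (modeDrift k u n (ξ, x) ^ 2) ∂intensityLaw N ≤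
      ENNReal.ofReal (2 * ∫ x, x ^ 4 ∂gaussianReal 0 1) *
        ∑ i, ∑ j, ENNReal.ofReal (((N : ℝ)⁻¹) ^ 2) *
          ENNReal.ofReal (modeKernel k u n (x i) (x j) ^ 2) := by
  have hm0 : 0 ≤ 2 * ∫ x, x ^ 4 ∂gaussianReal 0 1 :=
    mul_nonneg two_pos.le (integral_nonneg fun x => by positivity)
  refine (lintegral_quadratic_sq_le (h := fun i j => (N : ℝ)⁻¹ * modeKernel k u n (x i) (x j))
    (fun i j => by rw [h.modeKernel_symm]) fun i => by rw [modeKernel_self, mul_zero]).trans_eq ?_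
  rw [ENNReal.ofReal_mul hm0, ENNReal.ofReal_sum_of_nonneg fun i _ =>
    Finset.sum_nonneg fun j _ => sq_nonneg _]
  congr 1
  refine Finset.sum_congr rfl fun i _ => ?_
  rw [ENNReal.ofReal_sum_of_nonneg fun j _ => sq_nonneg _]
  refine Finset.sum_congr rfl fun j _ => ?_
  rw [mul_pow, ENNReal.ofReal_mul (sq_nonneg _)]

theorem IsRegularKernel.measurable_modeKernel_sq (h : IsRegularKernel k k') (u : ℂ)
    (n : Fin 2 → ℤ) (i j : Fin N) :
    Measurable fun x : Config N => ENNReal.ofReal (modeKernel k u n (x i) (x j) ^ 2) := by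
  have h3 : Continuous fun x : Config N => modeKernel k u n (x i) (x j) := by
    have e1 : ∀ i : Fin N, Continuous fun x : Config N => waveSlope u n (x i) := fun i =>
      (continuous_waveSlope u n).comp (continuous_apply i)
    have e2 : Continuous fun x : Config N => waveDot n (k (x i - x j)) :=
      (waveDot n).continuous.comp (h.continuous.comp
        ((continuous_apply i).sub (continuous_apply j)))
    unfold modeKernel
    fun_prop
  exact (h3.pow 2).measurable.ennreal_ofReal

theorem lintegral_modeKernel_sq_le {C : NNReal} {ε : ℝ}
    (hk : ∀ x, ‖k x‖ₑ ≤ C * singWeight (2 - ε) x) {u : ℂ} (hu : ‖u‖ ≤ 1) (n : Fin 2 → ℤ)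
    (i j : Fin N) :
    ∫⁻ x : Config N, ENNReal.ofReal (modeKernel k u n (x i) (x j) ^ 2) ≤
      ENNReal.ofReal (bracketSq n ^ 2) *
        ((ENNReal.ofReal (8 * Real.pi ^ 2) * C) ^ 2 * ∫⁻ x, singWeight (2 - 2 * ε) x) := by
  rcases eq_or_ne i j with rfl | hij
  · simp [modeKernel_self]
  · have h1 := lintegral_mono (μ := (volume : Measure (Config N))) fun x : Config N =>
      ofReal_modeKernel_sq_le hk hu n (x i) (x j)
    refine h1.trans_eq ?_
    have hw : Measurable fun x : Config N => singWeight (2 - 2 * ε) (x i - x j) :=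
      measurable_singWeight_sub (2 - 2 * ε) i j
    rw [lintegral_const_mul _ (hw.const_mul _), lintegral_const_mul _ hw,
      lintegral_pair hij (measurable_singWeight (2 - 2 * ε))]

/-- For frozen positions the drift is an off-diagonal quadratic form with coefficients of order
`1/N`. The `N²` pairs, each with weight `N⁻²`, give a bound free of `N`. -/
theorem IsRegularKernel.lintegral_modeDrift_sq_le (h : IsRegularKernel k k') {C : NNReal} {ε : ℝ}
    (hk : ∀ x, ‖k x‖ₑ ≤ C * singWeight (2 - ε) x) {u : ℂ} (hu : ‖u‖ ≤ 1) (n : Fin 2 → ℤ) :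
    ∫⁻ p : Param N, ENNReal.ofReal (modeDrift k u n p ^ 2) ∂paramLaw N ≤
      ENNReal.ofReal (2 * ∫ x, x ^ 4 ∂gaussianReal 0 1) * (ENNReal.ofReal (bracketSq n ^ 2) *
        ((ENNReal.ofReal (8 * Real.pi ^ 2) * C) ^ 2 * ∫⁻ x, singWeight (2 - 2 * ε) x)) := by
  have h0 : paramLaw N = (intensityLaw N).prod volume := rfl
  generalize hB : ENNReal.ofReal (bracketSq n ^ 2) *
    ((ENNReal.ofReal (8 * Real.pi ^ 2) * C) ^ 2 * ∫⁻ x, singWeight (2 - 2 * ε) x) = B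
  have hmeas := h.measurable_modeKernel_sq (N := N) u n
  have hmeas' : ∀ i : Fin N, Measurable fun x : Config N =>
      ∑ j, ENNReal.ofReal (((N : ℝ)⁻¹) ^ 2) * ENNReal.ofReal (modeKernel k u n (x i) (x j) ^ 2) :=
    fun i => Finset.measurable_fun_sum _ fun j _ => (hmeas i j).const_mul _
  have h4 : ∀ i : Fin N, ∫⁻ x : Config N, ∑ j, ENNReal.ofReal (((N : ℝ)⁻¹) ^ 2) *
      ENNReal.ofReal (modeKernel k u n (x i) (x j) ^ 2) ≤
        ∑ _j : Fin N, ENNReal.ofReal (((N : ℝ)⁻¹) ^ 2) * B := fun i => by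
    rw [lintegral_finsetSum _ fun j _ => (hmeas i j).const_mul _]
    refine Finset.sum_le_sum fun j _ => ?_
    rw [lintegral_const_mul _ (hmeas i j)]
    exact mul_le_mul_right ((lintegral_modeKernel_sq_le hk hu n i j).trans_eq hB) _
  rw [h0, lintegral_prod_symm _ (h.measurable_modeDrift_sq u n).aemeasurable]
  refine (lintegral_mono fun x => h.lintegral_modeDrift_sq_intensityLaw_le u n x).trans ?_
  rw [lintegral_const_mul' _ _ ENNReal.ofReal_ne_top]
  refine mul_le_mul_right ?_ _
  rw [lintegral_finsetSum _ fun i _ => hmeas' i]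
  refine (Finset.sum_le_sum fun i _ => h4 i).trans ?_
  simp only [Finset.sum_const, Finset.card_univ, Fintype.card_fin, nsmul_eq_mul]
  rw [← mul_assoc, ← mul_assoc, ← ENNReal.ofReal_natCast, ← ENNReal.ofReal_mul (Nat.cast_nonneg _),
    ← ENNReal.ofReal_mul (by positivity)]
  refine mul_le_of_le_one_left' ?_
  rw [ENNReal.ofReal_le_one]
  calc (N : ℝ) * N * ((N : ℝ)⁻¹) ^ 2 = (N * (N : ℝ)⁻¹) ^ 2 := by ring
    _ ≤ 1 := pow_le_one₀ (by positivity) mul_inv_le_one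

end ModeMoments

/-- The moments of the Fourier modes are bounded uniformly in the number of vortices and in the
regularisation of the kernel. -/
theorem exists_lintegral_modeRate_le (C : NNReal) {ε : ℝ} (hε₀ : 0 < ε) (hε₁ : ε < 1) :
    ∃ M : NNReal, ∀ (N : ℕ) {k : Torus → Plane} {k' : Torus → Plane →L[ℝ] Plane},
      IsRegularKernel k k' → (∀ x, ‖k x‖ₑ ≤ C * singWeight (2 - ε) x) →
      ∀ (u : ℂ) (n : Fin 2 → ℤ), ‖u‖ ≤ 1 →
        ∫⁻ p : Param N, modeRate k u n p ∂paramLaw N ≤ M * ENNReal.ofReal (bracketSq n ^ 2) := by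
  -- The exponent is `(±4)² / 2`, from the two Gaussian exponential moments in `modeRate`.
  set E : ENNReal := ENNReal.ofReal (2 * Real.exp 8) with hE
  set I : ENNReal := ENNReal.ofReal (2 * ∫ x, x ^ 4 ∂gaussianReal 0 1) *
    ((ENNReal.ofReal (8 * Real.pi ^ 2) * C) ^ 2 * ∫⁻ x, singWeight (2 - 2 * ε) x) with hI
  have hIt : I ≠ ⊤ := ENNReal.mul_ne_top ENNReal.ofReal_ne_top
    (ENNReal.mul_ne_top (ENNReal.pow_ne_top (ENNReal.mul_ne_top ENNReal.ofReal_ne_top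
      ENNReal.coe_ne_top)) (lintegral_singWeight_lt_top (by linarith) (by linarith)).ne)
  have hM : E + E + I ≠ ⊤ :=
    ENNReal.add_ne_top.2 ⟨ENNReal.add_ne_top.2 ⟨ENNReal.ofReal_ne_top, ENNReal.ofReal_ne_top⟩, hIt⟩
  refine ⟨(E + E + I).toNNReal, fun N k k' h hk u n hu => ?_⟩
  rw [ENNReal.coe_toNNReal hM]
  have h1 := measurable_ofReal_exp_modeTest (N := N) u n 4
  have h2 := measurable_ofReal_exp_modeTest (N := N) u n (-4)
  have e1 := lintegral_exp_modeTest_le (N := N) hu n 4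
  have e2 := lintegral_exp_modeTest_le (N := N) hu n (-4)
  have e3 := h.lintegral_modeDrift_sq_le (N := N) hk hu n
  simp only [neg_mul] at h2 e2
  have e8 : ((-4 : ℝ)) ^ 2 / 2 = 8 := by norm_num
  have e9 : (4 : ℝ) ^ 2 / 2 = 8 := by norm_num
  rw [e9] at e1
  rw [e8] at e2
  have h12 : Measurable fun p : Param N => ENNReal.ofReal (2 * Real.exp (4 * modeTest u n p)) +
      ENNReal.ofReal (2 * Real.exp (-(4 * modeTest u n p))) := h1.add h2
  have hb : 1 ≤ ENNReal.ofReal (bracketSq n ^ 2) := by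
    rw [ENNReal.one_le_ofReal]
    exact one_le_pow₀ (one_le_bracketSq n)
  have hE' : E ≤ E * ENNReal.ofReal (bracketSq n ^ 2) := le_mul_of_one_le_right' hb
  simp only [modeRate]
  rw [lintegral_add_left h12, lintegral_add_left h1, add_mul, add_mul]
  refine add_le_add (add_le_add (e1.trans hE') (e2.trans hE')) (e3.trans_eq ?_)
  rw [hI]
  ring

/-! ### Control of the Fourier modes along the flow -/

/-- Controls a Fourier mode and its modulus of continuity on `[0, T]`. -/
def modeBound {N : ℕ} (k : Torus → Plane) (T : ℝ) (u : ℂ) (n : Fin 2 → ℤ) (p : Param N) :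
    ENNReal :=
  modeRate k u n p + timeIntegral k T (modeRate k u n) p

section ModeControl

variable {k : Torus → Plane} {k' : Torus → Plane →L[ℝ] Plane} {N : ℕ}

theorem IsRegularKernel.measurable_modeBound (h : IsRegularKernel k k') {T : ℝ} (hT : 0 ≤ T)
    (u : ℂ) (n : Fin 2 → ℤ) : Measurable (modeBound (N := N) k T u n) :=
  (h.measurable_modeRate u n).add (h.measurable_timeIntegral hT (h.measurable_modeRate u n))

theorem IsRegularKernel.lintegral_modeBound (h : IsRegularKernel k k') {T : ℝ} (hT : 0 ≤ T)
    (u : ℂ) (n : Fin 2 → ℤ) :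
    ∫⁻ p : Param N, modeBound k T u n p ∂paramLaw N =
      (1 + ENNReal.ofReal T) * ∫⁻ p : Param N, modeRate k u n p ∂paramLaw N := by
  simp only [modeBound]
  rw [lintegral_add_left (h.measurable_modeRate u n),
    h.lintegral_timeIntegral hT (h.measurable_modeRate u n), add_mul, one_mul]

theorem IsRegularKernel.exists_modeTest_eq (h : IsRegularKernel k k') (u : ℂ) (n : Fin 2 → ℤ)
    (p : Param N) : ∃ z D : ℝ → ℝ, (∀ t, HasDerivAt z (D t) t) ∧ Continuous D ∧
      ∀ t, 0 ≤ t → z t = modeTest u n (p.1, vortexFlow k t p) ∧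
        D t = modeDrift k u n (p.1, vortexFlow k t p) := by
  obtain ⟨ξ, x⟩ := p
  obtain ⟨y, rfl⟩ := (isOpenQuotientMap_toConfig N).surjective x
  refine ⟨_, _, fun t => h.hasDerivAt_modeTest u n ξ y t, ?_, fun t ht => ?_⟩
  · have h1 : Continuous (liftFlow k ξ y) :=
      continuous_iff_continuousAt.2 fun t => (h.hasDerivAt_liftFlow ξ y t).continuousAt
    have h2 : Continuous fun t => (ξ, toConfig N (liftFlow k ξ y t)) :=
      continuous_const.prodMk ((isOpenQuotientMap_toConfig N).continuous.comp h1)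
    exact (h.continuous_modeDrift u n).comp h2
  · rw [h.vortexFlow_toConfig ξ y ht]
    exact ⟨rfl, rfl⟩

theorem lintegral_Icc_le_timeIntegral {T s t : ℝ} (hs : 0 ≤ s) (ht : t ≤ T)
    {g : ℝ → ENNReal} {R : Param N → ENNReal} {p : Param N}
    (hg : ∀ r, 0 ≤ r → g r ≤ R (p.1, vortexFlow k r p)) :
    ∫⁻ r in Set.Icc s t, g r ≤ timeIntegral k T R p :=
  (setLIntegral_mono' measurableSet_Icc fun r hr => hg r (hs.trans hr.1)).trans
    (lintegral_mono_set (Set.Icc_subset_Icc hs ht))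

/-- The function `f = e^{2z} + e^{-2z}` is a smooth substitute for `e^{2|z|}` with `|f'| ≤ 2 |z'| f
≤ z'² + f²` and `f² ≤ 2 e^{4z} + 2 e^{-4z}`. So its variation on `[0, T]` is at most the time
integral of `modeRate`, which bounds every time at once by a functional of the initial data. -/
theorem IsRegularKernel.ofReal_exp_modeTest_le (h : IsRegularKernel k k') (u : ℂ)
    (n : Fin 2 → ℤ) (p : Param N) {T t : ℝ} (ht : 0 ≤ t) (htT : t ≤ T) :
    ENNReal.ofReal (Real.exp (2 * |modeTest u n (p.1, vortexFlow k t p)|)) ≤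
      modeBound k T u n p := by
  obtain ⟨z, D, hz, hD, he⟩ := h.exists_modeTest_eq u n p
  set f : ℝ → ℝ := fun t => Real.exp (2 * z t) + Real.exp (-(2 * z t)) with hf
  have hzc : Continuous z := continuous_iff_continuousAt.2 fun t => (hz t).continuousAt
  have hf' : ∀ t, HasDerivAt f
      (Real.exp (2 * z t) * (2 * D t) + Real.exp (-(2 * z t)) * -(2 * D t)) t := fun t =>
    (((hz t).const_mul 2).exp).add (((hz t).const_mul 2).neg.exp)
  have h1 := ofReal_abs_sub_le_lintegral hf' (by fun_prop) ht
  have hsq : ∀ r, f r ^ 2 ≤ 2 * Real.exp (4 * z r) + 2 * Real.exp (-(4 * z r)) := fun r => by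
    have e1 : Real.exp (4 * z r) = Real.exp (2 * z r) ^ 2 := by rw [← Real.exp_nat_mul]; ring_nf
    have e2 : Real.exp (-(4 * z r)) = Real.exp (-(2 * z r)) ^ 2 := by
      rw [← Real.exp_nat_mul]; ring_nf
    rw [e1, e2, hf]
    nlinarith [sq_nonneg (Real.exp (2 * z r) - Real.exp (-(2 * z r)))]
  have h2 : ∀ r, 0 ≤ r →
      ENNReal.ofReal |Real.exp (2 * z r) * (2 * D r) + Real.exp (-(2 * z r)) * -(2 * D r)| ≤
        modeRate k u n (p.1, vortexFlow k r p) := fun r hr => by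
    rw [modeRate, ← (he r hr).1, ← (he r hr).2, ← ENNReal.ofReal_add (by positivity) (by positivity),
      ← ENNReal.ofReal_add (by positivity) (by positivity)]
    refine ENNReal.ofReal_le_ofReal (le_trans ?_ (add_le_add_left (hsq r) _))
    have p1 := Real.exp_pos (2 * z r)
    have p2 := Real.exp_pos (-(2 * z r))
    have e : |Real.exp (2 * z r) * (2 * D r) + Real.exp (-(2 * z r)) * -(2 * D r)| ≤
        2 * |D r| * f r := by
      have : Real.exp (2 * z r) * (2 * D r) + Real.exp (-(2 * z r)) * -(2 * D r) =
        2 * D r * (Real.exp (2 * z r) - Real.exp (-(2 * z r))) := by ring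
      rw [this, abs_mul, abs_mul, abs_two]
      gcongr
      rw [hf, abs_le]
      constructor <;> simp only <;> linarith
    nlinarith [sq_nonneg (|D r| - f r), sq_abs (D r)]
  have h3 : ENNReal.ofReal (f 0) ≤ modeRate k u n p := by
    have e0 := (he 0 le_rfl).1
    rw [h.vortexFlow_zero] at e0
    rw [modeRate]
    change _ ≤ ENNReal.ofReal (2 * Real.exp (4 * modeTest u n (p.1, p.2))) +
      ENNReal.ofReal (2 * Real.exp (-(4 * modeTest u n (p.1, p.2)))) + _
    rw [← e0, ← ENNReal.ofReal_add (by positivity) (by positivity)]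
    refine le_trans (ENNReal.ofReal_le_ofReal (le_trans ?_ (hsq 0))) le_self_add
    have p1 := Real.add_one_le_exp (2 * z 0)
    have p2 := Real.add_one_le_exp (-(2 * z 0))
    -- Since `f 0 ≥ 1`, it is at most its square, which `modeRate` controls.
    have : 2 ≤ f 0 := by simp only [hf]; linarith
    nlinarith
  have h4 : Real.exp (2 * |z t|) ≤ f 0 + |f t - f 0| := by
    have : Real.exp (2 * |z t|) ≤ f t := by
      have p1 := Real.exp_pos (2 * z t)
      have p2 := Real.exp_pos (-(2 * z t))
      rcases abs_cases (z t) with ⟨e, _⟩ | ⟨e, _⟩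
      · rw [e]; simp only [hf]; linarith
      · rw [e, mul_neg]; simp only [hf]; linarith
    linarith [le_abs_self (f t - f 0)]
  rw [← (he t ht).1]
  refine (ENNReal.ofReal_le_ofReal h4).trans (ENNReal.ofReal_add_le.trans ?_)
  exact add_le_add h3 (h1.trans (lintegral_Icc_le_timeIntegral le_rfl htT h2))

/-- Integrate `|D| ≤ l⁻¹ + l D²` over an interval of length `l²`: the square integral of the
derivative in time yields Hölder continuity of exponent `1/2`. -/
theorem IsRegularKernel.ofReal_abs_modeTest_sub_le (h : IsRegularKernel k k') (u : ℂ)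
    (n : Fin 2 → ℤ) (p : Param N) {T s t : ℝ} (hs : 0 ≤ s) (hst : s ≤ t) (htT : t ≤ T) :
    ENNReal.ofReal |modeTest u n (p.1, vortexFlow k t p) -
      modeTest u n (p.1, vortexFlow k s p)| ≤
        ENNReal.ofReal √(t - s) * (1 + modeBound k T u n p) := by
  rcases hst.eq_or_lt with rfl | hst'
  · simp
  obtain ⟨z, D, hz, hD, he⟩ := h.exists_modeTest_eq u n p
  rw [← (he s hs).1, ← (he t (hs.trans hst)).1]
  refine (ofReal_abs_sub_le_lintegral hz hD hst).trans ?_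
  set l := √(t - s) with hl
  have hl0 : 0 < l := Real.sqrt_pos.2 (by linarith)
  have hl2 : l * l = t - s := Real.mul_self_sqrt (by linarith)
  have h1 : ∀ r, ENNReal.ofReal |D r| ≤
      ENNReal.ofReal l⁻¹ + ENNReal.ofReal l * ENNReal.ofReal (D r ^ 2) := fun r => by
    rw [← ENNReal.ofReal_mul hl0.le, ← ENNReal.ofReal_add (by positivity) (by positivity)]
    refine ENNReal.ofReal_le_ofReal ?_
    have e : l⁻¹ + l * D r ^ 2 - |D r| =
        l⁻¹ * ((l * |D r| - 1 / 2) ^ 2 + 3 / 4) := by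
      rw [← sq_abs (D r)]
      field_simp
      ring
    have : 0 ≤ l⁻¹ * ((l * |D r| - 1 / 2) ^ 2 + 3 / 4) := by positivity
    linarith
  have h2 : ∀ r, 0 ≤ r → ENNReal.ofReal (D r ^ 2) ≤
      modeRate k u n (p.1, vortexFlow k r p) := fun r hr => by
    rw [modeRate, ← (he r hr).2]
    exact le_add_self
  calc ∫⁻ r in Set.Icc s t, ENNReal.ofReal |D r|
      ≤ ∫⁻ r in Set.Icc s t, (ENNReal.ofReal l⁻¹ + ENNReal.ofReal l * ENNReal.ofReal (D r ^ 2)) :=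
        lintegral_mono fun r => h1 r
    _ = ENNReal.ofReal l + ENNReal.ofReal l * ∫⁻ r in Set.Icc s t, ENNReal.ofReal (D r ^ 2) := by
        rw [lintegral_add_left measurable_const, lintegral_const, Measure.restrict_apply_univ,
          Real.volume_Icc, ← ENNReal.ofReal_mul (by positivity), ← hl2, inv_mul_cancel_left₀ hl0.ne',
          lintegral_const_mul' _ _ ENNReal.ofReal_ne_top]
    _ ≤ ENNReal.ofReal l + ENNReal.ofReal l * modeBound k T u n p := by
        gcongr
        exact (lintegral_Icc_le_timeIntegral hs htT h2).trans le_add_self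
    _ = _ := by rw [mul_add, mul_one]

/-- Bounds for a path in terms of bounds for its Fourier modes. -/
theorem IsRegularKernel.norm_fourierCoeff_path_le (h : IsRegularKernel k k') {A T : ℝ}
    {n : Fin 2 → ℤ} {p : Param N}
    (h1 : modeBound k T 1 n p ≤ ENNReal.ofReal (Real.exp A * bracketSq n ^ 4))
    (h2 : modeBound k T (-Complex.I) n p ≤ ENNReal.ofReal (Real.exp A * bracketSq n ^ 4)) :
    (∀ t, ‖fourierCoeff (h.path T N p t).toDistribution n‖ ≤ logBound A n) ∧
      ∀ s t, ‖fourierCoeff (h.path T N p t).toDistribution n -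
        fourierCoeff (h.path T N p s).toDistribution n‖ ≤
          2 * (1 + Real.exp A * bracketSq n ^ 4) * √|(t : ℝ) - s| := by
  have hb := bracketSq_pos n
  have hre : ∀ q : Param N, (modeSum n q).re = modeTest 1 n q := fun q => by
    rw [modeTest_eq, one_mul]
  have him : ∀ q : Param N, (modeSum n q).im = modeTest (-Complex.I) n q := fun q => by
    rw [modeTest_eq]; simp
  have hB : 0 < Real.exp A * bracketSq n ^ 4 := by positivity
  constructor
  · intro t
    rw [h.path_apply, fourierCoeff_fieldOf]
    -- Taking logarithms in `e^{2|z|} ≤ e^A (1 + |n|²)⁴` gives half of `logBound` for each of the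
    -- real and imaginary parts.
    have key : ∀ u : ℂ, modeBound k T u n p ≤ ENNReal.ofReal (Real.exp A * bracketSq n ^ 4) →
        |modeTest u n (p.1, vortexFlow k t p)| ≤ (A + 4 * Real.log (bracketSq n)) / 2 :=
      fun u hu => by
        have e := (h.ofReal_exp_modeTest_le u n p t.2.1 t.2.2).trans hu
        rw [ENNReal.ofReal_le_ofReal_iff hB.le, ← Real.le_log_iff_exp_le hB,
          Real.log_mul (Real.exp_pos A).ne' (by positivity), Real.log_exp, Real.log_pow] at e
        push_cast at e
        linarith
    refine (Complex.norm_le_abs_re_add_abs_im _).trans ?_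
    rw [hre, him, logBound]
    linarith [key _ h1, key _ h2]
  · have key : ∀ u : ℂ, modeBound k T u n p ≤ ENNReal.ofReal (Real.exp A * bracketSq n ^ 4) →
        ∀ s t : ℝ, 0 ≤ s → s ≤ t → t ≤ T → |modeTest u n (p.1, vortexFlow k t p) -
          modeTest u n (p.1, vortexFlow k s p)| ≤ (1 + Real.exp A * bracketSq n ^ 4) * √(t - s) :=
      fun u hu s t hs hst ht => by
        have e := h.ofReal_abs_modeTest_sub_le u n p hs hst ht
        rw [← ENNReal.ofReal_le_ofReal_iff (by positivity), mul_comm (1 + _),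
          ENNReal.ofReal_mul (by positivity), ENNReal.ofReal_add zero_le_one hB.le,
          ENNReal.ofReal_one]
        exact e.trans (by gcongr)
    have main : ∀ s t : Set.Icc (0 : ℝ) T, s ≤ t →
        ‖fourierCoeff (h.path T N p t).toDistribution n -
          fourierCoeff (h.path T N p s).toDistribution n‖ ≤
            2 * (1 + Real.exp A * bracketSq n ^ 4) * √((t : ℝ) - s) := fun s t hst => by
      rw [h.path_apply, h.path_apply, fourierCoeff_fieldOf, fourierCoeff_fieldOf]
      refine (Complex.norm_le_abs_re_add_abs_im _).trans ?_
      rw [Complex.sub_re, Complex.sub_im, hre, him, hre, him]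
      linarith [key _ h1 s t s.2.1 hst t.2.2, key _ h2 s t s.2.1 hst t.2.2]
    intro s t
    rcases le_total s t with hst | hst
    · rw [abs_of_nonneg (sub_nonneg.2 (show (s : ℝ) ≤ t from hst))]
      exact main s t hst
    · rw [norm_sub_rev, abs_sub_comm, abs_of_nonneg (sub_nonneg.2 (show (t : ℝ) ≤ s from hst))]
      exact main t s hst

end ModeControl

/-! ### Weak sequential compactness of tight families -/

section Prokhorov

variable {X : Type*}

theorem exists_subseq_tendsto_of_isTight_of_t2 [TopologicalSpace X] [T2Space X]
    [TopologicalSpace.PseudoMetrizableSpace X] [TopologicalSpace.SeparableSpace X]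
    [MeasurableSpace X] [BorelSpace X]
    (μ : ℕ → ProbabilityMeasure X) (hμ : IsTightMeasureSet {ν | ∃ n, ν = (μ n : Measure X)}) :
    ∃ (φ : ℕ → ℕ) (Q : ProbabilityMeasure X), StrictMono φ ∧
      Tendsto (fun k => μ (φ k)) atTop (𝓝 Q) := by
  have hc : IsCompact (closure (Set.range μ)) := by
    refine isCompact_closure_of_isTightMeasureSet (hμ.subset ?_)
    rintro _ ⟨_, ⟨n, rfl⟩, rfl⟩
    exact ⟨n, rfl⟩
  obtain ⟨Q, -, φ, hφ, h⟩ := hc.isSeqCompact (x := μ) fun n => subset_closure ⟨n, rfl⟩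
  exact ⟨φ, Q, hφ, h⟩

/-- Pass to the Hausdorff quotient. Since the quotient map induces the topology, any section of it
is continuous and carries the limit back; continuous functions do not distinguish inseparable
points, so no integral changes. -/
theorem exists_subseq_tendsto_integral_of_separable [PseudoMetricSpace X]
    [TopologicalSpace.SeparableSpace X] [MeasurableSpace X] [BorelSpace X]
    (μ : ℕ → Measure X) [∀ n, IsProbabilityMeasure (μ n)]
    (hμ : IsTightMeasureSet {ν | ∃ n, ν = μ n}) :
    ∃ (φ : ℕ → ℕ) (Q : Measure X), StrictMono φ ∧ IsProbabilityMeasure Q ∧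
      ∀ f : BoundedContinuousFunction X ℝ,
        Tendsto (fun k => ∫ x, f x ∂μ (φ k)) atTop (𝓝 (∫ x, f x ∂Q)) := by
  let _ : MeasurableSpace (SeparationQuotient X) := borel _
  have _ : BorelSpace (SeparationQuotient X) := ⟨rfl⟩
  set π : X → SeparationQuotient X := SeparationQuotient.mk with hπ
  have hπc : Continuous π := SeparationQuotient.continuous_mk
  set s : SeparationQuotient X → X := Function.surjInv SeparationQuotient.surjective_mk with hs
  have hπs : ∀ y, π (s y) = y := Function.surjInv_eq _
  have hsc : Continuous s := by
    rw [SeparationQuotient.isInducing_mk.continuous_iff]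
    exact continuous_id.congr fun y => (hπs y).symm
  have hsep : TopologicalSpace.SeparableSpace (SeparationQuotient X) :=
    (SeparationQuotient.surjective_mk.denseRange).separableSpace hπc
  have hp : ∀ n, IsProbabilityMeasure ((μ n).map π) := fun n =>
    Measure.isProbabilityMeasure_map hπc.measurable.aemeasurable
  obtain ⟨φ, Q, hφ, h⟩ := exists_subseq_tendsto_of_isTight_of_t2
    (fun n => (⟨(μ n).map π, hp n⟩ : ProbabilityMeasure (SeparationQuotient X)))
    ((hμ.map hπc).subset (by rintro _ ⟨n, rfl⟩; exact ⟨μ n, ⟨n, rfl⟩, rfl⟩))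
  refine ⟨φ, (Q : Measure _).map s, hφ,
    Measure.isProbabilityMeasure_map hsc.measurable.aemeasurable, fun f => ?_⟩
  have h1 := ProbabilityMeasure.tendsto_iff_forall_integral_tendsto.1 h
    (f.compContinuous ⟨s, hsc⟩)
  have e1 : ∫ x, f x ∂(Q : Measure _).map s = ∫ y, f (s y) ∂(Q : Measure _) :=
    integral_map hsc.measurable.aemeasurable f.continuous.aestronglyMeasurable
  have e2 : ∀ n, ∫ y, f (s y) ∂(μ n).map π = ∫ x, f x ∂μ n := fun n => by
    have hfs : AEStronglyMeasurable (fun y => f (s y)) ((μ n).map π) :=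
      (f.continuous.comp hsc).measurable.aestronglyMeasurable
    rw [integral_map hπc.measurable.aemeasurable hfs]
    refine integral_congr_ae (Eventually.of_forall fun x => ?_)
    exact ((SeparationQuotient.mk_eq_mk.1 (hπs (π x))).map f.continuous).eq
  rw [e1]
  refine h1.congr fun k => ?_
  exact e2 (φ k)

/-- **Prokhorov's theorem**: a tight sequence of probability measures on a pseudometric space has a
weakly convergent subsequence. -/
theorem exists_subseq_tendsto_integral [PseudoMetricSpace X] [MeasurableSpace X] [BorelSpace X]
    (μ : ℕ → Measure X) [∀ n, IsProbabilityMeasure (μ n)]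
    (hμ : IsTightMeasureSet {ν | ∃ n, ν = μ n}) :
    ∃ (φ : ℕ → ℕ) (Q : Measure X), StrictMono φ ∧ IsProbabilityMeasure Q ∧
      ∀ f : BoundedContinuousFunction X ℝ,
        Tendsto (fun k => ∫ x, f x ∂μ (φ k)) atTop (𝓝 (∫ x, f x ∂Q)) := by
  have ht := isTightMeasureSet_iff_exists_isCompact_measure_compl_le.1 hμ
  have hpos : ∀ j : ℕ, (0 : ENNReal) < ((j : ENNReal) + 1)⁻¹ := fun j => by simp
  choose K hK hKμ using fun j : ℕ => ht _ (hpos j)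
  have hsep : TopologicalSpace.IsSeparable (⋃ j, K j) :=
    TopologicalSpace.IsSeparable.iUnion fun j => (hK j).isSeparable
  -- Countably many compact sets carry all the measures, and the closure of their union is a
  -- separable set of full measure. This removes the separability assumption.
  set Z : Set X := closure (⋃ j, K j) with hZ
  have hZm : MeasurableSet Z := isClosed_closure.measurableSet
  have _ : TopologicalSpace.SeparableSpace Z := hsep.closure.separableSpace
  have hZ0 : ∀ n, μ n Zᶜ = 0 := fun n => by
    refine le_antisymm (ENNReal.le_of_forall_pos_le_add fun η hη _ => ?_) bot_le
    rw [zero_add]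
    obtain ⟨j, hj⟩ := ENNReal.exists_inv_nat_lt (ENNReal.coe_ne_zero.2 hη.ne')
    calc μ n Zᶜ ≤ μ n (K j)ᶜ :=
          measure_mono (Set.compl_subset_compl.2 ((Set.subset_iUnion K j).trans subset_closure))
      _ ≤ ((j : ENNReal) + 1)⁻¹ := hKμ j _ ⟨n, rfl⟩
      _ ≤ (j : ENNReal)⁻¹ := ENNReal.inv_le_inv.2 le_self_add
      _ ≤ η := hj.le
  have hrest : ∀ n, (μ n).restrict Z = μ n := fun n =>
    Measure.restrict_eq_self_of_ae_mem (by rw [ae_iff]; exact hZ0 n)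
  set ν : ℕ → Measure Z := fun n => (μ n).comap Subtype.val with hν
  have hmap : ∀ n, (ν n).map Subtype.val = μ n := fun n => by
    rw [hν, map_comap_subtype_coe hZm, hrest]
  have hp : ∀ n, IsProbabilityMeasure (ν n) := fun n => by
    constructor
    have := congrArg (fun m : Measure X => m Set.univ) (hmap n)
    simp only [measure_univ] at this
    rwa [Measure.map_apply measurable_subtype_coe MeasurableSet.univ, Set.preimage_univ] at this
  have htight : IsTightMeasureSet {m | ∃ n, m = ν n} := by
    rw [isTightMeasureSet_iff_exists_isCompact_measure_compl_le]
    intro η hη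
    obtain ⟨C, hC, hCμ⟩ := ht η hη
    refine ⟨Subtype.val ⁻¹' closure C, ?_, ?_⟩
    · exact (isClosed_closure.isClosedEmbedding_subtypeVal).isCompact_preimage hC.closure
    · rintro _ ⟨n, rfl⟩
      rw [← Set.preimage_compl, ← Measure.map_apply measurable_subtype_coe
        isClosed_closure.measurableSet.compl, hmap]
      exact (measure_mono (Set.compl_subset_compl.2 subset_closure)).trans (hCμ _ ⟨n, rfl⟩)
  obtain ⟨φ, Q, hφ, hQ, h⟩ := exists_subseq_tendsto_integral_of_separable ν htight
  refine ⟨φ, Q.map Subtype.val, hφ,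
    Measure.isProbabilityMeasure_map measurable_subtype_coe.aemeasurable, fun f => ?_⟩
  have h1 := h (f.compContinuous ⟨Subtype.val, continuous_subtype_val⟩)
  have e : ∀ m : Measure Z, ∫ x, f x ∂m.map Subtype.val = ∫ z : Z, f z ∂m := fun m =>
    integral_map measurable_subtype_coe.aemeasurable f.continuous.measurable.aestronglyMeasurable
  rw [e]
  refine h1.congr fun k => ?_
  rw [← hmap (φ k), e]
  rfl

end Prokhorov

/-! ### Tightness -/

theorem summable_inv_bracketSq_sq : Summable fun n : Fin 2 → ℤ => (bracketSq n ^ 2)⁻¹ := by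
  refine (summable_sobolevWeight (s := -2) (by norm_num)).congr fun n => ?_
  rw [sobolevWeight_eq, Real.rpow_neg (bracketSq_pos n).le, Real.rpow_two]

/-- Markov's inequality at height `e^A (1 + |n|²)⁴` against an expectation `O((1 + |n|²)²)` leaves
`(1 + |n|²)^{-2}`, summable over `ℤ²`. The exponent `4` chosen here becomes the factor `4` in
`logBound`. -/
theorem exists_measure_modeBound_le (C : NNReal) {ε : ℝ} (hε₀ : 0 < ε) (hε₁ : ε < 1) {T : ℝ}
    (hT : 0 ≤ T) :
    ∃ S : NNReal, ∀ (A : ℝ) (N : ℕ) {k : Torus → Plane} {k' : Torus → Plane →L[ℝ] Plane},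
      IsRegularKernel k k' → (∀ x, ‖k x‖ₑ ≤ C * singWeight (2 - ε) x) →
        paramLaw N (⋃ n, {p | ENNReal.ofReal (Real.exp A * bracketSq n ^ 4) ≤ modeBound k T 1 n p} ∪
          {p | ENNReal.ofReal (Real.exp A * bracketSq n ^ 4) ≤ modeBound k T (-Complex.I) n p}) ≤
            S * ENNReal.ofReal (Real.exp (-A)) := by
  obtain ⟨M, hM⟩ := exists_lintegral_modeRate_le C hε₀ hε₁
  set I : ENNReal := ∑' n : Fin 2 → ℤ, ENNReal.ofReal (bracketSq n ^ 2)⁻¹ with hI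
  have hIt : I ≠ ⊤ := summable_inv_bracketSq_sq.tsum_ofReal_ne_top
  set c : ENNReal := (1 + ENNReal.ofReal T) * M with hc
  have hct : c ≠ ⊤ := ENNReal.mul_ne_top (ENNReal.add_ne_top.2
    ⟨ENNReal.one_ne_top, ENNReal.ofReal_ne_top⟩) ENNReal.coe_ne_top
  have hSt : 2 * c * I ≠ ⊤ := ENNReal.mul_ne_top (ENNReal.mul_ne_top ENNReal.ofNat_ne_top hct) hIt
  refine ⟨(2 * c * I).toNNReal, fun A N k k' h hk => ?_⟩
  rw [ENNReal.coe_toNNReal hSt]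
  have key : ∀ (u : ℂ) (n : Fin 2 → ℤ), ‖u‖ ≤ 1 →
      paramLaw N {p | ENNReal.ofReal (Real.exp A * bracketSq n ^ 4) ≤ modeBound k T u n p} ≤
        c * ENNReal.ofReal (bracketSq n ^ 2)⁻¹ * ENNReal.ofReal (Real.exp (-A)) := fun u n hu => by
    have hb := bracketSq_pos n
    have hpos : 0 < Real.exp A * bracketSq n ^ 4 := by positivity
    refine (meas_ge_le_lintegral_div (h.measurable_modeBound hT u n).aemeasurable
      (ENNReal.ofReal_pos.2 hpos).ne' ENNReal.ofReal_ne_top).trans ?_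
    rw [h.lintegral_modeBound hT]
    refine ENNReal.div_le_of_le_mul ?_
    have e : ENNReal.ofReal (bracketSq n ^ 2)⁻¹ * ENNReal.ofReal (Real.exp (-A)) *
        ENNReal.ofReal (Real.exp A * bracketSq n ^ 4) = ENNReal.ofReal (bracketSq n ^ 2) := by
      rw [← ENNReal.ofReal_mul (by positivity), ← ENNReal.ofReal_mul (by positivity), Real.exp_neg]
      congr 1
      field_simp
    rw [mul_assoc c, mul_assoc c, e, hc, mul_assoc]
    exact mul_le_mul_right (hM N h hk u n hu) _
  refine (measure_iUnion_le _).trans ?_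
  have h2 : ∀ n : Fin 2 → ℤ, paramLaw N
      ({p | ENNReal.ofReal (Real.exp A * bracketSq n ^ 4) ≤ modeBound k T 1 n p} ∪
        {p | ENNReal.ofReal (Real.exp A * bracketSq n ^ 4) ≤ modeBound k T (-Complex.I) n p}) ≤
      2 * c * ENNReal.ofReal (Real.exp (-A)) * ENNReal.ofReal (bracketSq n ^ 2)⁻¹ := fun n => by
    refine (measure_union_le _ _).trans ((add_le_add (key 1 n (by simp))
      (key (-Complex.I) n (by simp))).trans_eq ?_)
    ring
  refine (ENNReal.tsum_le_tsum h2).trans_eq ?_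
  rw [ENNReal.tsum_mul_left]
  ring

/-- One compact set serves all `N` and all regular kernels with the same singular bound; this
uniformity lets the estimate pass to the untruncated dynamics. -/
theorem exists_isCompact_measure_path_le (C : NNReal) {ε : ℝ} (hε₀ : 0 < ε) (hε₁ : ε < 1) {T : ℝ}
    (hT : 0 ≤ T) {η : ENNReal} (hη : 0 < η) :
    ∃ K : Set (PathSpace T), IsCompact K ∧ IsClosed K ∧
      ∀ (N : ℕ) {k : Torus → Plane} {k' : Torus → Plane →L[ℝ] Plane} (h : IsRegularKernel k k'),
        (∀ x, ‖k x‖ₑ ≤ C * singWeight (2 - ε) x) →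
          paramLaw N {p | h.path T N p ∉ K} ≤ η := by
  obtain ⟨S, hS⟩ := exists_measure_modeBound_le C hε₀ hε₁ hT
  have h1 : Tendsto (fun A : ℝ => S * ENNReal.ofReal (Real.exp (-A))) atTop (𝓝 0) := by
    have e1 : Tendsto (fun A : ℝ => Real.exp (-A)) atTop (𝓝 0) :=
      Real.tendsto_exp_atBot.comp tendsto_neg_atTop_atBot
    have e2 := ENNReal.Tendsto.const_mul (a := (S : ENNReal)) (ENNReal.tendsto_ofReal e1)
      (Or.inr ENNReal.coe_ne_top)
    simpa using e2
  obtain ⟨A, hAη, hA1⟩ := ((h1.eventually_lt_const hη).and (eventually_ge_atTop 1)).exists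
  obtain ⟨K, hK, hKu⟩ := exists_isCompact_pathSpace T A hA1
    fun n => 2 * (1 + Real.exp A * bracketSq n ^ 4)
  refine ⟨closure K, hK.closure, isClosed_closure, fun N k k' h hk => ?_⟩
  refine (measure_mono fun p hp => ?_).trans ((hS A N h hk).trans hAη.le)
  by_contra hcon
  simp only [Set.mem_iUnion, Set.mem_union, Set.mem_ofPred_eq, not_exists, not_or, not_le] at hcon
  have h2 := fun n => h.norm_fourierCoeff_path_le (hcon n).1.le (hcon n).2.le
  exact hp (subset_closure (hKu _ (fun t n => (h2 n).1 t) fun s t n => (h2 n).2 s t))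

theorem isTightMeasureSet_thetaLaw (c : ℝ) {ε : ℝ} (hε₀ : 0 < ε) (hε₁ : ε < 1) {T : ℝ}
    (hT : 0 ≤ T) : IsTightMeasureSet {Q | ∃ N : ℕ, Q = thetaLaw c ε T N} := by
  rw [isTightMeasureSet_iff_exists_isCompact_measure_compl_le]
  intro η hη
  obtain ⟨C, hC⟩ := exists_enorm_torusKernel_le c hε₀ hε₁
  obtain ⟨K, hK, hKc, hKp⟩ := exists_isCompact_measure_path_le C hε₀ hε₁ hT hη
  refine ⟨K, hK, ?_⟩
  rintro _ ⟨N, rfl⟩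
  rw [thetaLaw, Measure.map_apply_of_aemeasurable (aemeasurable_theta c hε₀ hε₁ N hT)
    hKc.measurableSet.compl]
  set path := fun m => (isRegularKernel_cutoff c hε₁ m).path T N with hpath
  -- Almost surely `theta` is the truncated path for all fine cut-offs, so the event that it leaves
  -- `K` is covered by the increasing sets `E m`, each of measure at most `η`.
  set E : ℕ → Set (Fin N → ℝ × Torus) := fun m =>
    {v | ∀ k, m ≤ k → path k (splitParam v) ∉ K} with hE
  have hmono : Monotone E := fun m m' hm v hv k hk => hv k (hm.trans hk)
  have hsub : (theta c ε T N ⁻¹' Kᶜ : Set _) ≤ᵐ[initialLaw N] ⋃ m, E m := by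
    filter_upwards [ae_eventually_theta_eq c hε₀ hε₁ N hT] with v hv hvK
    obtain ⟨m, hm⟩ := eventually_atTop.1 hv
    refine Set.mem_iUnion.2 ⟨m, fun k hk hcon => hvK ?_⟩
    rw [hm k hk]
    exact hcon
  refine (measure_mono_ae hsub).trans ?_
  rw [hmono.measure_iUnion]
  refine iSup_le fun m => ?_
  have hEm : E m ⊆ splitParam ⁻¹' {p | path m p ∉ K} := fun v hv => hv m le_rfl
  refine (measure_mono hEm).trans ?_
  have hs := measurePreserving_splitParam N
  refine (Measure.le_map_apply hs.measurable.aemeasurable _).trans ?_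
  rw [hs.map_eq]
  exact hKp N (isRegularKernel_cutoff c hε₁ m)
    (hC _ (cutoff_pos m) (by linarith [cutoff_lt m]))

theorem isProbabilityMeasure_thetaLaw (c : ℝ) {ε : ℝ} (hε₀ : 0 < ε) (hε₁ : ε < 1) {T : ℝ}
    (hT : 0 ≤ T) (N : ℕ) : IsProbabilityMeasure (thetaLaw c ε T N) :=
  Measure.isProbabilityMeasure_map (aemeasurable_theta c hε₀ hε₁ N hT)

end PointVortex

end

/-! ### Well-posedness, tightness and subsequential convergence. -/

theorem mainTheorem5 (ε : ℝ) (hε₀ : 0 < ε) (hε₁ : ε < 1) (c : ℝ) (hc : c ≠ 0)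
    (T : ℝ) (hT : 0 < T) :
    -- `θ^N` is well defined almost surely, and is a random element of the path space
    (∀ N : ℕ, 1 ≤ N →
      (∀ᵐ v ∂PointVortex.initialLaw N, ∃ X : ℝ → Fin N → PointVortex.Torus,
        PointVortex.IsVortexSolution c ε v X ∧
        (∀ X', PointVortex.IsVortexSolution c ε v X' → ∀ t, 0 ≤ t → X' t = X t) ∧
        ∀ t : Set.Icc (0 : ℝ) T,
          (PointVortex.theta c ε T N v t).toDistribution = PointVortex.vortexField v (X t)) ∧
      AEMeasurable (PointVortex.theta c ε T N) (PointVortex.initialLaw N)) ∧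
    -- the laws `Q_N` are tight
    IsTightMeasureSet {Q | ∃ N : ℕ, 1 ≤ N ∧ Q = PointVortex.thetaLaw c ε T N} ∧
    -- a subsequence of `Q_N` converges weakly to a probability measure `Q`
    ∃ (N : ℕ → ℕ) (Q : Measure (PointVortex.PathSpace T)), StrictMono N ∧ (∀ k, 1 ≤ N k) ∧
      IsProbabilityMeasure Q ∧
      ∀ f : BoundedContinuousFunction (PointVortex.PathSpace T) ℝ,
        Tendsto (fun k => ∫ u, f u ∂PointVortex.thetaLaw c ε T (N k)) atTop
          (𝓝 (∫ u, f u ∂Q)) := by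
  refine ⟨fun N _ => ⟨?_, PointVortex.aemeasurable_theta c hε₀ hε₁ N hT.le⟩,
    (PointVortex.isTightMeasureSet_thetaLaw c hε₀ hε₁ hT.le).subset ?_, ?_⟩
  · filter_upwards [PointVortex.ae_exists_isVortexSolution c hε₀ hε₁ N] with v ⟨X, hX⟩
    exact ⟨X, hX, fun X' hX' t ht => hX.unique hε₁ hX' ht, hX.theta_apply hε₁ hT.le⟩
  · rintro _ ⟨N, _, rfl⟩
    exact ⟨N, rfl⟩
  -- Weak convergence depends on the topology only, so any compatible pseudometric will do. The
  -- index shift by one keeps the number of vortices positive.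
  · let _ : PseudoMetricSpace (PointVortex.PathSpace T) :=
      TopologicalSpace.pseudoMetrizableSpacePseudoMetric _
    have _ := fun k : ℕ =>
      PointVortex.isProbabilityMeasure_thetaLaw c hε₀ hε₁ hT.le (k + 1)
    obtain ⟨φ, Q, hφ, hQ, h⟩ := PointVortex.exists_subseq_tendsto_integral
      (fun k => PointVortex.thetaLaw c ε T (k + 1))
      ((PointVortex.isTightMeasureSet_thetaLaw c hε₀ hε₁ hT.le).subset
        (by rintro _ ⟨n, rfl⟩; exact ⟨n + 1, rfl⟩))
    exact ⟨fun k => φ k + 1, Q, fun a b hab => Nat.add_lt_add_right (hφ hab) 1,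
      fun k => Nat.le_add_left 1 _, hQ, h⟩
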